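/- Let $\delta>0$ and let $u_0:\mathbb{R}\to\mathbb{R}$ be an admissible initial condition: $u_0\in C^1(\mathbb{R})$, $u_0>0$, $u_0(x)\to0$ as $x\to\pm\infty$, $u_0$ has a single lobe with maximum $u_{\max}=u_0(x_{\max})$ and $u_0'(x)\ne0$ for $x\ne x_{\max}$, and $\int_{\mathbb{R}}(x^2+1)u_0(x)\,dx<\infty$. Notation. $W_0,W_{-1}$ are the standard branches of the Lambert function (values on the cuts being continuous from above). Put $\zeta(\kappa)=\kappa\cot(2\delta\kappa)+i\kappa$ for $0<\kappa<\pi/2\delta$, $\zeta(0)=1/2\delta$, and $\zeta_{\max}=-\tfrac1{2\delta}W_{-1}(-e^{2\delta u_{\max}-1})$, $\kappa_{\max}=\operatorname{Im}\zeta_{\max}$. For $\zeta=\zeta(\kappa)$ with $0<\kappa\le\kappa_{\max}$ let $E(\zeta)=-\zeta+\tfrac1{2\delta}(1+\log(2\delta\zeta))\in\mathbb{R}$ and let $x_-(\zeta)\le x_{\max}\le x_+(\zeta)$ be the solutions of $u_0(x_\pm(\zeta))=E(\zeta)$ (with $x_\pm=\pm\infty$ for $\zeta=1/2\delta$). With $a(\zeta,u)=-2\delta\zeta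 e^{-2\delta(\zeta+u)}$ set $$R(\zeta)=\frac1{4\delta}\int_{x_-(\zeta)}^{x_+(\zeta)}\big[W_0(a(\zeta,u_0(x)))-W_{-1}(a(\zeta,u_0(x)))\big]dx,\qquad \rho^{\mathrm{Wyl}}(\kappa)=-\frac{d}{d\kappa}R(\zeta(\kappa))\quad(0<\kappa<\kappa_{\max}),$$ $$\theta_+(\zeta)=\operatorname{Im}(\zeta)\,x_+(\zeta)+\int_{x_+(\zeta)}^{\infty}\operatorname{Im}\Big(\zeta+\frac1{2\delta}W_{-1}(a(\zeta,u_0(x)))\Big)dx,\qquad \theta_+(1/2\delta)=0,$$ $$V(\zeta;x,t)=x\operatorname{Im}\zeta+t\operatorname{Im}\big((\zeta-\tfrac1{2\delta})^2\big)-\theta_+(\zeta).$$ Discrete energies. For $N\ge1$ let $\epsilon_N=R(1/2\delta)/(\pi N)$ and let $\kappa_n\in[0,\kappa_{\max}]$, $1\le n\le N$, be determined by $R(\zeta(\kappa_n))=\pi(n-\tfrac12)\epsilon_N$. For $S\subseteq\{1,\dots,N\}$ let $\mu_S=\epsilon_N\pi\sum_{n\in S}\delta_{\kappa_n}$ and $$E_{N,S}(x,t)=\int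 V(\zeta(\kappa);x,t)\,d\mu_S(\kappa)+\frac1{2\pi}\iint g(\zeta(\kappa),\zeta(\eta))\,d\mu_S(\kappa)\,d\mu_S(\eta),\qquad E_N^{\min}(x,t)=\min_{S}E_{N,S}(x,t),$$ where $g(\zeta,\lambda)=\log\left|\frac{\zeta-\lambda^*}{\zeta-\lambda}\right|$ if $\zeta\ne\lambda$ and $g(\zeta,\zeta)=\log|\zeta-\zeta^*|$. Continuum energy. Let $\mathcal{A}$ be the set of real measurable functions $\rho$ on $[0,\kappa_{\max}]$ with $0\le\rho\le\rho^{\mathrm{Wyl}}$ (the upper bound being imposed on $(0,\kappa_{\max})$, where $\rho^{\mathrm{Wyl}}$ is defined), and for $\rho\in\mathcal{A}$ let $$\mathcal{E}[\rho](x,t)=\int_0^{\kappa_{\max}}\Big(V(\zeta(\kappa);x,t)+\tfrac12\mathcal{L}[\rho](\zeta(\kappa))\Big)\rho(\kappa)\,d\kappa,\qquad \mathcal{L}[\rho](\lambda)=\frac1\pi\int_0^{\kappa_{\max}}\log\left|\frac{\lambda-\zeta(\eta)^*}{\lambda-\zeta(\eta)}\right|\rho(\eta)\,d\eta.$$ Theorem.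 For every $\rho\in\mathcal{A}$ and every $(x,t)\in\mathbb{R}^2$ the integrals defining $\mathcal{L}[\rho](\zeta(\kappa))$, $0\le\kappa\le\kappa_{\max}$, and $\mathcal{E}[\rho](x,t)$ converge absolutely. For every $(x,t)\in\mathbb{R}^2$ the functional $\mathcal{E}[\,\cdot\,](x,t)$ attains its minimum $E_\infty^{\min}(x,t)=\min_{\rho\in\mathcal{A}}\mathcal{E}[\rho](x,t)$ on $\mathcal{A}$. Moreover $$\lim_{N\to\infty}E_N^{\min}(x,t)=E_\infty^{\min}(x,t)$$ uniformly on compact subsets of $(x,t)\in\mathbb{R}^2$. -/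

import Mathlib

open MeasureTheory Filter Topology

noncomputable section

namespace ILW

/-! ### Two standard branches of the Lambert function -/

/-- The range of the principal branch `W₀`: the region to the right of the curve
`re w = -im w * cot (im w)`, `|im w| < π`, together with the part `im w ≥ 0` of that curve
(values on the cut are continuous from above). -/
def lambertRange0 : Set ℂ :=
  {w | (w.im = 0 ∧ -1 ≤ w.re) ∨
    (0 < w.im ∧ w.im < Real.pi ∧ -w.im * Real.cot w.im ≤ w.re) ∨
    (-Real.pi < w.im ∧ w.im < 0 ∧ -w.im * Real.cot w.im < w.re)}

/-- The range of the branch `W₋₁` (values on the cuts are continuous from above). -/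
def lambertRangeNeg1 : Set ℂ :=
  {w | (w.im = 0 ∧ w.re ≤ -1) ∨
    (-Real.pi < w.im ∧ w.im < 0 ∧ w.re ≤ -w.im * Real.cot w.im) ∨
    (-(2 * Real.pi) ≤ w.im ∧ w.im ≤ -Real.pi) ∨
    (-(3 * Real.pi) < w.im ∧ w.im < -(2 * Real.pi) ∧ -w.im * Real.cot w.im < w.re)}

open Classical in
/-- The inverse of `w ↦ w * exp w` with values in the set `D`. -/
def lambertInverse (D : Set ℂ) (z : ℂ) : ℂ :=
  if h : ∃ w ∈ D, w * Complex.exp w = z then Classical.choose h else 0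

/-- The branch `W₀`. -/
def lambertW0 (z : ℂ) : ℂ := lambertInverse lambertRange0 z

/-- The branch `W₋₁`. -/
def lambertWNeg1 (z : ℂ) : ℂ := lambertInverse lambertRangeNeg1 z

/-! ### Initial data, the quadratrix, the Weyl law -/

/-- Admissible initial conditions: positive `C¹` functions with a single lobe, decaying to zero,
whose derivative vanishes only at the maximizer, with `∫ (x² + 1) u₀(x) dx < ∞`. -/
structure Admissible (u₀ : ℝ → ℝ) : Prop where
  contDiff : ContDiff ℝ 1 u₀
  pos : ∀ x, 0 < u₀ x
  tendsto_atTop : Tendsto u₀ atTop (𝓝 0)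
  tendsto_atBot : Tendsto u₀ atBot (𝓝 0)
  single_lobe : ∃ xmax : ℝ, (∀ x, u₀ x ≤ u₀ xmax) ∧ StrictMonoOn u₀ (Set.Iic xmax) ∧
    StrictAntiOn u₀ (Set.Ici xmax) ∧ ∀ x, x ≠ xmax → deriv u₀ x ≠ 0
  integrable : Integrable (fun x => (x ^ 2 + 1) * u₀ x)

/-- The maximal value of `u₀`. -/
def uMax (u₀ : ℝ → ℝ) : ℝ := ⨆ x, u₀ x

/-- The quadratrix `ζ(κ) = κ cot(2δκ) + iκ`, with `ζ(0) = 1/(2δ)` by continuity. -/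
def zeta (δ κ : ℝ) : ℂ :=
  if κ = 0 then ((1 / (2 * δ) : ℝ) : ℂ) else ⟨κ * Real.cot (2 * δ * κ), κ⟩

/-- The level `E(ζ) = -ζ + (1 + log(2δζ))/(2δ)`, which is real on the quadratrix. -/
def level (δ : ℝ) (ζ : ℂ) : ℝ :=
  (-ζ + (1 + Complex.log (2 * δ * ζ)) / (2 * δ)).re

/-- The right turning point: the largest solution `x` of `u₀(x) = E(ζ)`. -/
def xPlus (δ : ℝ) (u₀ : ℝ → ℝ) (ζ : ℂ) : ℝ := sSup {x | u₀ x = level δ ζ}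

/-- The left turning point: the smallest solution `x` of `u₀(x) = E(ζ)`. -/
def xMinus (δ : ℝ) (u₀ : ℝ → ℝ) (ζ : ℂ) : ℝ := sInf {x | u₀ x = level δ ζ}

open Classical in
/-- The interval between the turning points; it is the whole line at the vertex `ζ = 1/(2δ)`,
where the turning points are `±∞`. -/
def allowedRegion (δ : ℝ) (u₀ : ℝ → ℝ) (ζ : ℂ) : Set ℝ :=
  if ζ = zeta δ 0 then Set.univ else Set.Icc (xMinus δ u₀ ζ) (xPlus δ u₀ ζ)

/-- The argument `-2δζ exp(-2δ(ζ + u))` of the Lambert functions. -/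
def lambertArg (δ : ℝ) (ζ : ℂ) (u : ℝ) : ℂ :=
  -2 * δ * ζ * Complex.exp (-2 * δ * (ζ + u))

/-- The Weyl function `R(ζ)`; the integrand is real on the allowed region. -/
def RWyl (δ : ℝ) (u₀ : ℝ → ℝ) (ζ : ℂ) : ℝ :=
  1 / (4 * δ) * ∫ x in allowedRegion δ u₀ ζ,
    (lambertW0 (lambertArg δ ζ (u₀ x)) - lambertWNeg1 (lambertArg δ ζ (u₀ x))).re

/-- The top end `ζ_max = -W₋₁(-exp(2δ u_max - 1))/(2δ)` of the spectral arc. -/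
def zetaMax (δ : ℝ) (u₀ : ℝ → ℝ) : ℂ :=
  -(1 / (2 * δ)) * lambertWNeg1 (-Complex.exp (2 * δ * uMax u₀ - 1))

def kappaMax (δ : ℝ) (u₀ : ℝ → ℝ) : ℝ := (zetaMax δ u₀).im

/-- The Weyl density `ρ(κ) = -d/dκ R(ζ(κ))`, for `0 < κ < κ_max`. -/
def rhoWyl (δ : ℝ) (u₀ : ℝ → ℝ) (κ : ℝ) : ℝ :=
  -deriv (fun s => RWyl δ u₀ (zeta δ s)) κ

/-- The tail integral `θ₊(ζ)`. -/
def thetaPlus (δ : ℝ) (u₀ : ℝ → ℝ) (ζ : ℂ) : ℝ :=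
  ζ.im * xPlus δ u₀ ζ + ∫ x in Set.Ioi (xPlus δ u₀ ζ),
    (ζ + 1 / (2 * δ) * lambertWNeg1 (lambertArg δ ζ (u₀ x))).im

/-! ### The discrete energies -/

/-- `ε_N = R(1/(2δ)) / (π N)`. -/
def eps (δ : ℝ) (u₀ : ℝ → ℝ) (N : ℕ) : ℝ :=
  1 / (Real.pi * N) * RWyl δ u₀ (zeta δ 0)

/-- `κ_n = im ζ_n`, where `ζ_n = ζ(κ_n)` is the solution of `R(ζ_n) = π (n - 1/2) ε_N` on the
arc `0 ≤ κ ≤ κ_max`, along which `R` is strictly decreasing. -/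
def kappa (δ : ℝ) (u₀ : ℝ → ℝ) (N n : ℕ) : ℝ :=
  sSup {κ | κ ∈ Set.Icc 0 (kappaMax δ u₀) ∧
    RWyl δ u₀ (zeta δ κ) = Real.pi * ((n : ℝ) - 1 / 2) * eps δ u₀ N}

/-- The point measure `μ_S = ε_N π ∑_{n ∈ S} δ_{κ_n}`. -/
def muS (δ : ℝ) (u₀ : ℝ → ℝ) (N : ℕ) (S : Finset ℕ) : Measure ℝ :=
  ENNReal.ofReal (eps δ u₀ N * Real.pi) • ∑ n ∈ S, Measure.dirac (kappa δ u₀ N n)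

/-- The external potential `V(ζ; x, t)`. -/
def V (δ : ℝ) (u₀ : ℝ → ℝ) (ζ : ℂ) (x t : ℝ) : ℝ :=
  x * ζ.im + t * ((ζ - 1 / (2 * δ)) ^ 2).im - thetaPlus δ u₀ ζ

open Classical in
/-- The regulated Green's function of the upper half-plane. -/
def greenReg (ζ ξ : ℂ) : ℝ :=
  if ζ = ξ then Real.log ‖ζ - starRingEnd ℂ ξ‖
  else Real.log ‖(ζ - starRingEnd ℂ ξ) / (ζ - ξ)‖

/-- The discrete energy `E_{N,S}(x, t)`. -/
def discreteEnergy (δ : ℝ) (u₀ : ℝ → ℝ) (N : ℕ) (S : Finset ℕ) (x t : ℝ) : ℝ :=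
  (∫ κ, V δ u₀ (zeta δ κ) x t ∂(muS δ u₀ N S)) +
    1 / (2 * Real.pi) *
      ∫ κ, (∫ η, greenReg (zeta δ κ) (zeta δ η) ∂(muS δ u₀ N S)) ∂(muS δ u₀ N S)

/-- The discrete minimum `E_N^min(x, t)`, over all `S ⊆ {1, …, N}`. -/
def discreteMin (δ : ℝ) (u₀ : ℝ → ℝ) (N : ℕ) (x t : ℝ) : ℝ :=
  (Finset.Icc 1 N).powerset.inf' ⟨∅, Finset.empty_mem_powerset _⟩
    (fun S => discreteEnergy δ u₀ N S x t)

/-! ### The continuum energy -/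

/-- The admissible densities: measurable, `0 ≤ ρ` on `[0, κ_max]`, and `ρ ≤ ρ^Wyl` at the points
`0 < κ < κ_max` where `ρ^Wyl` is defined. -/
def admissibleDensities (δ : ℝ) (u₀ : ℝ → ℝ) : Set (ℝ → ℝ) :=
  {ρ | Measurable ρ ∧ (∀ κ ∈ Set.Icc 0 (kappaMax δ u₀), 0 ≤ ρ κ) ∧
    ∀ κ ∈ Set.Ioo 0 (kappaMax δ u₀), ρ κ ≤ rhoWyl δ u₀ κ}

/-- The integrand of the Green potential of `ρ`, as a function of `η`. -/
def potentialIntegrand (δ : ℝ) (ρ : ℝ → ℝ) (ξ : ℂ) (η : ℝ) : ℝ :=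
  Real.log ‖(ξ - starRingEnd ℂ (zeta δ η)) / (ξ - zeta δ η)‖ * ρ η

/-- The Green potential `L[ρ](ξ)`. -/
def potential (δ : ℝ) (u₀ : ℝ → ℝ) (ρ : ℝ → ℝ) (ξ : ℂ) : ℝ :=
  1 / Real.pi * ∫ η in Set.Icc 0 (kappaMax δ u₀), potentialIntegrand δ ρ ξ η

/-- The integrand `(V + L[ρ]/2) ρ` of the continuum energy, as a function of `κ`. -/
def energyIntegrand (δ : ℝ) (u₀ : ℝ → ℝ) (ρ : ℝ → ℝ) (x t κ : ℝ) : ℝ :=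
  (V δ u₀ (zeta δ κ) x t + 1 / 2 * potential δ u₀ ρ (zeta δ κ)) * ρ κ

/-- The continuum energy `𝓔[ρ](x, t)`. -/
def energy (δ : ℝ) (u₀ : ℝ → ℝ) (ρ : ℝ → ℝ) (x t : ℝ) : ℝ :=
  ∫ κ in Set.Icc 0 (kappaMax δ u₀), energyIntegrand δ u₀ ρ x t κ

/-- The continuum minimum `E_∞^min(x, t)`. -/
def continuumMin (δ : ℝ) (u₀ : ℝ → ℝ) (x t : ℝ) : ℝ :=
  sInf ((fun ρ => energy δ u₀ ρ x t) '' admissibleDensities δ u₀)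

end ILW

end

noncomputable section

namespace ILW

/-! ### Cells and nodes of a uniform partition -/

/-! The value s = R(ζ(κ)) of the Weyl function serves as spectral coordinate. On [0, κ_max] it
decreases continuously from L = R(1/2δ) to 0, and it carries ρ^Wyl dκ to Lebesgue measure on (0, L]
(`map_eq_withDensity`). Admissible densities become functions f with 0 ≤ f ≤ 1, the κ_n become the
midpoints of N equal cells, and the mass ε_N π is exactly the cell length h = L/N. Both
minimizations then concern one quadratic functional, with a potential continuous on [0, L] and a
kernel singular only on the diagonal.

Freezing potential and kernel at the midpoints and dropping the diagonal cells changes the energy of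
f by at most L¹ distances that do not depend on f, because |f| ≤ 1, and that vanish by dominated
convergence (`exists_potential_error`, `SingularKernel.exists_error`). The frozen energy sees f only
through its cell masses, a point of the cube [0, h]^N. A set S is the step density with masses 0 or
h, which bounds the continuum minimum by the discrete one. Conversely, without its diagonal the
frozen energy is affine in each mass, so the masses of a continuum minimizer can be rounded one at a
time to a vertex without raising the energy (`exists_vertex_le`). No positivity of the kernel
enters. The regulated diagonal terms total O(√h), and V is affine in (x, t), whence local
uniformity.

Existence of minimizers comes from the same approximation: it exhibits the energy as a uniform limit
of continuous functions on the primitives of densities, a compact set for pointwise convergence.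

The analytic input is the regularity of R. On the quadratrix the Lambert argument is real and
negative, and R is an integral of `gap (2δu₀ - ell)`. Here `gap` is 1/2-Hölder, because of the
branch point at -1/e, and `ell` is Lipschitz; interpolation against the integrable function u₀^(2/5)
makes R Hölder of exponent 1/10. Hence the inverse Φ satisfies |Φ(s) - Φ(t)| ≥ c|s - t|^10, and the
logarithm in the Green kernel turns this into the integrable singularity |s - t|^(-1/2). The
fundamental theorem of calculus for each x, with Tonelli, shows that R has no singular part. -/

/-- The index `n` of the cell `((n - 1) h, n h]` that contains `s`. -/
def cellIdx (h s : ℝ) : ℕ := ⌈s / h⌉₊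

/-- The midpoint of the cell `((n - 1) h, n h]`. -/
def node (h : ℝ) (n : ℕ) : ℝ := ((n : ℝ) - 1 / 2) * h

lemma measurable_cellIdx (h : ℝ) : Measurable (cellIdx h) :=
  Nat.measurable_ceil.comp (measurable_id.div_const h)

lemma cellIdx_eq_iff {h s : ℝ} (hh : 0 < h) (n : ℕ) (hn : 1 ≤ n) :
    cellIdx h s = n ↔ s ∈ Set.Ioc (((n : ℝ) - 1) * h) (n * h) := by
  unfold cellIdx
  rw [Nat.ceil_eq_iff (by omega), lt_div_iff₀ hh, div_le_iff₀ hh, Nat.cast_sub hn]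
  simp

lemma one_le_cellIdx {h s : ℝ} (hh : 0 < h) (hs : 0 < s) : 1 ≤ cellIdx h s :=
  Nat.one_le_ceil_iff.2 (div_pos hs hh)

lemma mem_cell {h s : ℝ} (hh : 0 < h) (hs : 0 < s) :
    s ∈ Set.Ioc (((cellIdx h s : ℝ) - 1) * h) (cellIdx h s * h) :=
  (cellIdx_eq_iff hh _ (one_le_cellIdx hh hs)).1 rfl

lemma cellIdx_mem {L : ℝ} {N : ℕ} (hL : 0 < L) (hN : 1 ≤ N) {s : ℝ} (hs : s ∈ Set.Ioc 0 L) :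
    cellIdx (L / N) s ∈ Finset.Icc 1 N := by
  have hN' : (0 : ℝ) < N := by exact_mod_cast hN
  have hh : 0 < L / N := div_pos hL hN'
  refine Finset.mem_Icc.2 ⟨one_le_cellIdx hh hs.1, Nat.ceil_le.2 ?_⟩
  rw [div_le_iff₀ hh, mul_div_cancel₀ _ hN'.ne']
  exact hs.2

lemma node_mem {L : ℝ} {N n : ℕ} (hL : 0 < L) (hn : n ∈ Finset.Icc 1 N) :
    node (L / N) n ∈ Set.Ioo 0 L := by
  obtain ⟨h1, h2⟩ := Finset.mem_Icc.1 hn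
  have hN' : (0 : ℝ) < N := by exact_mod_cast (by omega : 0 < N)
  have h1' : (1 : ℝ) ≤ n := by exact_mod_cast h1
  have h2' : (n : ℝ) ≤ N := by exact_mod_cast h2
  have hh : 0 < L / N := div_pos hL hN'
  have e : (N : ℝ) * (L / N) = L := mul_div_cancel₀ _ hN'.ne'
  constructor
  · exact mul_pos (by linarith) hh
  · calc node (L / N) n < N * (L / N) := mul_lt_mul_of_pos_right (by linarith) hh
      _ = L := e

lemma abs_node_cellIdx_sub_le {h s : ℝ} (hh : 0 < h) (hs : 0 < s) :
    |node h (cellIdx h s) - s| ≤ h / 2 := by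
  obtain ⟨h1, h2⟩ := mem_cell hh hs
  unfold node
  rw [abs_le]; constructor <;> nlinarith

lemma tendsto_div_nat (L : ℝ) : Tendsto (fun N : ℕ => L / N) atTop (𝓝 0) :=
  tendsto_const_div_atTop_nhds_zero_nat L

lemma tendsto_node {L s : ℝ} (hL : 0 < L) (hs : 0 < s) :
    Tendsto (fun N : ℕ => node (L / N) (cellIdx (L / N) s)) atTop (𝓝 s) := by
  rw [tendsto_iff_norm_sub_tendsto_zero]
  refine squeeze_zero' (Eventually.of_forall fun _ => norm_nonneg _) ?_
    (by simpa using (tendsto_div_nat L).div_const 2)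
  filter_upwards [eventually_ge_atTop 1] with N hN
  have hN' : (0 : ℝ) < N := by exact_mod_cast hN
  exact abs_node_cellIdx_sub_le (div_pos hL hN') hs

lemma node_sub_node (h : ℝ) (n m : ℕ) : node h n - node h m = ((n : ℝ) - m) * h := by
  unfold node; ring

/-- Each point is within h/2 of its node and distinct nodes are at least h apart, so |s - t| ≤ d + h
≤ 2d for the node distance d. The bound is uniform in h, which is what domination of the sampled
kernels requires. -/
lemma half_abs_sub_le_abs_node_sub {h s t : ℝ} (hh : 0 < h) (hs : 0 < s) (ht : 0 < t)
    (hne : cellIdx h s ≠ cellIdx h t) :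
    |s - t| / 2 ≤ |node h (cellIdx h s) - node h (cellIdx h t)| := by
  have h1 := abs_node_cellIdx_sub_le hh hs
  have h2 := abs_node_cellIdx_sub_le hh ht
  have h3 : h ≤ |node h (cellIdx h s) - node h (cellIdx h t)| := by
    rw [node_sub_node, abs_mul, abs_of_pos hh]
    have : (1 : ℝ) ≤ |(cellIdx h s : ℝ) - cellIdx h t| := by
      have : (1 : ℤ) ≤ |(cellIdx h s : ℤ) - cellIdx h t| :=
        Int.one_le_abs (sub_ne_zero.2 (by exact_mod_cast hne))
      exact_mod_cast this
    nlinarith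
  rw [abs_le] at h1 h2
  rcases abs_cases (s - t) with h4 | h4 <;>
  rcases abs_cases (node h (cellIdx h s) - node h (cellIdx h t)) with h5 | h5 <;> linarith

/-- The restriction of the Lebesgue measure to `(0, L]`. -/
abbrev lebIoc (L : ℝ) : Measure ℝ := volume.restrict (Set.Ioc 0 L)

/-- Integration of a step function against a density. -/
lemma integral_cellIdx_mul {L : ℝ} {N : ℕ} (hL : 0 < L) (hN : 1 ≤ N) (φ : ℕ → ℝ) {f : ℝ → ℝ}
    (hf : IntegrableOn f (Set.Ioc 0 L)) :
    ∫ s in Set.Ioc 0 L, φ (cellIdx (L / N) s) * f s =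
      ∑ n ∈ Finset.Icc 1 N, φ n * ∫ s in Set.Ioc (((n : ℝ) - 1) * (L / N)) (n * (L / N)), f s := by
  have hN' : (0 : ℝ) < N := by exact_mod_cast hN
  have hh : 0 < L / N := div_pos hL hN'
  have e : (N : ℝ) * (L / N) = L := mul_div_cancel₀ _ hN'.ne'
  have hsub : ∀ n ∈ Finset.Icc 1 N,
      Set.Ioc (((n : ℝ) - 1) * (L / N)) (n * (L / N)) ⊆ Set.Ioc 0 L := by
    intro n hn
    obtain ⟨h1, h2⟩ := Finset.mem_Icc.1 hn
    have h1' : (1 : ℝ) ≤ n := by exact_mod_cast h1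
    have h2' : (n : ℝ) ≤ N := by exact_mod_cast h2
    refine Set.Ioc_subset_Ioc (mul_nonneg (by linarith) hh.le) ?_
    calc (n : ℝ) * (L / N) ≤ N * (L / N) := mul_le_mul_of_nonneg_right h2' hh.le
      _ = L := e
  have h1 : ∀ s ∈ Set.Ioc 0 L, φ (cellIdx (L / N) s) * f s = ∑ n ∈ Finset.Icc 1 N,
      φ n * (Set.Ioc (((n : ℝ) - 1) * (L / N)) (n * (L / N))).indicator f s := by
    intro s hs
    rw [Finset.sum_eq_single_of_mem _ (cellIdx_mem hL hN hs),
      Set.indicator_of_mem (mem_cell hh hs.1)]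
    intro n hn hne
    rw [Set.indicator_of_notMem, mul_zero]
    intro hmem
    exact hne ((cellIdx_eq_iff hh n (Finset.mem_Icc.1 hn).1).2 hmem).symm
  rw [setIntegral_congr_fun measurableSet_Ioc h1, integral_finsetSum]
  · refine Finset.sum_congr rfl fun n hn => ?_
    rw [integral_const_mul, setIntegral_indicator measurableSet_Ioc,
      Set.inter_eq_self_of_subset_right (hsub n hn)]
  · intro n _
    exact (hf.integrable.indicator measurableSet_Ioc).const_mul _

/-- The set of densities with values in `[0, 1]`. -/
def unitDensities : Set (ℝ → ℝ) := {f | Measurable f ∧ ∀ s, 0 ≤ f s ∧ f s ≤ 1}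

lemma unitDensities.norm_le {f : ℝ → ℝ} (hf : f ∈ unitDensities) (s : ℝ) : ‖f s‖ ≤ 1 := by
  rw [Real.norm_eq_abs, abs_of_nonneg (hf.2 s).1]; exact (hf.2 s).2

lemma unitDensities.integrableOn {f : ℝ → ℝ} (hf : f ∈ unitDensities) (a b : ℝ) :
    IntegrableOn f (Set.Ioc a b) :=
  Measure.integrableOn_of_bounded (M := 1) measure_Ioc_lt_top.ne hf.1.aestronglyMeasurable
    (Eventually.of_forall fun s => unitDensities.norm_le hf s)

/-- The mass that a density gives to the `n`-th cell. -/
def cellMass (h : ℝ) (f : ℝ → ℝ) (n : ℕ) : ℝ := ∫ s in Set.Ioc (((n : ℝ) - 1) * h) (n * h), f s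

lemma cellMass_mem {h : ℝ} (hh : 0 < h) {f : ℝ → ℝ} (hf : f ∈ unitDensities) (n : ℕ) :
    cellMass h f n ∈ Set.Icc 0 h := by
  constructor
  · exact integral_nonneg fun s => (hf.2 s).1
  · calc cellMass h f n ≤ ∫ _ in Set.Ioc (((n : ℝ) - 1) * h) (n * h), (1 : ℝ) :=
        integral_mono (unitDensities.integrableOn hf _ _) (integrable_const _)
          fun s => (hf.2 s).2
      _ = h := by
        simp only [integral_const, MeasurableSet.univ, measureReal_restrict_apply, Set.univ_inter,
          Real.volume_real_Ioc, smul_eq_mul, mul_one]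
        rw [max_eq_left] <;> nlinarith

/-! ### Convergence of the potential part -/

/-- The node sum is the integral against f of W sampled at midpoints. The error is therefore at most
the L¹ distance between W and its sampling, whatever f is. -/
lemma exists_potential_error {L : ℝ} (hL : 0 < L) {W : ℝ → ℝ}
    (hW : ContinuousOn W (Set.Icc 0 L)) :
    ∃ err : ℕ → ℝ, Tendsto err atTop (𝓝 0) ∧ ∀ N : ℕ, 1 ≤ N → ∀ f ∈ unitDensities,
      |(∫ s in Set.Ioc 0 L, W s * f s) -
        ∑ n ∈ Finset.Icc 1 N, W (node (L / N) n) * cellMass (L / N) f n| ≤ err N := by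
  obtain ⟨B, hB⟩ := isCompact_Icc.exists_bound_of_continuousOn hW
  have hB0 : 0 ≤ B := (norm_nonneg _).trans (hB 0 ⟨le_rfl, hL.le⟩)
  have hWm : AEStronglyMeasurable W (volume.restrict (Set.Ioc 0 L)) :=
    (hW.mono Set.Ioc_subset_Icc_self).aestronglyMeasurable measurableSet_Ioc
  set WN : ℕ → ℝ → ℝ := fun N s => W (node (L / N) (cellIdx (L / N) s)) with hWN
  have hWNm : ∀ N, Measurable (WN N) := fun N =>
    (measurable_from_nat (f := fun n => W (node (L / N) n))).comp (measurable_cellIdx _)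
  have hWNb : ∀ N ≥ 1, ∀ s ∈ Set.Ioc 0 L, ‖WN N s‖ ≤ B := fun N hN s hs =>
    hB _ (Set.Ioo_subset_Icc_self (node_mem hL (cellIdx_mem hL hN hs)))
  have hWi : IntegrableOn W (Set.Ioc 0 L) := (hW.integrableOn_Icc).mono_set Set.Ioc_subset_Icc_self
  have hWNi : ∀ N ≥ 1, IntegrableOn (WN N) (Set.Ioc 0 L) := fun N hN =>
    Measure.integrableOn_of_bounded (M := B) measure_Ioc_lt_top.ne (hWNm N).aestronglyMeasurable
      ((ae_restrict_iff' measurableSet_Ioc).2 (Eventually.of_forall (hWNb N hN)))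
  refine ⟨fun N => ∫ s in Set.Ioc 0 L, |W s - WN N s|, ?_, ?_⟩
  · have := tendsto_integral_filter_of_dominated_convergence (μ := volume.restrict (Set.Ioc 0 L))
      (F := fun N s => |W s - WN N s|) (f := fun _ => 0) (l := atTop) (fun _ => 2 * B)
      (Eventually.of_forall fun N => (hWm.sub (hWNm N).aestronglyMeasurable).norm) ?_
      (integrable_const _) ?_
    · simpa using this
    · filter_upwards [eventually_ge_atTop 1] with N hN
      refine (ae_restrict_iff' measurableSet_Ioc).2 (Eventually.of_forall fun s hs => ?_)
      have h1 := hWNb N hN s hs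
      have h2 := hB s (Set.Ioc_subset_Icc_self hs)
      have h3 := norm_sub_le (W s) (WN N s)
      rw [norm_abs_eq_norm]
      linarith
    · refine (ae_restrict_iff' measurableSet_Ioc).2 (Eventually.of_forall fun s hs => ?_)
      have h1 : Tendsto (fun N => WN N s) atTop (𝓝 (W s)) := by
        refine (hW s (Set.Ioc_subset_Icc_self hs)).tendsto.comp
          (tendsto_nhdsWithin_iff.2 ⟨tendsto_node hL hs.1, ?_⟩)
        filter_upwards [eventually_ge_atTop 1] with N hN
        exact Set.Ioo_subset_Icc_self (node_mem hL (cellIdx_mem hL hN hs))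
      simpa using ((tendsto_const_nhds (x := W s)).sub h1).abs
  · intro N hN f hf
    have hfm := hf.1.aestronglyMeasurable (μ := volume.restrict (Set.Ioc 0 L))
    have hfb : ∀ᵐ s ∂(volume.restrict (Set.Ioc 0 L)), ‖f s‖ ≤ 1 :=
      Eventually.of_forall (unitDensities.norm_le hf)
    have := integral_cellIdx_mul hL hN (fun n => W (node (L / N) n))
      (unitDensities.integrableOn hf 0 L)
    unfold cellMass
    rw [← this, ← integral_sub (hWi.integrable.mul_bdd hfm hfb)
      ((hWNi N hN).integrable.mul_bdd hfm hfb)]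
    refine (abs_integral_le_integral_abs).trans ?_
    refine integral_mono_of_nonneg (Eventually.of_forall fun _ => abs_nonneg _)
      (hWi.integrable.sub (hWNi N hN).integrable).abs (Eventually.of_forall fun s => ?_)
    show |W s * f s - WN N s * f s| ≤ |W s - WN N s|
    rw [← sub_mul, abs_mul]
    exact mul_le_of_le_one_right (abs_nonneg _) (unitDensities.norm_le hf s)

/-! ### Convergence of the interaction part -/

/-- A singular kernel on `[0, L]²`: continuous off the diagonal, with a weak
singularity on it. -/
structure SingularKernel (L C : ℝ) (G : ℝ → ℝ → ℝ) : Prop where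
  nonneg : 0 ≤ C
  bound : ∀ s ∈ Set.Icc 0 L, ∀ t ∈ Set.Icc 0 L, s ≠ t → |G s t| ≤ C * |s - t| ^ (-(1 / 2) : ℝ)
  continuousOn : ContinuousOn (fun p : ℝ × ℝ => G p.1 p.2)
    {p | p.1 ∈ Set.Icc 0 L ∧ p.2 ∈ Set.Icc 0 L ∧ p.1 ≠ p.2}

lemma integrableOn_abs_rpow (L : ℝ) :
    IntegrableOn (fun x : ℝ => |x| ^ (-(1 / 2) : ℝ)) (Set.Ioc (-L) L) := by
  by_cases hL : 0 ≤ L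
  swap
  · rw [Set.Ioc_eq_empty (by linarith)]; exact integrableOn_empty
  have h0 : IntegrableOn (fun x : ℝ => |x| ^ (-(1 / 2) : ℝ)) (Set.Ioc 0 L) := by
    have := (intervalIntegral.intervalIntegrable_rpow' (a := 0) (b := L) (r := -(1 / 2))
      (by norm_num)).1
    refine this.congr_fun (fun x hx => ?_) measurableSet_Ioc
    simp only [abs_of_pos hx.1]
  have h1 : IntegrableOn (fun x : ℝ => |x| ^ (-(1 / 2) : ℝ)) (Set.Ioc (-L) 0) := by
    have := (intervalIntegral.intervalIntegrable_rpow' (a := 0) (b := L) (r := -(1 / 2))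
      (by norm_num)).comp_sub_left 0
    simp only [zero_sub, sub_zero] at this
    have := this.symm.1
    rw [integrableOn_Ioc_iff_integrableOn_Ioo] at this ⊢
    refine this.congr_fun (fun x hx => ?_) measurableSet_Ioo
    simp only [abs_of_neg hx.2]
  have := h1.union h0
  rwa [Set.Ioc_union_Ioc_eq_Ioc (by linarith) hL] at this

/-- The shear (s, t) ↦ (s - t, t) preserves plane Lebesgue measure and turns the bound into a
product of functions of one variable. Any exponent above -1 would serve. -/
lemma integrable_kernel_bound (L : ℝ) :
    Integrable (fun p : ℝ × ℝ => |p.1 - p.2| ^ (-(1 / 2) : ℝ)) ((lebIoc L).prod (lebIoc L)) := by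
  have h1 : Integrable (fun p : ℝ × ℝ =>
      (Set.Ioc (-L) L).indicator (fun x : ℝ => |x| ^ (-(1 / 2) : ℝ)) p.1 *
        (Set.Ioc 0 L).indicator (fun _ => (1 : ℝ)) p.2) (volume.prod volume) :=
    Integrable.mul_prod ((integrableOn_abs_rpow L).integrable_indicator measurableSet_Ioc)
      ((integrableOn_const (C := (1 : ℝ)) measure_Ioc_lt_top.ne).integrable_indicator
        measurableSet_Ioc)
  have h2 := ((measurePreserving_sub_prod (volume : Measure ℝ) (volume : Measure ℝ)).integrable_comp
    h1.aestronglyMeasurable).2 h1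
  rw [Measure.prod_restrict]
  refine (h2.integrableOn (s := Set.Ioc 0 L ×ˢ Set.Ioc 0 L)).congr_fun (fun p hp => ?_)
    (measurableSet_Ioc.prod measurableSet_Ioc)
  obtain ⟨⟨h3, h4⟩, h5, h6⟩ := hp
  have h7 : p.1 - p.2 ∈ Set.Ioc (-L) L := ⟨by linarith, by linarith⟩
  have h8 : p.2 ∈ Set.Ioc 0 L := ⟨h5, h6⟩
  simp [h7, h8]

lemma ae_prod_fst_ne_snd (L : ℝ) : ∀ᵐ p ∂((lebIoc L).prod (lebIoc L)), p.1 ≠ p.2 := by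
  have hm : MeasurableSet {p : ℝ × ℝ | ¬ p.1 ≠ p.2} := by
    simp only [ne_eq, not_not]; exact measurableSet_eq_fun measurable_fst measurable_snd
  rw [ae_iff, Measure.measure_prod_null hm]
  refine Eventually.of_forall fun x => ?_
  have : Prod.mk x ⁻¹' {p : ℝ × ℝ | ¬ p.1 ≠ p.2} = {x} := by ext y; simp [eq_comm]
  simp only [this]
  simp

lemma ae_prod_mem (L : ℝ) : ∀ᵐ p ∂((lebIoc L).prod (lebIoc L)),
    p.1 ∈ Set.Ioc 0 L ∧ p.2 ∈ Set.Ioc 0 L := by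
  rw [Measure.prod_restrict]
  exact (ae_restrict_iff' (measurableSet_Ioc.prod measurableSet_Ioc)).2
    (Eventually.of_forall fun p hp => hp)

/-- The kernel sampled at the nodes, with the diagonal cells removed. -/
def stepKernel (h : ℝ) (G : ℝ → ℝ → ℝ) (s t : ℝ) : ℝ :=
  if cellIdx h s = cellIdx h t then 0 else G (node h (cellIdx h s)) (node h (cellIdx h t))

lemma measurable_stepKernel (h : ℝ) (G : ℝ → ℝ → ℝ) :
    Measurable (fun p : ℝ × ℝ => stepKernel h G p.1 p.2) := by
  have h1 : Measurable (fun q : ℕ × ℕ => if q.1 = q.2 then 0 else G (node h q.1) (node h q.2)) :=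
    measurable_of_countable _
  exact h1.comp (((measurable_cellIdx h).comp measurable_fst).prodMk
    ((measurable_cellIdx h).comp measurable_snd))

variable {L C : ℝ} {G : ℝ → ℝ → ℝ}

lemma SingularKernel.abs_stepKernel_le (hG : SingularKernel L C G) (hL : 0 < L) {N : ℕ}
    (hN : 1 ≤ N) {s t : ℝ} (hs : s ∈ Set.Ioc 0 L) (ht : t ∈ Set.Ioc 0 L) (hst : s ≠ t) :
    |stepKernel (L / N) G s t| ≤ 2 * C * |s - t| ^ (-(1 / 2) : ℝ) := by
  have hN' : (0 : ℝ) < N := by exact_mod_cast hN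
  have hh : 0 < L / N := div_pos hL hN'
  have hd : 0 < |s - t| := abs_pos.2 (sub_ne_zero.2 hst)
  unfold stepKernel
  split_ifs with h
  · rw [abs_zero]
    have := hG.nonneg
    positivity
  have h1 := half_abs_sub_le_abs_node_sub hh hs.1 ht.1 h
  have h2 := node_mem hL (cellIdx_mem hL hN hs)
  have h3 := node_mem hL (cellIdx_mem hL hN ht)
  have h4 : node (L / N) (cellIdx (L / N) s) ≠ node (L / N) (cellIdx (L / N) t) := by
    intro h5
    rw [h5, sub_self, abs_zero] at h1
    linarith
  refine (hG.bound _ (Set.Ioo_subset_Icc_self h2) _ (Set.Ioo_subset_Icc_self h3) h4).trans ?_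
  have h5 : |node (L / N) (cellIdx (L / N) s) - node (L / N) (cellIdx (L / N) t)| ^ (-(1 / 2) : ℝ)
      ≤ (|s - t| / 2) ^ (-(1 / 2) : ℝ) :=
    Real.rpow_le_rpow_of_nonpos (by positivity) h1 (by norm_num)
  -- The factor (1/2)^(-1/2) = √2 lost by halving the distance is rounded up to 2.
  have h6 : (|s - t| / 2) ^ (-(1 / 2) : ℝ) ≤ 2 * |s - t| ^ (-(1 / 2) : ℝ) := by
    rw [Real.div_rpow hd.le (by norm_num), div_eq_mul_inv, mul_comm, ← Real.rpow_neg (by norm_num)]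
    refine mul_le_mul_of_nonneg_right ?_ (by positivity)
    calc (2 : ℝ) ^ (-(-(1 / 2)) : ℝ) ≤ 2 ^ (1 : ℝ) :=
          Real.rpow_le_rpow_of_exponent_le (by norm_num) (by norm_num)
      _ = 2 := by norm_num
  calc _ ≤ C * (2 * |s - t| ^ (-(1 / 2) : ℝ)) :=
        mul_le_mul_of_nonneg_left (h5.trans h6) hG.nonneg
    _ = _ := by ring

lemma SingularKernel.tendsto_stepKernel (hG : SingularKernel L C G) (hL : 0 < L) {s t : ℝ}
    (hs : s ∈ Set.Ioc 0 L) (ht : t ∈ Set.Ioc 0 L) (hst : s ≠ t) :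
    Tendsto (fun N : ℕ => stepKernel (L / N) G s t) atTop (𝓝 (G s t)) := by
  have h1 := tendsto_node hL hs.1
  have h2 := tendsto_node hL ht.1
  have h3 : ∀ᶠ N : ℕ in atTop,
      node (L / N) (cellIdx (L / N) s) ≠ node (L / N) (cellIdx (L / N) t) := by
    have := (h1.sub h2).eventually_ne (sub_ne_zero.2 hst)
    filter_upwards [this] with N hN
    exact sub_ne_zero.1 hN
  have h4 := (hG.continuousOn (s, t) ⟨Set.Ioc_subset_Icc_self hs, Set.Ioc_subset_Icc_self ht,
    hst⟩).tendsto.comp (tendsto_nhdsWithin_iff.2 ⟨h1.prodMk_nhds h2, by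
      filter_upwards [h3, eventually_ge_atTop 1] with N hN1 hN
      exact ⟨Set.Ioo_subset_Icc_self (node_mem hL (cellIdx_mem hL hN hs)),
        Set.Ioo_subset_Icc_self (node_mem hL (cellIdx_mem hL hN ht)), hN1⟩⟩)
  refine h4.congr' ?_
  filter_upwards [h3] with N hN
  simp only [Function.comp, stepKernel]
  rw [if_neg]
  intro h5
  rw [h5] at hN
  exact hN rfl

/-- G is the almost everywhere limit of its sampled versions, which are measurable because they
factor through ℕ × ℕ. -/
lemma SingularKernel.aestronglyMeasurable (hG : SingularKernel L C G) (hL : 0 < L) :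
    AEStronglyMeasurable (fun p : ℝ × ℝ => G p.1 p.2) ((lebIoc L).prod (lebIoc L)) := by
  refine aestronglyMeasurable_of_tendsto_ae atTop
    (fun N : ℕ => (measurable_stepKernel (L / N) G).aestronglyMeasurable) ?_
  filter_upwards [ae_prod_fst_ne_snd L, ae_prod_mem L] with p h1 h2
  exact hG.tendsto_stepKernel hL h2.1 h2.2 h1

lemma SingularKernel.integrable (hG : SingularKernel L C G) (hL : 0 < L) :
    Integrable (fun p : ℝ × ℝ => G p.1 p.2) ((lebIoc L).prod (lebIoc L)) := by
  refine ((integrable_kernel_bound L).const_mul C).mono' (hG.aestronglyMeasurable hL) ?_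
  filter_upwards [ae_prod_fst_ne_snd L, ae_prod_mem L] with p h1 h2
  exact hG.bound _ (Set.Ioc_subset_Icc_self h2.1) _ (Set.Ioc_subset_Icc_self h2.2) h1

lemma SingularKernel.integrable_stepKernel (hG : SingularKernel L C G) (hL : 0 < L) {N : ℕ}
    (hN : 1 ≤ N) :
    Integrable (fun p : ℝ × ℝ => stepKernel (L / N) G p.1 p.2) ((lebIoc L).prod (lebIoc L)) := by
  refine ((integrable_kernel_bound L).const_mul (2 * C)).mono'
    (measurable_stepKernel _ G).aestronglyMeasurable ?_
  filter_upwards [ae_prod_fst_ne_snd L, ae_prod_mem L] with p h1 h2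
  exact hG.abs_stepKernel_le hL hN h2.1 h2.2 h1

lemma integrable_mul_unitDensities {μ : Measure (ℝ × ℝ)} {K : ℝ × ℝ → ℝ} (hK : Integrable K μ)
    {f : ℝ → ℝ} (hf : f ∈ unitDensities) :
    Integrable (fun p => K p * (f p.1 * f p.2)) μ := by
  refine hK.mul_bdd (c := 1) ((hf.1.comp measurable_fst).mul
    (hf.1.comp measurable_snd)).aestronglyMeasurable (Eventually.of_forall fun p => ?_)
  rw [norm_mul]
  exact mul_le_one₀ (unitDensities.norm_le hf _) (norm_nonneg _) (unitDensities.norm_le hf _)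

/-- This identifies the interaction part of `nodeEnergy` as an exact double integral, so that
replacing f by cell masses costs nothing beyond the sampling of the kernel. -/
lemma integral_stepKernel (hG : SingularKernel L C G) (hL : 0 < L) {N : ℕ} (hN : 1 ≤ N)
    {f : ℝ → ℝ} (hf : f ∈ unitDensities) :
    ∫ p, stepKernel (L / N) G p.1 p.2 * (f p.1 * f p.2) ∂((lebIoc L).prod (lebIoc L)) =
      ∑ n ∈ Finset.Icc 1 N, ∑ m ∈ Finset.Icc 1 N,
        (if n = m then 0 else G (node (L / N) n) (node (L / N) m)) *
          (cellMass (L / N) f n * cellMass (L / N) f m) := by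
  rw [integral_prod _ (integrable_mul_unitDensities (hG.integrable_stepKernel hL hN) hf)]
  set φ : ℕ → ℕ → ℝ := fun n m => if n = m then 0 else G (node (L / N) n) (node (L / N) m)
  have hfi := unitDensities.integrableOn hf 0 L
  have h1 : ∀ s, ∫ t, stepKernel (L / N) G s t * (f s * f t) ∂(lebIoc L) =
      (∑ m ∈ Finset.Icc 1 N, φ (cellIdx (L / N) s) m * cellMass (L / N) f m) * f s := by
    intro s
    have := integral_cellIdx_mul hL hN (φ (cellIdx (L / N) s)) hfi
    unfold cellMass
    rw [← this, ← integral_mul_const]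
    refine integral_congr_ae (Eventually.of_forall fun t => ?_)
    simp only [stepKernel, φ]
    ring
  simp only [h1]
  rw [integral_cellIdx_mul hL hN
    (fun n => ∑ m ∈ Finset.Icc 1 N, φ n m * cellMass (L / N) f m) hfi]
  refine Finset.sum_congr rfl fun n _ => ?_
  rw [Finset.sum_mul]
  refine Finset.sum_congr rfl fun m _ => ?_
  simp only [φ, cellMass]
  ring

lemma SingularKernel.exists_error (hG : SingularKernel L C G) (hL : 0 < L) :
    ∃ err : ℕ → ℝ, Tendsto err atTop (𝓝 0) ∧ ∀ N : ℕ, 1 ≤ N → ∀ f ∈ unitDensities,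
      |(∫ p, G p.1 p.2 * (f p.1 * f p.2) ∂((lebIoc L).prod (lebIoc L))) -
        ∑ n ∈ Finset.Icc 1 N, ∑ m ∈ Finset.Icc 1 N,
        (if n = m then 0 else G (node (L / N) n) (node (L / N) m)) *
          (cellMass (L / N) f n * cellMass (L / N) f m)| ≤ err N := by
  refine ⟨fun N => ∫ p, |G p.1 p.2 - stepKernel (L / N) G p.1 p.2| ∂((lebIoc L).prod (lebIoc L)),
    ?_, ?_⟩
  · have := tendsto_integral_filter_of_dominated_convergence (μ := (lebIoc L).prod (lebIoc L))
      (F := fun (N : ℕ) p => |G p.1 p.2 - stepKernel (L / N) G p.1 p.2|) (f := fun _ => 0)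
      (l := atTop) (fun p => 3 * C * |p.1 - p.2| ^ (-(1 / 2) : ℝ))
      (Eventually.of_forall fun N => ((hG.aestronglyMeasurable hL).sub
        (measurable_stepKernel _ G).aestronglyMeasurable).norm) ?_
      ((integrable_kernel_bound L).const_mul _) ?_
    · simpa using this
    · filter_upwards [eventually_ge_atTop 1] with N hN
      filter_upwards [ae_prod_fst_ne_snd L, ae_prod_mem L] with p h1 h2
      have h3 := hG.abs_stepKernel_le hL hN h2.1 h2.2 h1
      have h4 := hG.bound _ (Set.Ioc_subset_Icc_self h2.1) _ (Set.Ioc_subset_Icc_self h2.2) h1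
      have h5 := abs_sub (G p.1 p.2) (stepKernel (L / N) G p.1 p.2)
      rw [Real.norm_eq_abs, abs_abs]
      linarith
    · filter_upwards [ae_prod_fst_ne_snd L, ae_prod_mem L] with p h1 h2
      simpa using ((tendsto_const_nhds (x := G p.1 p.2)).sub
        (hG.tendsto_stepKernel hL h2.1 h2.2 h1)).abs
  · intro N hN f hf
    have hG1 := hG.integrable hL
    have hG2 := hG.integrable_stepKernel hL hN
    rw [← integral_stepKernel hG hL hN hf, ← integral_sub (integrable_mul_unitDensities hG1 hf)
      (integrable_mul_unitDensities hG2 hf)]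
    refine (abs_integral_le_integral_abs).trans ?_
    refine integral_mono_of_nonneg (Eventually.of_forall fun _ => abs_nonneg _)
      (hG1.sub hG2).abs (Eventually.of_forall fun p => ?_)
    beta_reduce
    rw [← sub_mul, abs_mul]
    refine mul_le_of_le_one_right (abs_nonneg _) ?_
    rw [abs_mul]
    exact mul_le_one₀ (unitDensities.norm_le hf _) (abs_nonneg _) (unitDensities.norm_le hf _)

/-! ### Minimizing the continuum energy in the variable `s` -/

/-- The continuum energy of a density `f` on `(0, L]`. -/
def sEnergy (L : ℝ) (W : ℝ → ℝ) (G : ℝ → ℝ → ℝ) (f : ℝ → ℝ) : ℝ :=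
  (∫ s in Set.Ioc 0 L, W s * f s) +
    1 / (2 * Real.pi) * ∫ p, G p.1 p.2 * (f p.1 * f p.2) ∂((lebIoc L).prod (lebIoc L))

/-- The energy of masses `a n` placed at the nodes, without self-interaction. -/
def nodeEnergy (h : ℝ) (N : ℕ) (W : ℝ → ℝ) (G : ℝ → ℝ → ℝ) (a : ℕ → ℝ) : ℝ :=
  (∑ n ∈ Finset.Icc 1 N, W (node h n) * a n) +
    1 / (2 * Real.pi) * ∑ n ∈ Finset.Icc 1 N, ∑ m ∈ Finset.Icc 1 N,
      (if n = m then 0 else G (node h n) (node h m)) * (a n * a m)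

/-- A multi-affine quadratic form on a cube is minimized at a vertex. -/
lemma exists_vertex_le (A : Finset ℕ) (w : ℕ → ℝ) (k : ℕ → ℕ → ℝ) (hk : ∀ n, k n n = 0) (c h : ℝ)
    (a : ℕ → ℝ) (ha : ∀ n, a n ∈ Set.Icc 0 h) :
    ∃ S ⊆ A, (∑ n ∈ A, w n * (if n ∈ S then h else 0)) +
        c * ∑ n ∈ A, ∑ m ∈ A, k n m * ((if n ∈ S then h else 0) * (if m ∈ S then h else 0)) ≤
      (∑ n ∈ A, w n * a n) + c * ∑ n ∈ A, ∑ m ∈ A, k n m * (a n * a m) := by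
  classical
  set q : (ℕ → ℝ) → ℝ := fun a => (∑ n ∈ A, w n * a n) +
    c * ∑ n ∈ A, ∑ m ∈ A, k n m * (a n * a m) with hq
  -- Since the diagonal of k vanishes, no square of a single coordinate occurs, so q is affine in
  -- each coordinate separately.
  have haff : ∀ (b : ℕ → ℝ) (i : ℕ), ∃ α β : ℝ, ∀ z, q (Function.update b i z) = α + β * z := by
    intro b i
    set u : ℕ → ℝ := fun n => if n = i then 0 else b n with hu
    set v : ℕ → ℝ := fun n => if n = i then 1 else 0 with hv
    refine ⟨q u, (∑ n ∈ A, w n * v n) +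
      c * ∑ n ∈ A, ∑ m ∈ A, k n m * (u n * v m + v n * u m), fun z => ?_⟩
    have h1 : ∀ n, Function.update b i z n = u n + v n * z := by
      intro n
      by_cases hn : n = i <;> simp [hu, hv, hn]
    have h2 : ∀ n m, k n m * (v n * v m) = 0 := by
      intro n m
      by_cases hn : n = i <;> by_cases hm : m = i <;> simp [hv, hn, hm, hk]
    have h3 : ∀ n m, k n m * (Function.update b i z n * Function.update b i z m) =
        k n m * (u n * u m) + (k n m * (u n * v m + v n * u m)) * z := by
      intro n m
      rw [h1, h1]
      linear_combination (z ^ 2) * h2 n m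
    have h4 : ∀ n, w n * Function.update b i z n = w n * u n + w n * v n * z := by
      intro n; rw [h1]; ring
    simp only [hq, h3, h4, Finset.sum_add_distrib, ← Finset.sum_mul]
    ring
  -- Coordinates are moved to an endpoint one after another; the sign of the slope β decides between
  -- 0 and h, and q never increases.
  have hmain : ∀ T : Finset ℕ, ∃ b : ℕ → ℝ, (∀ n ∈ T, b n = 0 ∨ b n = h) ∧
      (∀ n, b n ∈ Set.Icc 0 h) ∧ q b ≤ q a := by
    intro T
    induction T using Finset.induction_on with
    | empty => exact ⟨a, by simp, ha, le_rfl⟩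
    | insert i T _ ih =>
      obtain ⟨b, h1, h2, h3⟩ := ih
      obtain ⟨α, β, hab⟩ := haff b i
      have hh : 0 ≤ h := (h2 0).1.trans (h2 0).2
      have hb : q b = α + β * b i := by rw [← hab, Function.update_eq_self]
      have key : ∀ z, (z = 0 ∨ z = h) → β * z ≤ β * b i → ∃ b : ℕ → ℝ,
          (∀ n ∈ insert i T, b n = 0 ∨ b n = h) ∧ (∀ n, b n ∈ Set.Icc 0 h) ∧ q b ≤ q a := by
        intro z hz hle
        refine ⟨Function.update b i z, ?_, ?_, ?_⟩
        · intro n hn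
          by_cases hni : n = i
          · subst hni; simpa using hz
          · rw [Function.update_of_ne hni]
            exact h1 n ((Finset.mem_insert.1 hn).resolve_left hni)
        · intro n
          by_cases hni : n = i
          · subst hni
            rcases hz with rfl | rfl <;> simp [hh]
          · rw [Function.update_of_ne hni]; exact h2 n
        · rw [hab]; linarith
      rcases le_total 0 β with hβ | hβ
      · exact key 0 (Or.inl rfl) (by rw [mul_zero]; exact mul_nonneg hβ (h2 i).1)
      · exact key h (Or.inr rfl) (mul_le_mul_of_nonpos_left (h2 i).2 hβ)
  obtain ⟨b, h1, h2, h3⟩ := hmain A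
  refine ⟨A.filter (fun n => b n = h), Finset.filter_subset _ _, le_of_eq_of_le ?_ h3⟩
  have hb : ∀ n ∈ A, (if n ∈ A.filter (fun n => b n = h) then h else 0) = b n := by
    intro n hn
    by_cases hbn : b n = h
    · simp [hn, hbn]
    · simp only [Finset.mem_filter, hn, hbn, and_false, if_false]
      exact ((h1 n hn).resolve_right hbn).symm
  simp only [hq]
  congr 1
  · exact Finset.sum_congr rfl fun n hn => by rw [hb n hn]
  · congr 1
    exact Finset.sum_congr rfl fun n hn => Finset.sum_congr rfl fun m hm => by rw [hb n hn, hb m hm]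

lemma SingularKernel.exists_energy_error (hG : SingularKernel L C G) (hL : 0 < L) {W : ℝ → ℝ}
    (hW : ContinuousOn W (Set.Icc 0 L)) :
    ∃ err : ℕ → ℝ, Tendsto err atTop (𝓝 0) ∧ ∀ N : ℕ, 1 ≤ N → ∀ f ∈ unitDensities,
      |sEnergy L W G f - nodeEnergy (L / N) N W G (cellMass (L / N) f)| ≤ err N := by
  obtain ⟨e1, h1, h1'⟩ := exists_potential_error hL hW
  obtain ⟨e2, h2, h2'⟩ := hG.exists_error hL
  refine ⟨fun N => e1 N + 1 / (2 * Real.pi) * e2 N, by simpa using h1.add (h2.const_mul _), ?_⟩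
  intro N hN f hf
  have h3 := h1' N hN f hf
  have h4 := h2' N hN f hf
  unfold sEnergy nodeEnergy
  rw [add_sub_add_comm, ← mul_sub]
  refine (abs_add_le _ _).trans (add_le_add h3 ?_)
  rw [abs_mul, abs_of_pos (by positivity)]
  exact mul_le_mul_of_nonneg_left h4 (by positivity)

/-- Primitives of densities with values in `[0, 1]`. -/
def primitives : Set (ℝ → ℝ) :=
  {A | A 0 = 0 ∧ ∀ s t, s ≤ t → 0 ≤ A t - A s ∧ A t - A s ≤ t - s}

/-- The topology is that of pointwise convergence: the conditions are closed and confine A s to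
[-|s|, |s|], so Tychonoff applies. This replaces weak-* compactness of the set of densities. -/
lemma isCompact_primitives : IsCompact primitives := by
  have h1 : IsCompact (Set.pi Set.univ fun s : ℝ => Set.Icc (-|s|) |s|) :=
    isCompact_univ_pi fun _ => isCompact_Icc
  refine h1.of_isClosed_subset ?_ ?_
  · have : primitives = {A | A 0 = 0} ∩ ⋂ s : ℝ, ⋂ t : ℝ, ⋂ _ : s ≤ t,
        ({A : ℝ → ℝ | 0 ≤ A t - A s} ∩ {A | A t - A s ≤ t - s}) := by
      ext A; simp [primitives]
    rw [this]
    refine (isClosed_eq (continuous_apply 0) continuous_const).inter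
      (isClosed_iInter fun s => isClosed_iInter fun t => isClosed_iInter fun _ =>
        (isClosed_le continuous_const ((continuous_apply t).sub (continuous_apply s))).inter
        (isClosed_le ((continuous_apply t).sub (continuous_apply s)) continuous_const))
  · rintro A ⟨h0, hA⟩ s -
    change A s ∈ Set.Icc (-|s|) |s|
    rcases le_total 0 s with hs | hs
    · have := hA 0 s hs
      rw [abs_of_nonneg hs]
      constructor <;> linarith
    · have := hA s 0 hs
      rw [abs_of_nonpos hs]
      constructor <;> linarith

lemma cellMass_eq_intervalIntegral {h : ℝ} (hh : 0 < h) (f : ℝ → ℝ) (n : ℕ) :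
    cellMass h f n = ∫ s in (((n : ℝ) - 1) * h)..(n * h), f s := by
  rw [cellMass, intervalIntegral.integral_of_le (by nlinarith)]

lemma exists_primitive {f : ℝ → ℝ} (hf : f ∈ unitDensities) :
    ∃ A ∈ primitives, ∀ h : ℝ, 0 < h → ∀ n : ℕ,
      cellMass h f n = A (n * h) - A (((n : ℝ) - 1) * h) := by
  have hfi : ∀ a b, IntervalIntegrable f volume a b := fun a b =>
    ⟨unitDensities.integrableOn hf _ _, unitDensities.integrableOn hf _ _⟩
  have hsub : ∀ a b, (∫ s in (0 : ℝ)..b, f s) - ∫ s in (0 : ℝ)..a, f s = ∫ s in a..b, f s :=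
    fun a b => intervalIntegral.integral_interval_sub_left (hfi _ _) (hfi _ _)
  refine ⟨fun s => ∫ t in (0 : ℝ)..s, f t, ⟨by simp, fun s t hst => ?_⟩, fun h hh n => ?_⟩
  · rw [hsub]
    constructor
    · exact intervalIntegral.integral_nonneg hst fun u _ => (hf.2 u).1
    · calc ∫ u in s..t, f u ≤ ∫ _ in s..t, (1 : ℝ) :=
          intervalIntegral.integral_mono_on hst (hfi _ _) (by simp) fun u _ => (hf.2 u).2
        _ = t - s := by simp
  · rw [cellMass_eq_intervalIntegral hh, hsub]

/-- A primitive is monotone and 1-Lipschitz, hence absolutely continuous, and its derivative is the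
density. Where A is not differentiable, `deriv` is 0, still a value in [0, 1]. -/
lemma exists_density {A : ℝ → ℝ} (hA : A ∈ primitives) :
    ∃ f ∈ unitDensities, ∀ h : ℝ, 0 < h → ∀ n : ℕ,
      cellMass h f n = A (n * h) - A (((n : ℝ) - 1) * h) := by
  have hmono : Monotone A := fun s t hst => sub_nonneg.1 (hA.2 s t hst).1
  have hlip : LipschitzWith 1 A := by
    refine LipschitzWith.of_dist_le_mul fun s t => ?_
    rw [Real.dist_eq, Real.dist_eq, NNReal.coe_one, one_mul]
    rcases le_total s t with h | h
    · have := hA.2 s t h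
      rw [abs_sub_comm, abs_of_nonneg this.1, abs_sub_comm, abs_of_nonneg (by linarith)]
      exact this.2
    · have := hA.2 t s h
      rw [abs_of_nonneg this.1, abs_of_nonneg (by linarith)]
      exact this.2
  refine ⟨deriv A, ⟨measurable_deriv A, fun s => ⟨hmono.deriv_nonneg, ?_⟩⟩, fun h hh n => ?_⟩
  · exact (le_abs_self _).trans (by simpa using norm_deriv_le_of_lipschitz (x₀ := s) hlip)
  · rw [cellMass_eq_intervalIntegral hh]
    exact (hlip.lipschitzOnWith.absolutelyContinuousOnInterval).integral_deriv_eq_sub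

/-- For each N the frozen energy depends on finitely many values of the primitive, hence is
continuous in it. Uniform convergence passes continuity to the limit, which attains its minimum on a
compact set. -/
lemma SingularKernel.exists_minimizer (hG : SingularKernel L C G) (hL : 0 < L) {W : ℝ → ℝ}
    (hW : ContinuousOn W (Set.Icc 0 L)) :
    ∃ f ∈ unitDensities, ∀ g ∈ unitDensities, sEnergy L W G f ≤ sEnergy L W G g := by
  obtain ⟨err, herr, hE⟩ := hG.exists_energy_error hL hW
  set q : ℕ → (ℝ → ℝ) → ℝ := fun N A => nodeEnergy (L / N) N W G
    (fun n => A (n * (L / N)) - A (((n : ℝ) - 1) * (L / N))) with hq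
  have hh : ∀ N : ℕ, 1 ≤ N → 0 < L / N := fun N hN =>
    div_pos hL (by exact_mod_cast hN)
  have hqE : ∀ N : ℕ, 1 ≤ N → ∀ (A f : ℝ → ℝ), f ∈ unitDensities →
      (∀ h : ℝ, 0 < h → ∀ n : ℕ, cellMass h f n = A (n * h) - A (((n : ℝ) - 1) * h)) →
      |sEnergy L W G f - q N A| ≤ err N := by
    intro N hN A f hf hAf
    have := hE N hN f hf
    rwa [show cellMass (L / N) f = fun n : ℕ => A (n * (L / N)) - A (((n : ℝ) - 1) * (L / N)) from
      funext fun n => hAf _ (hh N hN) n] at this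
  choose! d hd hd' using fun (A : ℝ → ℝ) (hA : A ∈ primitives) => exists_density hA
  have hunif : TendstoUniformlyOn q (fun A => sEnergy L W G (d A)) atTop primitives := by
    rw [Metric.tendstoUniformlyOn_iff]
    intro ε hε
    filter_upwards [herr.eventually_lt_const hε, eventually_ge_atTop 1] with N h1 h2 A hA
    rw [Real.dist_eq]
    exact (hqE N h2 A _ (hd A hA) (hd' A hA)).trans_lt h1
  have hcont : ContinuousOn (fun A => sEnergy L W G (d A)) primitives := by
    refine hunif.continuousOn (Frequently.of_forall fun N => Continuous.continuousOn ?_)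
    simp only [hq, nodeEnergy]
    fun_prop
  have hne : primitives.Nonempty := by
    obtain ⟨A, hA, -⟩ := exists_primitive (f := fun _ => 0) ⟨measurable_const, by simp⟩
    exact ⟨A, hA⟩
  obtain ⟨A, hA, hmin⟩ := isCompact_primitives.exists_isMinOn hne hcont
  refine ⟨d A, hd A hA, fun g hg => ?_⟩
  obtain ⟨B, hB, hgB⟩ := exists_primitive hg
  have h1 : sEnergy L W G (d A) ≤ sEnergy L W G (d B) := hmin hB
  -- The density chosen for the primitive B need not be g itself, but it has the same cell masses at
  -- every scale. Both energies are therefore the limit of `q N B`.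
  refine h1.trans (le_of_eq ?_)
  have h2 : Tendsto (fun N => q N B) atTop (𝓝 (sEnergy L W G (d B))) := hunif.tendsto_at hB
  refine tendsto_nhds_unique h2 ?_
  rw [tendsto_iff_norm_sub_tendsto_zero]
  refine squeeze_zero' (Eventually.of_forall fun _ => norm_nonneg _) ?_ herr
  filter_upwards [eventually_ge_atTop 1] with N hN
  rw [Real.norm_eq_abs, abs_sub_comm]
  exact hqE N hN B g hg hgB

/-! ### The level function along the quadratrix -/

/-- The rescaled level function: `2 δ E(ζ(κ)) = ell (2 δ κ)`. -/
def ell (y : ℝ) : ℝ := 1 - Real.cos y / Real.sinc y - Real.log (Real.sinc y)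

lemma sinc_pos {y : ℝ} (h0 : 0 ≤ y) (h1 : y < Real.pi) : 0 < Real.sinc y := by
  rcases h0.eq_or_lt with rfl | h
  · simp
  · rw [Real.sinc_of_ne_zero h.ne']
    exact div_pos (Real.sin_pos_of_pos_of_lt_pi h h1) h

lemma ell_zero : ell 0 = 0 := by simp [ell]

lemma continuousOn_ell : ContinuousOn ell (Set.Ico 0 Real.pi) := by
  have h := Real.continuous_sinc.continuousOn (s := Set.Ico 0 Real.pi)
  have hne : ∀ y ∈ Set.Ico 0 Real.pi, Real.sinc y ≠ 0 := fun y hy => (sinc_pos hy.1 hy.2).ne'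
  exact (continuousOn_const.sub (Real.continuous_cos.continuousOn.div h hne)).sub (h.log hne)

/-- The derivative of `ell`. -/
def ellDeriv (y : ℝ) : ℝ :=
  ((y - Real.sin y * Real.cos y) ^ 2 + Real.sin y ^ 4) / (y * Real.sin y ^ 2)

lemma hasDerivAt_ell {y : ℝ} (h0 : 0 < y) (h1 : y < Real.pi) : HasDerivAt ell (ellDeriv y) y := by
  have hs := Real.sin_pos_of_pos_of_lt_pi h0 h1
  have hd : HasDerivAt (fun y => 1 - y * Real.cos y / Real.sin y -
      (Real.log (Real.sin y) - Real.log y)) (ellDeriv y) y := by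
    have h2 := (((hasDerivAt_id y).mul (Real.hasDerivAt_cos y)).div (Real.hasDerivAt_sin y) hs.ne')
    have h3 := (Real.hasDerivAt_sin y).log hs.ne'
    have h4 := Real.hasDerivAt_log h0.ne'
    refine ((h2.const_sub 1).sub (h3.sub h4)).congr_deriv ?_
    have h5 := Real.sin_sq_add_cos_sq y
    unfold ellDeriv
    simp only [id, Pi.mul_apply]
    field_simp
    linear_combination (y ^ 2 - Real.sin y ^ 2) * h5
  refine hd.congr_of_eventuallyEq ?_
  filter_upwards [Ioo_mem_nhds h0 h1] with z hz
  have hz' := Real.sin_pos_of_pos_of_lt_pi hz.1 hz.2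
  rw [ell, Real.sinc_of_ne_zero hz.1.ne', Real.log_div hz'.ne' hz.1.ne']
  congr 2
  have := hz.1.ne'
  field_simp

/-- Up to π/2 the term sin⁴ suffices, by Jordan's inequality sin y ≥ 2y/π. Beyond π/2 the cosine is
nonpositive, so the squared term is at least y². -/
lemma le_ellDeriv {y : ℝ} (h0 : 0 < y) (h1 : y < Real.pi) :
    4 / Real.pi ^ 2 * y ≤ ellDeriv y := by
  have hs := Real.sin_pos_of_pos_of_lt_pi h0 h1
  have hpi := Real.pi_gt_three
  unfold ellDeriv
  rw [le_div_iff₀ (by positivity)]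
  rcases le_total y (Real.pi / 2) with h | h
  · have h2 := Real.mul_le_sin h0.le h
    have h3 : (2 / Real.pi * y) ^ 2 ≤ Real.sin y ^ 2 := by gcongr
    have h4 : 4 / Real.pi ^ 2 * y * (y * Real.sin y ^ 2) =
      (2 / Real.pi * y) ^ 2 * Real.sin y ^ 2 := by ring
    rw [h4]
    nlinarith [sq_nonneg (y - Real.sin y * Real.cos y), sq_nonneg (Real.sin y)]
  · have h2 : Real.cos y ≤ 0 := Real.cos_nonpos_of_pi_div_two_le_of_le h (by linarith)
    have h3 : y ^ 2 ≤ (y - Real.sin y * Real.cos y) ^ 2 := by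
      refine pow_le_pow_left₀ h0.le ?_ 2
      nlinarith
    have h4 : 4 / Real.pi ^ 2 ≤ 1 := by rw [div_le_one (by positivity)]; nlinarith
    have h5 := Real.sin_sq_le_one y
    have h6 : 0 ≤ Real.sin y ^ 4 := by positivity
    have h7 : 4 / Real.pi ^ 2 * y * (y * Real.sin y ^ 2) ≤ 1 * y * (y * 1) := by gcongr
    nlinarith

/-- Integrating the bound on the derivative gives growth at least like b² - a² ≥ (b - a)². This
makes the inverse of `ell` 1/2-Hölder up to the vertex, where the derivative of `ell` degenerates.
-/
lemma ell_sub_ell_ge {a b : ℝ} (ha : 0 ≤ a) (hab : a ≤ b) (hb : b < Real.pi) :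
    2 / Real.pi ^ 2 * (b - a) ^ 2 ≤ ell b - ell a := by
  have hmono : MonotoneOn (fun y => ell y - 2 / Real.pi ^ 2 * y ^ 2) (Set.Ico 0 Real.pi) := by
    refine monotoneOn_of_deriv_nonneg (convex_Ico _ _)
      (continuousOn_ell.sub (by fun_prop)) ?_ ?_ <;> rw [interior_Ico]
    · intro y hy
      exact (((hasDerivAt_ell hy.1 hy.2).sub
        ((hasDerivAt_pow 2 y).const_mul _)).differentiableAt).differentiableWithinAt
    · intro y hy
      have hd : HasDerivAt (fun y => ell y - 2 / Real.pi ^ 2 * y ^ 2) _ y :=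
        (hasDerivAt_ell hy.1 hy.2).sub ((hasDerivAt_pow 2 y).const_mul (2 / Real.pi ^ 2))
      rw [hd.deriv]
      have := le_ellDeriv hy.1 hy.2
      have e : 2 / Real.pi ^ 2 * ((2 : ℕ) * y ^ (2 - 1)) = 4 / Real.pi ^ 2 * y := by
        norm_num; ring
      rw [e]; linarith
  have h1 := hmono ⟨ha, hab.trans_lt hb⟩ ⟨ha.trans hab, hb⟩ hab
  simp only at h1
  have h2 : (b - a) ^ 2 ≤ b ^ 2 - a ^ 2 := by nlinarith
  have h3 : 2 / Real.pi ^ 2 * (b - a) ^ 2 ≤ 2 / Real.pi ^ 2 * (b ^ 2 - a ^ 2) := by gcongr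
  linarith

lemma strictMonoOn_ell : StrictMonoOn ell (Set.Ico 0 Real.pi) := by
  intro a ha b hb hab
  have h1 := ell_sub_ell_ge ha.1 hab.le hb.2
  have h2 : 0 < 2 / Real.pi ^ 2 * (b - a) ^ 2 := by
    have := sub_pos.2 hab
    positivity
  linarith

lemma ell_nonneg {y : ℝ} (h0 : 0 ≤ y) (h1 : y < Real.pi) : 0 ≤ ell y := by
  rw [← ell_zero]
  exact strictMonoOn_ell.monotoneOn ⟨le_rfl, Real.pi_pos⟩ ⟨h0, h1⟩ h0

lemma ell_pos {y : ℝ} (h0 : 0 < y) (h1 : y < Real.pi) : 0 < ell y := by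
  rw [← ell_zero]
  exact strictMonoOn_ell ⟨le_rfl, Real.pi_pos⟩ ⟨h0.le, h1⟩ h0

/-- As y → π the logarithmic term tends to +∞ because sinc tends to 0, while the cosine term is
nonnegative beyond π/2; the intermediate value theorem concludes. -/
lemma exists_ell_eq {p : ℝ} (hp : 0 ≤ p) : ∃ y ∈ Set.Ico 0 Real.pi, ell y = p := by
  have hpi := Real.pi_pos
  have h1 : Tendsto Real.sinc (𝓝[<] Real.pi) (𝓝 0) := by
    have := (Real.continuous_sinc.tendsto Real.pi)
    rw [Real.sinc_of_ne_zero hpi.ne', Real.sin_pi, zero_div] at this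
    exact this.mono_left nhdsWithin_le_nhds
  have h2 : ∀ᶠ y in 𝓝[<] Real.pi, Real.sinc y < Real.exp (-p) :=
    h1.eventually_lt_const (Real.exp_pos _)
  have h3 : ∀ᶠ y in 𝓝[<] Real.pi, y ∈ Set.Ioo (Real.pi / 2) Real.pi :=
    Ioo_mem_nhdsLT (by linarith)
  obtain ⟨y, hy1, hy2⟩ := (h2.and h3).exists
  have hy0 : 0 ≤ y := by linarith [hy2.1]
  have hpos := sinc_pos hy0 hy2.2
  have h4 : p ≤ ell y := by
    have h5 : Real.log (Real.sinc y) < -p := (Real.log_lt_iff_lt_exp hpos).2 hy1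
    have h6 : Real.cos y / Real.sinc y ≤ 0 := div_nonpos_of_nonpos_of_nonneg
      (Real.cos_nonpos_of_pi_div_two_le_of_le hy2.1.le (by linarith [hy2.2])) hpos.le
    unfold ell; linarith
  obtain ⟨z, hz, hz'⟩ := intermediate_value_Icc hy0
    (continuousOn_ell.mono (Set.Icc_subset_Ico_right hy2.2)) (⟨by rwa [ell_zero], h4⟩ :
      p ∈ Set.Icc (ell 0) (ell y))
  exact ⟨z, ⟨hz.1, hz.2.trans_lt hy2.2⟩, hz'⟩

/-- At 0 the numerator of `ellDeriv` is O(y⁴) against a denominator of order y³, and away from π the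
function sinc is bounded below, so the derivative stays bounded. -/
lemma exists_ell_lipschitz {Y : ℝ} (hY : Y < Real.pi) :
    ∃ M, 0 ≤ M ∧ ∀ a b, 0 ≤ a → a ≤ b → b ≤ Y → ell b - ell a ≤ M * (b - a) := by
  by_cases hY0 : 0 ≤ Y
  swap
  · exact ⟨0, le_rfl, fun a b ha hab hb => by linarith⟩
  obtain ⟨c, hc, hcs⟩ : ∃ c > 0, ∀ y ∈ Set.Icc 0 Y, c ≤ Real.sinc y := by
    obtain ⟨y, hy, hmin⟩ := isCompact_Icc.exists_isMinOn ⟨0, le_rfl, hY0⟩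
      (Real.continuous_sinc.continuousOn (s := Set.Icc 0 Y))
    exact ⟨Real.sinc y, sinc_pos hy.1 (hy.2.trans_lt hY), fun z hz => hmin hz⟩
  -- From (y³)² + y⁴ = (y³ + y) y³ in the numerator and y (c y)² = c² y³ in the denominator.
  set M := (Real.pi ^ 3 + Real.pi) / c ^ 2 with hM
  have hpi := Real.pi_pos
  have hMpos : 0 ≤ M := by positivity
  have hbound : ∀ y ∈ Set.Ioo 0 Y, ellDeriv y ≤ M := by
    intro y hy
    have hs := Real.sin_pos_of_pos_of_lt_pi hy.1 (hy.2.trans hY)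
    have h1 : c * y ≤ Real.sin y := by
      have := hcs y (Set.Ioo_subset_Icc_self hy)
      rwa [Real.sinc_of_ne_zero hy.1.ne', le_div_iff₀ hy.1] at this
    have h2 : Real.sin y ≤ y := Real.sin_le hy.1.le
    have h3 := Real.sin_ge_sub_cube hy.1.le
    have h4 := Real.one_sub_sq_div_two_le_cos (x := y)
    have h5 : y - Real.sin y * Real.cos y ≤ y ^ 3 := by
      have : Real.sin y * (1 - Real.cos y) ≤ y * (y ^ 2 / 2) :=
        mul_le_mul h2 (by linarith) (by linarith [Real.cos_le_one y]) hy.1.le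
      nlinarith [pow_pos hy.1 3]
    have h5' : 0 ≤ y - Real.sin y * Real.cos y := by nlinarith [Real.cos_le_one y]
    have h6 : (y - Real.sin y * Real.cos y) ^ 2 ≤ (y ^ 3) ^ 2 := by gcongr
    have h7 : Real.sin y ^ 4 ≤ y ^ 4 := by gcongr
    have h8 : (c * y) ^ 2 ≤ Real.sin y ^ 2 := by
      have := hy.1
      gcongr
    have hy3 : y ≤ Real.pi := (hy.2.trans hY).le
    have hy0 := hy.1
    unfold ellDeriv
    rw [div_le_iff₀ (by positivity)]
    calc _ ≤ (y ^ 3) ^ 2 + y ^ 4 := add_le_add h6 h7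
      _ = (y ^ 3 + y) * y ^ 3 := by ring
      _ ≤ (Real.pi ^ 3 + Real.pi) * y ^ 3 := by gcongr
      _ = M * (y * (c * y) ^ 2) := by rw [hM]; field_simp
      _ ≤ M * (y * Real.sin y ^ 2) := by gcongr
  refine ⟨M, hMpos, fun a b ha hab hb => ?_⟩
  have hmono : MonotoneOn (fun y => M * y - ell y) (Set.Icc 0 Y) := by
    refine monotoneOn_of_deriv_nonneg (convex_Icc _ _) ((by fun_prop : ContinuousOn _ _).sub
      (continuousOn_ell.mono (Set.Icc_subset_Ico_right hY))) ?_ ?_ <;> rw [interior_Icc]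
    · intro y hy
      exact (((hasDerivAt_id y).const_mul M).sub
        (hasDerivAt_ell hy.1 (hy.2.trans hY))).differentiableAt.differentiableWithinAt
    · intro y hy
      have hd : HasDerivAt (fun y => M * y - ell y) _ y :=
        ((hasDerivAt_id y).const_mul M).sub (hasDerivAt_ell hy.1 (hy.2.trans hY))
      rw [hd.deriv]
      have := hbound y hy
      linarith
  have := hmono ⟨ha, hab.trans hb⟩ ⟨ha.trans hab, hb⟩ hab
  simp only at this
  linarith

/-! ### The Lambert branches on the negative real axis -/

/-- The point of the quadratrix with imaginary part `y`, scaled by `2 δ`. -/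
def quad (y : ℝ) : ℂ := ⟨Real.cos y / Real.sinc y, y⟩

lemma mul_sinc (y : ℝ) : y * Real.sinc y = Real.sin y := by
  rcases eq_or_ne y 0 with rfl | h
  · simp
  · rw [Real.sinc_of_ne_zero h, mul_div_cancel₀ _ h]

lemma quad_eq {y : ℝ} (h : Real.sinc y ≠ 0) :
    quad y = ((1 / Real.sinc y : ℝ) : ℂ) * Complex.exp (y * Complex.I) := by
  have h1 := mul_sinc y
  apply Complex.ext
  · rw [Complex.re_ofReal_mul, Complex.exp_ofReal_mul_I_re, quad]
    simp only; ring
  · rw [Complex.im_ofReal_mul, Complex.exp_ofReal_mul_I_im, quad, ← h1]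
    field_simp

/-- In polar form `quad y` has modulus 1 / sinc y and argument y, and the exponential contributes
the opposite phase. The quadratrix is thus where the Lambert argument is real. -/
lemma quad_mul_exp {y : ℝ} (h0 : 0 ≤ y) (h1 : y < Real.pi) :
    -quad y * Complex.exp (-quad y) = ((-Real.exp (ell y - 1) : ℝ) : ℂ) := by
  have hs := sinc_pos h0 h1
  have h2 : -quad y = ((-(Real.cos y / Real.sinc y) : ℝ) : ℂ) + ((-(y * Complex.I)) : ℂ) := by
    apply Complex.ext <;> simp [quad, -Complex.ofReal_cos, -Complex.ofReal_div]
  rw [show Complex.exp (-quad y) =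
    ((Real.exp (-(Real.cos y / Real.sinc y)) : ℝ) : ℂ) * Complex.exp (-(y * Complex.I)) by
      rw [h2, Complex.exp_add, Complex.ofReal_exp], quad_eq hs.ne', ell]
  have h3 : Real.exp (1 - Real.cos y / Real.sinc y - Real.log (Real.sinc y) - 1) =
      1 / Real.sinc y * Real.exp (-(Real.cos y / Real.sinc y)) := by
    rw [show 1 - Real.cos y / Real.sinc y - Real.log (Real.sinc y) - 1 =
      -Real.log (Real.sinc y) + -(Real.cos y / Real.sinc y) by ring, Real.exp_add, Real.exp_neg,
      Real.exp_log hs, one_div]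
  rw [h3]
  have h4 : Complex.exp (y * Complex.I) * Complex.exp (-(y * Complex.I)) = 1 := by
    rw [← Complex.exp_add, add_neg_cancel, Complex.exp_zero]
  rw [Complex.ofReal_neg, Complex.ofReal_mul]
  linear_combination (-((1 / Real.sinc y : ℝ) : ℂ) *
    ((Real.exp (-(Real.cos y / Real.sinc y)) : ℝ) : ℂ)) * h4

lemma re_im_of_mul_exp {w : ℂ} {a : ℝ} (h : w * Complex.exp w = a) :
    w.re * Real.sin w.im + w.im * Real.cos w.im = 0 ∧
      Real.exp w.re * (w.re * Real.cos w.im - w.im * Real.sin w.im) = a := by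
  have h1 := congrArg Complex.im h
  have h2 := congrArg Complex.re h
  rw [Complex.mul_im, Complex.exp_re, Complex.exp_im, Complex.ofReal_im] at h1
  rw [Complex.mul_re, Complex.exp_re, Complex.exp_im, Complex.ofReal_re] at h2
  constructor
  · have : Real.exp w.re * (w.re * Real.sin w.im + w.im * Real.cos w.im) = 0 := by linarith
    exact (mul_eq_zero.1 this).resolve_left (Real.exp_ne_zero _)
  · linarith

/-- Vanishing of the imaginary part places w on a curve re w = -im w cot (im w), and the real part
fixes the sign of sin (im w). These two facts eliminate the irrelevant pieces of the branch ranges.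
-/
lemma nonreal_solution {w : ℂ} {a : ℝ} (h : w * Complex.exp w = a) (hw : w.im ≠ 0) :
    Real.sin w.im ≠ 0 ∧ w.re = -w.im * Real.cot w.im ∧
      a * Real.sin w.im = -(w.im * Real.exp w.re) := by
  obtain ⟨h1, h2⟩ := re_im_of_mul_exp h
  have h3 := Real.sin_sq_add_cos_sq w.im
  have hs : Real.sin w.im ≠ 0 := by
    intro hs
    rw [hs] at h1 h3
    have hc : Real.cos w.im ≠ 0 := by rintro hc; rw [hc] at h3; norm_num at h3
    have : w.im * Real.cos w.im = 0 := by linarith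
    exact (mul_ne_zero hw hc) this
  refine ⟨hs, ?_, ?_⟩
  · rw [Real.cot_eq_cos_div_sin]
    field_simp
    linarith
  · rw [← h2]
    linear_combination (Real.exp w.re * Real.cos w.im) * h1 - (Real.exp w.re * w.im) * h3

lemma real_solution {w : ℂ} {a : ℝ} (h : w * Complex.exp w = a) (hw : w.im = 0) :
    w.re * Real.exp w.re = a := by
  obtain ⟨-, h2⟩ := re_im_of_mul_exp h
  rw [hw] at h2
  simp at h2
  linarith

lemma cot_neg_real (y : ℝ) : Real.cot (-y) = -Real.cot y := by
  rw [Real.cot_eq_cos_div_sin, Real.cot_eq_cos_div_sin, Real.cos_neg, Real.sin_neg, div_neg]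

lemma mul_cot {y : ℝ} (h : y ≠ 0) : y * Real.cot y = Real.cos y / Real.sinc y := by
  rw [Real.cot_eq_cos_div_sin, Real.sinc_of_ne_zero h]
  field_simp

/-- Solutions in the strip `-π < im w < 0` come from the quadratrix. -/
lemma strip_solution {w : ℂ} {a : ℝ} (h : w * Complex.exp w = a) (h0 : -Real.pi < w.im)
    (h1 : w.im < 0) : w = -quad (-w.im) ∧ a = -Real.exp (ell (-w.im) - 1) := by
  obtain ⟨-, h2, -⟩ := nonreal_solution h h1.ne
  have h3 : w = -quad (-w.im) := by
    apply Complex.ext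
    · rw [h2, Complex.neg_re, quad]
      simp only
      rw [← mul_cot (neg_ne_zero.2 h1.ne), cot_neg_real]
      ring
    · simp [quad]
  refine ⟨h3, ?_⟩
  have h4 := quad_mul_exp (y := -w.im) (by linarith) (by linarith)
  rw [← h3, h] at h4
  exact_mod_cast h4

/-- The conjugate strip. -/
lemma strip_solution_conj {w : ℂ} {a : ℝ} (h : w * Complex.exp w = a) (h0 : 0 < w.im)
    (h1 : w.im < Real.pi) : a = -Real.exp (ell w.im - 1) := by
  have h2 : starRingEnd ℂ w * Complex.exp (starRingEnd ℂ w) = a := by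
    rw [Complex.exp_conj, ← map_mul, h, Complex.conj_ofReal]
  have := (strip_solution h2 (by simpa using h1) (by simpa using h0)).2
  simpa using this

/-- There are no negative values of `w exp w` attained with `im w ∈ [-2π, -π]`. -/
lemma no_solution_second_strip {w : ℂ} {a : ℝ} (ha : a < 0) (h : w * Complex.exp w = a)
    (h0 : -(2 * Real.pi) ≤ w.im) (h1 : w.im ≤ -Real.pi) : False := by
  have hpi := Real.pi_pos
  have hw : w.im < 0 := by linarith
  obtain ⟨h2, -, h3⟩ := nonreal_solution h hw.ne
  have h4 : 0 ≤ Real.sin w.im := by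
    rw [← Real.sin_add_two_pi]
    exact Real.sin_nonneg_of_nonneg_of_le_pi (by linarith) (by linarith)
  nlinarith [Real.exp_pos w.re, mul_pos_of_neg_of_neg hw (neg_neg_of_pos (Real.exp_pos w.re))]

/-- The branch value is an arbitrary choice, so this is all that is known of it. That the range
leaves a single possibility is derived case by case below. -/
lemma lambertInverse_spec {D : Set ℂ} {z : ℂ} (h : ∃ w ∈ D, w * Complex.exp w = z) :
    lambertInverse D z ∈ D ∧ lambertInverse D z * Complex.exp (lambertInverse D z) = z := by
  unfold lambertInverse
  rw [dif_pos h]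
  exact Classical.choose_spec h

/-- The convex function whose two inverse branches describe the real Lambert branches. -/
def phi (v : ℝ) : ℝ := v - 1 - Real.log v

lemma phi_one : phi 1 = 0 := by simp [phi]

/-- Insert log v = 2 log √v ≤ 2(√v - 1). This quantitative convexity yields both the range of `phi`
and the square-root moduli of its inverses. -/
lemma sq_sqrt_sub_one_le_phi {v : ℝ} (hv : 0 < v) : (√v - 1) ^ 2 ≤ phi v := by
  have h1 := Real.log_le_sub_one_of_pos (Real.sqrt_pos.2 hv)
  have h2 : Real.log v = 2 * Real.log √v := by
    rw [Real.log_sqrt hv.le]; ring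
  have h3 := Real.sq_sqrt hv.le
  unfold phi
  nlinarith

lemma continuousOn_phi : ContinuousOn phi (Set.Ioi 0) :=
  (by fun_prop : ContinuousOn (fun v : ℝ => v - 1) (Set.Ioi 0)).sub
    (Real.continuousOn_log.mono fun _ hv => (Set.mem_Ioi.1 hv).ne')

lemma exists_phi_eq_ge {p : ℝ} (hp : 0 ≤ p) : ∃ v, 1 ≤ v ∧ phi v = p := by
  have h0 : (1 : ℝ) ≤ (1 + √p) ^ 2 := by nlinarith [Real.sqrt_nonneg p]
  have h1 : p ≤ phi ((1 + √p) ^ 2) := by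
    have := sq_sqrt_sub_one_le_phi (v := (1 + √p) ^ 2) (by linarith)
    rw [Real.sqrt_sq (by positivity), add_sub_cancel_left, Real.sq_sqrt hp] at this
    exact this
  obtain ⟨v, hv, hv'⟩ := intermediate_value_Icc h0 (continuousOn_phi.mono fun v hv =>
    Set.mem_Ioi.2 (by linarith [hv.1])) (⟨by rwa [phi_one], h1⟩ : p ∈ Set.Icc (phi 1) _)
  exact ⟨v, hv.1, hv'⟩

lemma exists_phi_eq_le {p : ℝ} (hp : 0 ≤ p) : ∃ v, 0 < v ∧ v ≤ 1 ∧ phi v = p := by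
  have h0 : Real.exp (-1 - p) ≤ 1 := Real.exp_le_one_iff.2 (by linarith)
  have h1 : p ≤ phi (Real.exp (-1 - p)) := by
    unfold phi
    rw [Real.log_exp]
    linarith [Real.exp_pos (-1 - p)]
  obtain ⟨v, hv, hv'⟩ := intermediate_value_Icc' h0 (continuousOn_phi.mono fun v hv =>
    Set.mem_Ioi.2 ((Real.exp_pos _).trans_le hv.1)) (⟨by rwa [phi_one], h1⟩ :
      p ∈ Set.Icc (phi 1) _)
  exact ⟨v, (Real.exp_pos _).trans_le hv.1, hv.2, hv'⟩

lemma neg_mul_exp_eq_iff {v p : ℝ} (hv : 0 < v) :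
    -v * Real.exp (-v) = -Real.exp (-1 - p) ↔ phi v = p := by
  have h1 : v * Real.exp (-v) = Real.exp (-1 - phi v) := by
    rw [phi, show -1 - (v - 1 - Real.log v) = Real.log v + -v by ring, Real.exp_add,
      Real.exp_log hv]
  rw [neg_mul, neg_inj, h1, Real.exp_eq_exp]
  constructor <;> intro h <;> linarith

/-- The branch `W₀` on `[-1/e, 0)`. -/
lemma lambertW0_spec {p : ℝ} (hp : 0 ≤ p) :
    ∃ v, 0 < v ∧ v ≤ 1 ∧ phi v = p ∧ lambertW0 ((-Real.exp (-1 - p) : ℝ) : ℂ) = ((-v : ℝ) : ℂ) := by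
  have hex : ∃ w ∈ lambertRange0, w * Complex.exp w = ((-Real.exp (-1 - p) : ℝ) : ℂ) := by
    obtain ⟨v, h0, h1, h2⟩ := exists_phi_eq_le hp
    refine ⟨((-v : ℝ) : ℂ), Or.inl ⟨Complex.ofReal_im _, ?_⟩, ?_⟩
    · rw [Complex.ofReal_re]; linarith
    · rw [← (neg_mul_exp_eq_iff h0).2 h2]; push_cast; rfl
  obtain ⟨h1, h2⟩ := lambertInverse_spec hex
  change lambertW0 _ ∈ _ at h1
  change lambertW0 _ * Complex.exp (lambertW0 _) = _ at h2
  set w := lambertW0 ((-Real.exp (-1 - p) : ℝ) : ℂ) with hw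
  rcases h1 with ⟨h3, h4⟩ | ⟨h3, h4, -⟩ | ⟨h3, h4, h5⟩
  · have h5 := real_solution h2 h3
    have h6 : w.re < 0 := by
      by_contra h7
      push Not at h7
      have := mul_nonneg h7 (Real.exp_pos w.re).le
      have := Real.exp_pos (-1 - p)
      linarith
    refine ⟨-w.re, by linarith, by linarith, (neg_mul_exp_eq_iff (by linarith)).1 ?_, ?_⟩
    · rwa [neg_neg]
    · apply Complex.ext <;> simp [h3]
  -- A nonreal solution here would have a value below -1/e, whereas -exp (-1 - p) ≥ -1/e.
  · have h5 := strip_solution_conj h2 h3 h4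
    have h6 := ell_pos h3 h4
    have : Real.exp (-1 - p) < Real.exp (ell w.im - 1) := Real.exp_lt_exp.2 (by linarith)
    linarith
  -- Every nonreal solution lies on the boundary curve, which the strict inequality in this piece of
  -- the range excludes.
  · have := (nonreal_solution h2 h4.ne).2.1
    linarith

/-- For a negative value, the second strip is excluded by the sign of the sine, and the last piece
because it omits the curve that carries all nonreal solutions. -/
lemma lambertWNeg1_cases {a : ℝ} (ha : a < 0)
    (hex : ∃ w ∈ lambertRangeNeg1, w * Complex.exp w = (a : ℂ)) :
    lambertWNeg1 a * Complex.exp (lambertWNeg1 a) = a ∧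
      (((lambertWNeg1 a).im = 0 ∧ (lambertWNeg1 a).re ≤ -1) ∨
      (-Real.pi < (lambertWNeg1 a).im ∧ (lambertWNeg1 a).im < 0)) := by
  obtain ⟨h1, h2⟩ := lambertInverse_spec hex
  change lambertWNeg1 _ ∈ _ at h1
  change lambertWNeg1 _ * Complex.exp (lambertWNeg1 _) = _ at h2
  refine ⟨h2, ?_⟩
  rcases h1 with h3 | ⟨h3, h4, -⟩ | ⟨h3, h4⟩ | ⟨h3, h4, h5⟩
  · exact Or.inl h3
  · exact Or.inr ⟨h3, h4⟩
  · exact (no_solution_second_strip ha h2 h3 h4).elim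
  · have := (nonreal_solution h2 (by linarith [Real.pi_pos])).2.1
    linarith

/-- The branch `W₋₁` on `[-1/e, 0)`. -/
lemma lambertWNeg1_spec {p : ℝ} (hp : 0 ≤ p) :
    ∃ v, 1 ≤ v ∧ phi v = p ∧ lambertWNeg1 ((-Real.exp (-1 - p) : ℝ) : ℂ) = ((-v : ℝ) : ℂ) := by
  have hex : ∃ w ∈ lambertRangeNeg1, w * Complex.exp w = ((-Real.exp (-1 - p) : ℝ) : ℂ) := by
    obtain ⟨v, h0, h2⟩ := exists_phi_eq_ge hp
    refine ⟨((-v : ℝ) : ℂ), Or.inl ⟨Complex.ofReal_im _, ?_⟩, ?_⟩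
    · rw [Complex.ofReal_re]; linarith
    · rw [← (neg_mul_exp_eq_iff (by linarith)).2 h2]; push_cast; rfl
  obtain ⟨h2, ⟨h3, h4⟩ | ⟨h3, h4⟩⟩ :=
    lambertWNeg1_cases (neg_neg_of_pos (Real.exp_pos (-1 - p))) hex
  · refine ⟨-(lambertWNeg1 ((-Real.exp (-1 - p) : ℝ) : ℂ)).re, by linarith,
      (neg_mul_exp_eq_iff (by linarith)).1 ?_, ?_⟩
    · rw [neg_neg]; exact real_solution h2 h3
    · apply Complex.ext <;> simp only [neg_neg, Complex.ofReal_re, Complex.ofReal_im, h3]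
  · have h5 := (strip_solution h2 h3 h4).2
    have h6 := ell_pos (y := -(lambertWNeg1 ((-Real.exp (-1 - p) : ℝ) : ℂ)).im) (by linarith)
      (by linarith)
    have : Real.exp (-1 - p) <
      Real.exp (ell (-(lambertWNeg1 ((-Real.exp (-1 - p) : ℝ) : ℂ)).im) - 1) :=
      Real.exp_lt_exp.2 (by linarith)
    linarith

/-- The branch `W₋₁` on `(-∞, -1/e)`. -/
lemma lambertWNeg1_neg_exp_ell {y : ℝ} (h0 : 0 < y) (h1 : y < Real.pi) :
    lambertWNeg1 ((-Real.exp (ell y - 1) : ℝ) : ℂ) = -quad y := by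
  have hex : ∃ w ∈ lambertRangeNeg1, w * Complex.exp w = ((-Real.exp (ell y - 1) : ℝ) : ℂ) := by
    refine ⟨-quad y, Or.inr (Or.inl ⟨?_, ?_, ?_⟩), quad_mul_exp h0.le h1⟩
    · simpa [quad] using h1
    · simpa [quad] using h0
    · simp only [Complex.neg_re, Complex.neg_im, quad, cot_neg_real, neg_neg]
      rw [← mul_cot h0.ne']
      linarith
  obtain ⟨h2, ⟨h3, h4⟩ | ⟨h3, h4⟩⟩ :=
    lambertWNeg1_cases (neg_neg_of_pos (Real.exp_pos (ell y - 1))) hex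
  · have h5 := real_solution h2 h3
    set x := (lambertWNeg1 ((-Real.exp (ell y - 1) : ℝ) : ℂ)).re
    -- On the real axis -x eˣ never exceeds 1/e, so a value below -1/e has no real solution.
    have h6 : -x * Real.exp x ≤ Real.exp (-1) := by
      have : (-x) ≤ Real.exp (-x - 1) := by have := Real.add_one_le_exp (-x - 1); linarith
      calc -x * Real.exp x ≤ Real.exp (-x - 1) * Real.exp x := by gcongr
        _ = Real.exp (-1) := by rw [← Real.exp_add]; congr 1; ring
    have h7 : Real.exp (-1) < Real.exp (ell y - 1) := by
      have := ell_pos h0 h1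
      exact Real.exp_lt_exp.2 (by linarith)
    linarith
  · obtain ⟨h5, h6⟩ := strip_solution h2 h3 h4
    have h7 : ell y = ell (-(lambertWNeg1 ((-Real.exp (ell y - 1) : ℝ) : ℂ)).im) := by
      have := Real.exp_injective (neg_injective h6)
      linarith
    have h8 := strictMonoOn_ell.injOn ⟨h0.le, h1⟩ ⟨by linarith, by linarith⟩ h7
    rw [← h8] at h5
    exact h5

/-! ### Regularity of the real Lambert branches -/

/-- Because a ≥ 1, the increment of `phi` dominates `phi (b / a)`, to which the square-root bound
applies. The constant depends on b, so the resulting Hölder estimate for `vPlus` is only local. -/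
lemma sq_sub_le_phi_of_one_le {a b : ℝ} (ha : 1 ≤ a) (hab : a ≤ b) :
    (b - a) ^ 2 ≤ 4 * b ^ 2 * (phi b - phi a) := by
  have ha0 : 0 < a := by linarith
  have hb0 : 0 < b := by linarith
  have h1 := sq_sqrt_sub_one_le_phi (v := b / a) (by positivity)
  have h2 : phi (b / a) ≤ phi b - phi a := by
    unfold phi
    rw [Real.log_div hb0.ne' ha0.ne']
    have : b / a - 1 ≤ b - a := by
      rw [div_sub_one ha0.ne', div_le_iff₀ ha0]; nlinarith
    linarith
  set x := √(b / a) with hx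
  have hx2 : x ^ 2 = b / a := Real.sq_sqrt (by positivity)
  have hx1 : 1 ≤ x := by
    rw [hx, Real.one_le_sqrt, one_le_div ha0]; exact hab
  have h3 : b = a * x ^ 2 := by rw [hx2]; field_simp
  have h4 : b - a = (x - 1) * (a * x + a) := by rw [h3]; ring
  have h5 : a * x + a ≤ 2 * b := by
    rw [h3]; nlinarith [mul_le_mul_of_nonneg_left hx1 ha0.le,
      mul_le_mul_of_nonneg_left (mul_le_mul_of_nonneg_left hx1 (by linarith : 0 ≤ x)) ha0.le]
  calc (b - a) ^ 2 = (x - 1) ^ 2 * (a * x + a) ^ 2 := by rw [h4]; ring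
    _ ≤ (phi b - phi a) * (2 * b) ^ 2 := by
      gcongr
      · exact (sq_nonneg _).trans (h1.trans h2)
      · exact h1.trans h2
    _ = _ := by ring

lemma sq_sub_le_phi_of_le_one {a b : ℝ} (ha : 0 < a) (hab : a ≤ b) (hb : b ≤ 1) :
    (b - a) ^ 2 ≤ 4 * (phi a - phi b) := by
  have hb0 : 0 < b := by linarith
  have h1 := sq_sqrt_sub_one_le_phi (v := a / b) (by positivity)
  have h2 : phi (a / b) ≤ phi a - phi b := by
    unfold phi
    rw [Real.log_div ha.ne' hb0.ne']
    have : a / b - 1 ≤ a - b := by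
      rw [div_sub_one hb0.ne', div_le_iff₀ hb0]; nlinarith
    linarith
  set x := √(a / b) with hx
  have hx2 : x ^ 2 = a / b := Real.sq_sqrt (by positivity)
  have hx0 : 0 ≤ x := Real.sqrt_nonneg _
  have hx1 : x ≤ 1 := by
    exact Real.sqrt_le_one.2 ((div_le_one hb0).2 hab)
  have h3 : a = b * x ^ 2 := by rw [hx2]; field_simp
  have h4 : b - a = (1 - x) * (b * (1 + x)) := by rw [h3]; ring
  have h5 : b * (1 + x) ≤ 2 := by nlinarith
  calc (b - a) ^ 2 = (x - 1) ^ 2 * (b * (1 + x)) ^ 2 := by rw [h4]; ring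
    _ ≤ (phi a - phi b) * 2 ^ 2 := by
      gcongr
      · exact (sq_nonneg _).trans (h1.trans h2)
      · exact h1.trans h2
    _ = _ := by ring

lemma strictMonoOn_phi : StrictMonoOn phi (Set.Ici 1) := by
  intro a ha b _ hab
  have h1 := sq_sub_le_phi_of_one_le ha hab.le
  have h2 : 0 < (b - a) ^ 2 := by have := sub_pos.2 hab; positivity
  have h3 : 0 < 4 * b ^ 2 := by
    have : 0 < b := by linarith [Set.mem_Ici.1 ha]
    positivity
  by_contra h
  push Not at h
  nlinarith

lemma strictAntiOn_phi : StrictAntiOn phi (Set.Ioc 0 1) := by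
  intro a ha b hb hab
  have h1 := sq_sub_le_phi_of_le_one ha.1 hab.le hb.2
  have h2 : 0 < (b - a) ^ 2 := by have := sub_pos.2 hab; positivity
  linarith

lemma hasDerivAt_phi {v : ℝ} (hv : v ≠ 0) : HasDerivAt phi (1 - v⁻¹) v :=
  ((hasDerivAt_id v).sub_const 1).sub (Real.hasDerivAt_log hv)

/-- Minus the branch `W₋₁` at `-exp (-1 - p)`. -/
def vPlus (p : ℝ) : ℝ := -(lambertWNeg1 ((-Real.exp (-1 - p) : ℝ) : ℂ)).re

/-- Minus the branch `W₀` at `-exp (-1 - p)`. -/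
def vMinus (p : ℝ) : ℝ := -(lambertW0 ((-Real.exp (-1 - p) : ℝ) : ℂ)).re

lemma vPlus_spec {p : ℝ} (hp : 0 ≤ p) : 1 ≤ vPlus p ∧ phi (vPlus p) = p := by
  obtain ⟨v, h1, h2, h3⟩ := lambertWNeg1_spec hp
  rw [vPlus, h3, Complex.ofReal_re, neg_neg]
  exact ⟨h1, h2⟩

lemma vMinus_spec {p : ℝ} (hp : 0 ≤ p) : 0 < vMinus p ∧ vMinus p ≤ 1 ∧ phi (vMinus p) = p := by
  obtain ⟨v, h0, h1, h2, h3⟩ := lambertW0_spec hp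
  rw [vMinus, h3, Complex.ofReal_re, neg_neg]
  exact ⟨h0, h1, h2⟩

lemma vPlus_strictMonoOn : StrictMonoOn vPlus (Set.Ici 0) := by
  intro p hp q hq hpq
  obtain ⟨h1, h2⟩ := vPlus_spec hp
  obtain ⟨h3, h4⟩ := vPlus_spec hq
  rw [← strictMonoOn_phi.lt_iff_lt h1 h3, h2, h4]
  exact hpq

lemma vMinus_strictAntiOn : StrictAntiOn vMinus (Set.Ici 0) := by
  intro p hp q hq hpq
  obtain ⟨h0, h1, h2⟩ := vMinus_spec hp
  obtain ⟨h3, h4, h5⟩ := vMinus_spec hq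
  rw [← strictAntiOn_phi.lt_iff_gt ⟨h0, h1⟩ ⟨h3, h4⟩, h2, h5]
  exact hpq

/-- The difference `W₀ - W₋₁` at `-exp (-1 - p)`, extended by zero to `p < 0`. -/
def gap (p : ℝ) : ℝ := vPlus (max p 0) - vMinus (max p 0)

lemma gap_of_nonneg {p : ℝ} (hp : 0 ≤ p) : gap p = vPlus p - vMinus p := by
  rw [gap, max_eq_left hp]

lemma gap_of_nonpos {p : ℝ} (hp : p ≤ 0) : gap p = 0 := by
  have h1 := vPlus_spec (le_refl 0)
  have h2 := vMinus_spec (le_refl 0)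
  have h3 : vPlus 0 = 1 := strictMonoOn_phi.injOn h1.1 Set.self_mem_Ici (by rw [h1.2, phi_one])
  have h4 : vMinus 0 = 1 :=
    strictAntiOn_phi.injOn ⟨h2.1, h2.2.1⟩ ⟨one_pos, le_rfl⟩ (by rw [h2.2.2, phi_one])
  rw [gap, max_eq_right hp, h3, h4, sub_self]

lemma gap_mono : Monotone gap := by
  intro p q hpq
  have h : max p 0 ≤ max q 0 := max_le_max_right 0 hpq
  have h1 := vPlus_strictMonoOn.monotoneOn (le_max_right p 0) (le_max_right q 0) h
  have h2 := vMinus_strictAntiOn.antitoneOn (le_max_right p 0) (le_max_right q 0) h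
  unfold gap
  linarith

lemma gap_lt {p q : ℝ} (hpq : p < q) (hq : 0 < q) : gap p < gap q := by
  have h : max p 0 < max q 0 := by rw [max_eq_left hq.le]; exact max_lt hpq hq
  have h1 := vPlus_strictMonoOn (le_max_right p 0) (le_max_right q 0) h
  have h2 := vMinus_strictAntiOn (le_max_right p 0) (le_max_right q 0) h
  unfold gap
  linarith

lemma gap_nonneg (p : ℝ) : 0 ≤ gap p := by
  rcases le_total p 0 with h | h
  · rw [gap_of_nonpos h]
  · rw [← gap_of_nonpos le_rfl]; exact gap_mono h

/-- The exponent 1/2 reflects the square-root branch point where W₀ and W₋₁ meet. The cutoff P is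
needed because the constant for `vPlus` grows with its argument. -/
lemma exists_gap_holder (P : ℝ) : ∃ B, 0 ≤ B ∧ ∀ p q, p ≤ q → q ≤ P →
    gap q - gap p ≤ B * √(q - p) := by
  set M := vPlus (max P 0)
  have hM : 1 ≤ M := (vPlus_spec (le_max_right P 0)).1
  refine ⟨2 * M + 2, by linarith, fun p q hpq hq => ?_⟩
  set p' := max p 0 with hp'
  set q' := max q 0 with hq'
  have hp0 : 0 ≤ p' := le_max_right _ _
  have hq0 : 0 ≤ q' := le_max_right _ _
  have h : p' ≤ q' := max_le_max_right 0 hpq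
  have hd : q' - p' ≤ q - p := by
    rcases max_cases p 0 with h1 | h1 <;> rcases max_cases q 0 with h2 | h2 <;>
      simp only [hp', hq'] <;> linarith
  have h1 : vPlus q' - vPlus p' ≤ 2 * M * √(q - p) := by
    have h2 := vPlus_strictMonoOn.monotoneOn hp0 hq0 h
    have h3 := sq_sub_le_phi_of_one_le (vPlus_spec hp0).1 h2
    rw [(vPlus_spec hp0).2, (vPlus_spec hq0).2] at h3
    have h4 : vPlus q' ≤ M :=
      vPlus_strictMonoOn.monotoneOn hq0 (le_max_right P 0) (max_le_max_right 0 hq)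
    have h5 := (vPlus_spec hq0).1
    refine abs_le_of_sq_le_sq' (a := vPlus q' - vPlus p') ?_ (by positivity) |>.2
    rw [mul_pow, Real.sq_sqrt (by linarith)]
    calc (vPlus q' - vPlus p') ^ 2 ≤ 4 * vPlus q' ^ 2 * (q' - p') := h3
      _ ≤ 4 * M ^ 2 * (q - p) := by gcongr
      _ = _ := by ring
  have h2 : vMinus p' - vMinus q' ≤ 2 * √(q - p) := by
    have h2 := vMinus_strictAntiOn.antitoneOn hp0 hq0 h
    have h3 := sq_sub_le_phi_of_le_one (vMinus_spec hq0).1 h2 (vMinus_spec hp0).2.1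
    rw [(vMinus_spec hp0).2.2, (vMinus_spec hq0).2.2] at h3
    refine abs_le_of_sq_le_sq' (a := vMinus p' - vMinus q') ?_ (by positivity) |>.2
    rw [mul_pow, Real.sq_sqrt (by linarith)]
    linarith
  unfold gap
  linarith

lemma continuous_gap : Continuous gap := by
  rw [continuous_iff_continuousAt]
  intro p
  obtain ⟨B, hB, h⟩ := exists_gap_holder (p + 1)
  rw [ContinuousAt, tendsto_iff_norm_sub_tendsto_zero]
  have hlim : Tendsto (fun q => B * √|q - p|) (𝓝 p) (𝓝 0) := by
    have : Continuous fun q => B * √|q - p| := by fun_prop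
    simpa using this.tendsto p
  refine squeeze_zero' (Eventually.of_forall fun _ => norm_nonneg _) ?_ hlim
  filter_upwards [Iio_mem_nhds (lt_add_one p)] with q hq
  rw [Real.norm_eq_abs]
  rcases le_total p q with h1 | h1
  · rw [abs_of_nonneg (sub_nonneg.2 (gap_mono h1)), abs_of_nonneg (sub_nonneg.2 h1)]
    exact h p q h1 (Set.mem_Iio.1 hq).le
  · rw [abs_sub_comm, abs_of_nonneg (sub_nonneg.2 (gap_mono h1)), abs_sub_comm q,
      abs_of_nonneg (sub_nonneg.2 h1)]
    exact h q p h1 (by linarith)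

/-- Both branches are continuous on `(0, ∞)` since their monotone difference is. -/
lemma continuousAt_vPlus_vMinus {p : ℝ} (hp : 0 < p) : ContinuousAt vPlus p ∧ ContinuousAt vMinus p := by
  have hg := (continuous_gap.continuousAt (x := p)).tendsto
  rw [tendsto_iff_norm_sub_tendsto_zero] at hg
  constructor <;> rw [ContinuousAt, tendsto_iff_norm_sub_tendsto_zero] <;>
  refine squeeze_zero' (Eventually.of_forall fun _ => norm_nonneg _) ?_ hg <;>
  filter_upwards [Ioi_mem_nhds hp] with q hq <;>
  rw [gap_of_nonneg hp.le, gap_of_nonneg (Set.mem_Ioi.1 hq).le, Real.norm_eq_abs,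
    Real.norm_eq_abs] <;>
  rcases le_total p q with h | h
  · have h1 := vPlus_strictMonoOn.monotoneOn hp.le (Set.mem_Ioi.1 hq).le h
    have h2 := vMinus_strictAntiOn.antitoneOn hp.le (Set.mem_Ioi.1 hq).le h
    rw [abs_of_nonneg (by linarith), abs_of_nonneg (by linarith)]; linarith
  · have h1 := vPlus_strictMonoOn.monotoneOn (Set.mem_Ioi.1 hq).le hp.le h
    have h2 := vMinus_strictAntiOn.antitoneOn (Set.mem_Ioi.1 hq).le hp.le h
    rw [abs_of_nonpos (by linarith), abs_of_nonpos (by linarith)]; linarith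
  · have h1 := vPlus_strictMonoOn.monotoneOn hp.le (Set.mem_Ioi.1 hq).le h
    have h2 := vMinus_strictAntiOn.antitoneOn hp.le (Set.mem_Ioi.1 hq).le h
    rw [abs_of_nonpos (by linarith), abs_of_nonneg (by linarith)]; linarith
  · have h1 := vPlus_strictMonoOn.monotoneOn (Set.mem_Ioi.1 hq).le hp.le h
    have h2 := vMinus_strictAntiOn.antitoneOn (Set.mem_Ioi.1 hq).le hp.le h
    rw [abs_of_nonneg (by linarith), abs_of_nonpos (by linarith)]; linarith

/-- Each branch inverts `phi`, whose derivative 1 - 1/v vanishes only at v = 1, that is at p = 0. -/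
lemma differentiableAt_gap {p : ℝ} (hp : 0 < p) : DifferentiableAt ℝ gap p := by
  have key : ∀ g : ℝ → ℝ, ContinuousAt g p → (∀ q, 0 < q → 0 < g q ∧ phi (g q) = q) →
      DifferentiableAt ℝ g p := by
    intro g hg hspec
    obtain ⟨h0, h1⟩ := hspec p hp
    have hne : g p ≠ 1 := by
      intro h; rw [h, phi_one] at h1; linarith
    refine (HasDerivAt.of_local_left_inverse hg (hasDerivAt_phi h0.ne') ?_ ?_).differentiableAt
    · intro h
      apply hne
      field_simp at h
      linarith
    · filter_upwards [Ioi_mem_nhds hp] with q hq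
      exact (hspec q hq).2
  have h1 := key vPlus (continuousAt_vPlus_vMinus hp).1 fun q hq =>
    ⟨by linarith [(vPlus_spec hq.le).1], (vPlus_spec hq.le).2⟩
  have h2 := key vMinus (continuousAt_vPlus_vMinus hp).2 fun q hq =>
    ⟨(vMinus_spec hq.le).1, (vMinus_spec hq.le).2.2⟩
  refine (h1.sub h2).congr_of_eventuallyEq ?_
  filter_upwards [Ioi_mem_nhds hp] with q hq
  exact gap_of_nonneg (Set.mem_Ioi.1 hq).le

/-! ### The inverse of the level function -/

/-- Minus the imaginary part of `W₋₁` at `-exp (p - 1)`. -/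
def yInv (p : ℝ) : ℝ := -(lambertWNeg1 ((-Real.exp (p - 1) : ℝ) : ℂ)).im

lemma yInv_of_nonpos {p : ℝ} (hp : p ≤ 0) : yInv p = 0 := by
  obtain ⟨v, -, -, h⟩ := lambertWNeg1_spec (p := -p) (by linarith)
  rw [show -1 - -p = p - 1 by ring] at h
  rw [yInv, h, Complex.ofReal_im, neg_zero]

lemma yInv_ell {y : ℝ} (h0 : 0 ≤ y) (h1 : y < Real.pi) : yInv (ell y) = y := by
  rcases h0.eq_or_lt with rfl | h
  · rw [ell_zero, yInv_of_nonpos le_rfl]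
  · rw [yInv, lambertWNeg1_neg_exp_ell h h1]
    simp [quad]

lemma yInv_spec (p : ℝ) : yInv p ∈ Set.Ico 0 Real.pi ∧ ell (yInv p) = max p 0 := by
  rcases le_total p 0 with h | h
  · rw [yInv_of_nonpos h, max_eq_right h, ell_zero]
    exact ⟨⟨le_rfl, Real.pi_pos⟩, rfl⟩
  · obtain ⟨y, hy, rfl⟩ := exists_ell_eq h
    rw [yInv_ell hy.1 hy.2, max_eq_left h]
    exact ⟨hy, rfl⟩

lemma yInv_mono : Monotone yInv := by
  intro p q hpq
  rw [← strictMonoOn_ell.le_iff_le (yInv_spec p).1 (yInv_spec q).1, (yInv_spec p).2,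
    (yInv_spec q).2]
  exact max_le_max_right 0 hpq

lemma yInv_sub_le {p q : ℝ} (hpq : p ≤ q) : yInv q - yInv p ≤ Real.pi * √(q - p) := by
  have h1 := ell_sub_ell_ge (yInv_spec p).1.1 (yInv_mono hpq) (yInv_spec q).1.2
  rw [(yInv_spec p).2, (yInv_spec q).2] at h1
  have hd : max q 0 - max p 0 ≤ q - p := by
    rcases max_cases p 0 with h1 | h1 <;> rcases max_cases q 0 with h2 | h2 <;> linarith
  have hpi := Real.pi_pos
  refine abs_le_of_sq_le_sq' (a := yInv q - yInv p) ?_ (by positivity) |>.2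
  rw [mul_pow, Real.sq_sqrt (by linarith)]
  have h2 : 2 / Real.pi ^ 2 * (yInv q - yInv p) ^ 2 ≤ q - p := h1.trans hd
  rw [div_mul_eq_mul_div, div_le_iff₀ (by positivity)] at h2
  nlinarith [sq_nonneg (yInv q - yInv p)]

lemma continuous_yInv : Continuous yInv := by
  rw [continuous_iff_continuousAt]
  intro p
  rw [ContinuousAt, tendsto_iff_norm_sub_tendsto_zero]
  have hlim : Tendsto (fun q => Real.pi * √|q - p|) (𝓝 p) (𝓝 0) := by
    have : Continuous fun q => Real.pi * √|q - p| := by fun_prop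
    simpa using this.tendsto p
  refine squeeze_zero' (Eventually.of_forall fun _ => norm_nonneg _)
    (Eventually.of_forall fun q => ?_) hlim
  rw [Real.norm_eq_abs]
  rcases le_total p q with h1 | h1
  · rw [abs_of_nonneg (sub_nonneg.2 (yInv_mono h1)), abs_of_nonneg (sub_nonneg.2 h1)]
    exact yInv_sub_le h1
  · rw [abs_sub_comm, abs_of_nonneg (sub_nonneg.2 (yInv_mono h1)), abs_sub_comm q,
      abs_of_nonneg (sub_nonneg.2 h1)]
    exact yInv_sub_le h1

/-! ### The quadratrix and the level function -/

section Quadratrix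

variable {δ : ℝ} (hδ : 0 < δ)

include hδ in
lemma zeta_eq (κ : ℝ) : (2 * δ : ℂ) * zeta δ κ = quad (2 * δ * κ) := by
  unfold zeta quad
  split_ifs with h
  · subst h
    have : (δ : ℂ) ≠ 0 := by exact_mod_cast hδ.ne'
    push_cast
    simp only [mul_zero, Real.cos_zero, Real.sinc_zero, div_one]
    rw [mul_one_div_cancel (by simpa using this)]
    rfl
  · have hy : 2 * δ * κ ≠ 0 := by positivity
    rw [← mul_cot hy, ← Complex.ofReal_ofNat, ← Complex.ofReal_mul]
    apply Complex.ext
    · rw [Complex.re_ofReal_mul]; simp only; ring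
    · rw [Complex.im_ofReal_mul]

lemma zeta_im (δ κ : ℝ) : (zeta δ κ).im = κ := by
  unfold zeta
  split_ifs with h
  · rw [h, Complex.ofReal_im]
  · rfl

lemma zeta_injective (δ : ℝ) : Function.Injective (zeta δ) := fun a b h => by
  have := congrArg Complex.im h
  rwa [zeta_im, zeta_im] at this

include hδ in
lemma zeta_eq_div (κ : ℝ) : zeta δ κ = ((1 / (2 * δ) : ℝ) : ℂ) * quad (2 * δ * κ) := by
  have : (δ : ℂ) ≠ 0 := by exact_mod_cast hδ.ne'
  rw [← zeta_eq hδ]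
  push_cast
  field_simp

include hδ in
lemma level_zeta {κ : ℝ} (h0 : 0 ≤ κ) (h1 : 2 * δ * κ < Real.pi) :
    level δ (zeta δ κ) = ell (2 * δ * κ) / (2 * δ) := by
  have hs := sinc_pos (by positivity) h1
  have hn : ‖quad (2 * δ * κ)‖ = (Real.sinc (2 * δ * κ))⁻¹ := by
    rw [quad_eq hs.ne', norm_mul, Complex.norm_exp_ofReal_mul_I, mul_one, Complex.norm_real,
      Real.norm_eq_abs, abs_of_pos (by positivity), one_div]
  unfold level
  rw [zeta_eq hδ, zeta_eq_div hδ, ell]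
  rw [show ((2 : ℂ) * δ) = ((2 * δ : ℝ) : ℂ) by push_cast; rfl]
  rw [Complex.add_re, Complex.div_ofReal_re, Complex.neg_re, Complex.re_ofReal_mul, Complex.add_re,
    Complex.log_re, hn, Real.log_inv, Complex.one_re]
  simp only [quad]
  field_simp
  ring

include hδ in
-- With p = 2δu - `ell`, the argument is -exp (-1 - p). For p ≥ 0 both branches are real and enter
-- `gap`; for p < 0, the region of the tail integral, the imaginary part of W₋₁ is read off by
-- `yInv`.
lemma lambertArg_zeta {κ : ℝ} (h0 : 0 ≤ κ) (h1 : 2 * δ * κ < Real.pi) (u : ℝ) :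
    lambertArg δ (zeta δ κ) u = ((-Real.exp (ell (2 * δ * κ) - 2 * δ * u - 1) : ℝ) : ℂ) := by
  have h2 := quad_mul_exp (by positivity) h1
  have e1 : (-2 * δ * zeta δ κ : ℂ) = -quad (2 * δ * κ) := by
    rw [← zeta_eq hδ]; ring
  have e2 : (-2 * δ * (zeta δ κ + u) : ℂ) = -quad (2 * δ * κ) + ((-(2 * δ * u) : ℝ) : ℂ) := by
    rw [← zeta_eq hδ]; push_cast; ring
  unfold lambertArg
  rw [e1, e2, Complex.exp_add, ← mul_assoc, h2, ← Complex.ofReal_exp, ← Complex.ofReal_mul,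
    neg_mul, ← Real.exp_add]
  congr 3
  ring

end Quadratrix

/-! ### The initial condition -/

section Initial

variable {δ : ℝ} (hδ : 0 < δ) {u₀ : ℝ → ℝ} (hu : Admissible u₀)

include hu in
lemma Admissible.continuous : Continuous u₀ := hu.contDiff.continuous

/-- Maximizer with its monotonicity properties. -/
def IsLobeTop (u₀ : ℝ → ℝ) (xm : ℝ) : Prop :=
  (∀ x, u₀ x ≤ u₀ xm) ∧ StrictMonoOn u₀ (Set.Iic xm) ∧ StrictAntiOn u₀ (Set.Ici xm)

include hu in
lemma Admissible.exists_lobeTop : ∃ xm, IsLobeTop u₀ xm := by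
  obtain ⟨xm, h1, h2, h3, -⟩ := hu.single_lobe
  exact ⟨xm, h1, h2, h3⟩

lemma IsLobeTop.uMax_eq {xm : ℝ} (h : IsLobeTop u₀ xm) : uMax u₀ = u₀ xm :=
  le_antisymm (ciSup_le h.1) (le_ciSup ⟨u₀ xm, by rintro _ ⟨x, rfl⟩; exact h.1 x⟩ xm)

include hu in
lemma Admissible.uMax_pos : 0 < uMax u₀ := by
  obtain ⟨xm, h⟩ := hu.exists_lobeTop
  rw [h.uMax_eq]; exact hu.pos _

include hu in
lemma Admissible.le_uMax (x : ℝ) : u₀ x ≤ uMax u₀ := by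
  obtain ⟨xm, h⟩ := hu.exists_lobeTop
  rw [h.uMax_eq]; exact h.1 x

lemma kappaMax_eq : kappaMax δ u₀ = yInv (2 * δ * uMax u₀) / (2 * δ) := by
  unfold kappaMax zetaMax yInv
  rw [show (-Complex.exp (2 * δ * uMax u₀ - 1) : ℂ) =
    ((-Real.exp (2 * δ * uMax u₀ - 1) : ℝ) : ℂ) by push_cast; rfl]
  rw [show (-(1 / (2 * δ)) : ℂ) = ((-(1 / (2 * δ)) : ℝ) : ℂ) by push_cast; rfl,
    Complex.im_ofReal_mul]
  ring

include hδ in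
lemma two_delta_kappaMax : 2 * δ * kappaMax δ u₀ = yInv (2 * δ * uMax u₀) := by
  rw [kappaMax_eq]; field_simp

include hδ in
lemma two_delta_kappaMax_lt : 2 * δ * kappaMax δ u₀ < Real.pi := by
  rw [two_delta_kappaMax hδ]; exact (yInv_spec _).1.2

include hδ hu in
lemma ell_kappaMax : ell (2 * δ * kappaMax δ u₀) = 2 * δ * uMax u₀ := by
  have := hu.uMax_pos
  rw [two_delta_kappaMax hδ, (yInv_spec _).2, max_eq_left (by positivity)]

include hδ hu in
lemma kappaMax_pos : 0 < kappaMax δ u₀ := by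
  have h1 := hu.uMax_pos
  have h2 := ell_kappaMax hδ hu
  have h3 : 0 ≤ kappaMax δ u₀ := by
    rw [kappaMax_eq]; exact div_nonneg (yInv_spec _).1.1 (by positivity)
  refine h3.lt_of_ne fun h => ?_
  rw [← h, mul_zero, ell_zero] at h2
  have : 0 < 2 * δ * uMax u₀ := by positivity
  linarith

include hδ in
lemma two_delta_mem {κ : ℝ} (hκ : κ ∈ Set.Icc 0 (kappaMax δ u₀)) :
    2 * δ * κ ∈ Set.Ico 0 Real.pi := by
  have := two_delta_kappaMax_lt hδ (u₀ := u₀)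
  refine ⟨mul_nonneg (by positivity) hκ.1, lt_of_le_of_lt ?_ this⟩
  exact mul_le_mul_of_nonneg_left hκ.2 (by positivity)

include hu in
lemma Admissible.exists_turning {xm E : ℝ} (h : IsLobeTop u₀ xm) (h0 : 0 < E)
    (h1 : E ≤ uMax u₀) : ∃ a b, a ≤ xm ∧ xm ≤ b ∧ u₀ a = E ∧ u₀ b = E ∧
      (∀ x, E ≤ u₀ x ↔ x ∈ Set.Icc a b) ∧ sSup {x | u₀ x = E} = b ∧ sInf {x | u₀ x = E} = a := by
  have hc := hu.continuous
  rw [h.uMax_eq] at h1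
  obtain ⟨b', hb1, hb2⟩ := ((hu.tendsto_atTop.eventually_lt_const h0).and
    (eventually_ge_atTop xm)).exists
  obtain ⟨b, hb, hbE⟩ := intermediate_value_Icc' hb2 hc.continuousOn ⟨hb1.le, h1⟩
  obtain ⟨a', ha1, ha2⟩ := ((hu.tendsto_atBot.eventually_lt_const h0).and
    (eventually_le_atBot xm)).exists
  obtain ⟨a, ha, haE⟩ := intermediate_value_Icc ha2 hc.continuousOn ⟨ha1.le, h1⟩
  have hiff : ∀ x, E ≤ u₀ x ↔ x ∈ Set.Icc a b := by
    intro x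
    rcases le_total x xm with hx | hx
    · have : E ≤ u₀ x ↔ a ≤ x := by
        rw [← haE]; exact h.2.1.le_iff_le ha.2 hx
      rw [this]
      exact ⟨fun h => ⟨h, hx.trans hb.1⟩, fun h => h.1⟩
    · have : E ≤ u₀ x ↔ x ≤ b := by
        rw [← hbE]; exact h.2.2.le_iff_ge hb.1 hx
      rw [this]
      exact ⟨fun h => ⟨ha.2.trans hx, h⟩, fun h => h.2⟩
  refine ⟨a, b, ha.2, hb.1, haE, hbE, hiff, ?_, ?_⟩
  · have : IsGreatest {x | u₀ x = E} b :=
      ⟨hbE, fun x hx => ((hiff x).1 (le_of_eq (Eq.symm hx))).2⟩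
    exact this.csSup_eq
  · have : IsLeast {x | u₀ x = E} a :=
      ⟨haE, fun x hx => ((hiff x).1 (le_of_eq (Eq.symm hx))).1⟩
    exact this.csInf_eq

include hδ hu in
lemma level_mem {κ : ℝ} (h0 : 0 < κ) (h1 : κ ≤ kappaMax δ u₀) :
    0 < ell (2 * δ * κ) / (2 * δ) ∧ ell (2 * δ * κ) / (2 * δ) ≤ uMax u₀ := by
  have h2 := two_delta_mem hδ (u₀ := u₀) ⟨h0.le, h1⟩
  have hm := two_delta_mem hδ (u₀ := u₀) ⟨(kappaMax_pos hδ hu).le, le_rfl⟩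
  refine ⟨div_pos (ell_pos (by positivity) h2.2) (by positivity), ?_⟩
  rw [div_le_iff₀ (by positivity), mul_comm (uMax u₀), ← ell_kappaMax hδ hu]
  exact strictMonoOn_ell.monotoneOn h2 hm (by gcongr)

include hδ hu in
lemma mem_allowedRegion {κ : ℝ} (hκ : κ ∈ Set.Icc 0 (kappaMax δ u₀)) (x : ℝ) :
    x ∈ allowedRegion δ u₀ (zeta δ κ) ↔ 0 ≤ 2 * δ * u₀ x - ell (2 * δ * κ) := by
  unfold allowedRegion
  rcases hκ.1.eq_or_lt with rfl | h
  · have := hu.pos x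
    simp only [if_true, Set.mem_univ, mul_zero, ell_zero, sub_zero, true_iff]
    positivity
  · rw [if_neg (fun h' => h.ne' (zeta_injective δ h'))]
    obtain ⟨xm, hxm⟩ := hu.exists_lobeTop
    obtain ⟨h1, h2⟩ := level_mem hδ hu h hκ.2
    obtain ⟨a, b, -, -, -, -, hiff, hb, ha⟩ := hu.exists_turning hxm h1 h2
    have h3 := two_delta_mem hδ hκ
    rw [xMinus, xPlus, level_zeta hδ hκ.1 h3.2, hb, ha, ← hiff, div_le_iff₀ (by positivity),
      sub_nonneg, mul_comm (u₀ x)]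

include hδ hu in
-- Since `gap` vanishes for negative argument, the moving turning points disappear and κ enters only
-- through the integrand.
lemma RWyl_zeta {κ : ℝ} (hκ : κ ∈ Set.Icc 0 (kappaMax δ u₀)) :
    RWyl δ u₀ (zeta δ κ) = 1 / (4 * δ) * ∫ x, gap (2 * δ * u₀ x - ell (2 * δ * κ)) := by
  have h3 := two_delta_mem hδ hκ
  have hmem := mem_allowedRegion hδ hu hκ
  have hmeas : MeasurableSet (allowedRegion δ u₀ (zeta δ κ)) := by
    have : allowedRegion δ u₀ (zeta δ κ) = {x | 0 ≤ 2 * δ * u₀ x - ell (2 * δ * κ)} :=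
      Set.ext hmem
    rw [this]
    have := hu.continuous
    exact (isClosed_le continuous_const (by fun_prop)).measurableSet
  unfold RWyl
  congr 1
  rw [← setIntegral_eq_integral_of_forall_compl_eq_zero (s := allowedRegion δ u₀ (zeta δ κ))
    (f := fun x => gap (2 * δ * u₀ x - ell (2 * δ * κ)))]
  · refine setIntegral_congr_fun hmeas fun x hx => ?_
    have hp := (hmem x).1 hx
    rw [lambertArg_zeta hδ hκ.1 h3.2, gap_of_nonneg hp, vPlus, vMinus, Complex.sub_re]
    rw [show -1 - (2 * δ * u₀ x - ell (2 * δ * κ)) = ell (2 * δ * κ) - 2 * δ * u₀ x - 1 by ring]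
    ring
  · intro x hx
    refine gap_of_nonpos ?_
    by_contra h
    exact hx ((hmem x).2 (not_le.1 h).le)

include hu in
-- Weighted AM-GM with weights 2/5 and 3/5 on (x² + 1)u₀ and (1 + x²)^(-2/3): the powers of 1 + x²
-- cancel, and the second function is integrable because 4/3 > 1.
lemma Admissible.integrable_rpow : Integrable fun x => u₀ x ^ (2 / 5 : ℝ) := by
  have h1 : Integrable fun x : ℝ => ((1 : ℝ) + ‖x‖ ^ 2) ^ (-(4 / 3 : ℝ) / 2) :=
    integrable_rpow_neg_one_add_norm_sq (by simp; norm_num)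
  refine (((hu.integrable.const_mul (2 / 5)).add (h1.const_mul (3 / 5)))).mono'
    ((hu.continuous.rpow_const fun x => Or.inr (by norm_num)).aestronglyMeasurable)
    (Eventually.of_forall fun x => ?_)
  have hux := hu.pos x
  have hx : 0 < 1 + x ^ 2 := by positivity
  rw [Real.norm_eq_abs, abs_of_nonneg (by positivity)]
  have h2 := Real.geom_mean_le_arith_mean2_weighted (w₁ := 2 / 5) (w₂ := 3 / 5)
    (p₁ := (x ^ 2 + 1) * u₀ x) (p₂ := (1 + x ^ 2) ^ (-(2 / 3) : ℝ)) (by norm_num) (by norm_num)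
    (by positivity) (by positivity) (by norm_num)
  have h3 : ((x ^ 2 + 1) * u₀ x) ^ (2 / 5 : ℝ) * ((1 + x ^ 2) ^ (-(2 / 3) : ℝ)) ^ (3 / 5 : ℝ) =
      u₀ x ^ (2 / 5 : ℝ) := by
    rw [Real.mul_rpow (by positivity) hux.le, ← Real.rpow_mul hx.le, add_comm (x ^ 2),
      mul_right_comm, ← Real.rpow_add hx]
    norm_num
  rw [h3] at h2
  simp only [Pi.add_apply, Real.norm_eq_abs, sq_abs]
  norm_num at h2 ⊢
  exact h2

include hu in
lemma Admissible.integrable_sqrt : Integrable fun x => √(u₀ x) := by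
  refine (hu.integrable_rpow.const_mul (uMax u₀ ^ (1 / 10 : ℝ))).mono'
    hu.continuous.sqrt.aestronglyMeasurable (Eventually.of_forall fun x => ?_)
  have hux := hu.pos x
  rw [Real.norm_eq_abs, abs_of_nonneg (Real.sqrt_nonneg _), Real.sqrt_eq_rpow,
    show (1 / 2 : ℝ) = 1 / 10 + 2 / 5 by norm_num, Real.rpow_add hux]
  gcongr
  exact hu.le_uMax x

include hδ hu in
/-- Pointwise Hölder bound for the integrand of the Weyl function. -/
lemma exists_gap_bound : ∃ B, 0 ≤ B ∧ ∀ x, gap (2 * δ * u₀ x) ≤ B * √(u₀ x) ∧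
    ∀ e e', 0 ≤ e → e ≤ e' → gap (2 * δ * u₀ x - e) - gap (2 * δ * u₀ x - e') ≤
      B * (e' - e) ^ (1 / 10 : ℝ) * u₀ x ^ (2 / 5 : ℝ) := by
  obtain ⟨B, hB, h⟩ := exists_gap_holder (2 * δ * uMax u₀)
  refine ⟨B * √(2 * δ) + B * (2 * δ) ^ (2 / 5 : ℝ), by positivity, fun x => ⟨?_, ?_⟩⟩
  · have hux := hu.pos x
    have hle : 2 * δ * u₀ x ≤ 2 * δ * uMax u₀ := by have := hu.le_uMax x; gcongr
    have h1 := h 0 (2 * δ * u₀ x) (by positivity) hle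
    rw [gap_of_nonpos le_rfl, sub_zero, sub_zero, Real.sqrt_mul (by positivity)] at h1
    have : 0 ≤ B * (2 * δ) ^ (2 / 5 : ℝ) * √(u₀ x) := by positivity
    linarith
  · intro e e' he hee
    have hux := hu.pos x
    have hle : 2 * δ * u₀ x ≤ 2 * δ * uMax u₀ := by have := hu.le_uMax x; gcongr
    set p := 2 * δ * u₀ x with hp
    have hp0 : 0 < p := by positivity
    have hd : 0 ≤ e' - e := by linarith
    -- With d = e' - e, the increment is at most B √(min d p) ≤ B d^(1/10) p^(2/5). The exponent 2/5
    -- is the one for which u₀ is known to be integrable, and 1/10 is what remains of 1/2.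
    have key : gap (p - e) - gap (p - e') ≤ B * (e' - e) ^ (1 / 10 : ℝ) * p ^ (2 / 5 : ℝ) := by
      have hsplit : ∀ z : ℝ, 0 ≤ z → √z = z ^ (1 / 10 : ℝ) * z ^ (2 / 5 : ℝ) := by
        intro z hz
        rw [← Real.rpow_add_of_nonneg hz (by norm_num) (by norm_num), Real.sqrt_eq_rpow]
        norm_num
      rcases le_total (e' - e) p with h1 | h1
      · have h2 := h (p - e') (p - e) (by linarith) (by linarith)
        rw [show p - e - (p - e') = e' - e by ring, hsplit _ hd] at h2
        refine h2.trans ?_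
        rw [mul_assoc]
        gcongr
      · have h2 := h 0 p hp0.le hle
        rw [gap_of_nonpos le_rfl, sub_zero, sub_zero, hsplit _ hp0.le] at h2
        have h3 := gap_mono (by linarith : p - e ≤ p)
        have h4 := gap_nonneg (p - e')
        calc gap (p - e) - gap (p - e') ≤ gap p := by linarith
          _ ≤ B * (p ^ (1 / 10 : ℝ) * p ^ (2 / 5 : ℝ)) := h2
          _ ≤ B * ((e' - e) ^ (1 / 10 : ℝ) * p ^ (2 / 5 : ℝ)) := by gcongr
          _ = _ := by ring
    refine key.trans ?_
    rw [hp, Real.mul_rpow (by positivity) hux.le]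
    have : 0 ≤ B * √(2 * δ) * ((e' - e) ^ (1 / 10 : ℝ) * u₀ x ^ (2 / 5 : ℝ)) := by positivity
    linarith

include hδ hu in
lemma integrable_gap {e : ℝ} (he : 0 ≤ e) : Integrable fun x => gap (2 * δ * u₀ x - e) := by
  obtain ⟨B, hB, h⟩ := exists_gap_bound hδ hu
  refine (hu.integrable_sqrt.const_mul B).mono' ((continuous_gap.comp
    ((hu.continuous.const_mul (2 * δ)).sub continuous_const)).aestronglyMeasurable)
    (Eventually.of_forall fun x => ?_)
  rw [Real.norm_eq_abs, abs_of_nonneg (gap_nonneg _)]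
  exact (gap_mono (by linarith)).trans (h x).1

end Initial

/-! ### Monotonicity and Hölder continuity of the Weyl function, and its inverse -/

section WeylFunction

variable {δ : ℝ} (hδ : 0 < δ) {u₀ : ℝ → ℝ} (hu : Admissible u₀)

/-- The Weyl function along the quadratrix. -/
def weyl (δ : ℝ) (u₀ : ℝ → ℝ) (κ : ℝ) : ℝ := RWyl δ u₀ (zeta δ κ)

include hδ in
lemma ell_le_ell {κ κ' : ℝ} (hκ : 0 ≤ κ) (h : κ ≤ κ') (hκ' : κ' ≤ kappaMax δ u₀) :
    ell (2 * δ * κ) ≤ ell (2 * δ * κ') :=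
  strictMonoOn_ell.monotoneOn (two_delta_mem hδ ⟨hκ, h.trans hκ'⟩)
    (two_delta_mem hδ ⟨hκ.trans h, hκ'⟩) (by gcongr)

include hδ hu in
lemma weyl_kappaMax : weyl δ u₀ (kappaMax δ u₀) = 0 := by
  rw [weyl, RWyl_zeta hδ hu ⟨(kappaMax_pos hδ hu).le, le_rfl⟩, ell_kappaMax hδ hu]
  have : ∀ x, gap (2 * δ * u₀ x - 2 * δ * uMax u₀) = 0 := fun x => by
    refine gap_of_nonpos ?_
    have : 2 * δ * u₀ x ≤ 2 * δ * uMax u₀ := by have := hu.le_uMax x; gcongr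
    linarith
  simp [this]

include hδ hu in
-- The integrand decreases with the level for every x, and strictly so on the open set where u₀
-- exceeds the lower level. That set contains the lobe top, hence has positive measure.
lemma strictAntiOn_weyl : StrictAntiOn (weyl δ u₀) (Set.Icc 0 (kappaMax δ u₀)) := by
  intro κ hκ κ' hκ' hlt
  have h1 := two_delta_mem hδ hκ
  have h2 := two_delta_mem hδ hκ'
  have he : ell (2 * δ * κ) < ell (2 * δ * κ') :=
    strictMonoOn_ell h1 h2 (by gcongr)
  have he0 := ell_nonneg h1.1 h1.2
  have hi := integrable_gap hδ hu he0
  have hi' := integrable_gap hδ hu (he0.trans he.le)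
  have hc := hu.continuous
  have hlt' : ell (2 * δ * κ) < 2 * δ * uMax u₀ := by
    have := ell_le_ell hδ (u₀ := u₀) (hκ.1.trans hlt.le) hκ'.2 le_rfl
    rw [ell_kappaMax hδ hu] at this
    linarith
  rw [weyl, weyl, RWyl_zeta hδ hu hκ, RWyl_zeta hδ hu hκ']
  refine mul_lt_mul_of_pos_left ?_ (by positivity)
  rw [← sub_pos, ← integral_sub hi hi', integral_pos_iff_support_of_nonneg
    (fun x => sub_nonneg.2 (gap_mono (by linarith))) (hi.sub hi')]
  have hopen : IsOpen {x | ell (2 * δ * κ) < 2 * δ * u₀ x} :=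
    isOpen_lt continuous_const (by fun_prop)
  obtain ⟨xm, hxm⟩ := hu.exists_lobeTop
  refine (hopen.measure_pos volume ⟨xm, ?_⟩).trans_le (measure_mono fun x hx => ?_)
  · rw [Set.mem_ofPred_eq, ← hxm.uMax_eq]; exact hlt'
  · rw [Set.mem_ofPred_eq] at hx
    rw [Function.mem_support]
    exact (sub_pos.2 (gap_lt (by linarith) (by linarith))).ne'

include hδ hu in
lemma exists_weyl_holder : ∃ C, 0 < C ∧ ∀ κ κ', 0 ≤ κ → κ ≤ κ' → κ' ≤ kappaMax δ u₀ →
    weyl δ u₀ κ - weyl δ u₀ κ' ≤ C * (κ' - κ) ^ (1 / 10 : ℝ) := by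
  obtain ⟨B, hB, hb⟩ := exists_gap_bound hδ hu
  obtain ⟨M, hM, hl⟩ := exists_ell_lipschitz (two_delta_kappaMax_lt hδ (u₀ := u₀))
  set I := ∫ x, u₀ x ^ (2 / 5 : ℝ) with hI
  have hI0 : 0 ≤ I := integral_nonneg fun x => Real.rpow_nonneg (hu.pos x).le _
  -- The summand 1 only makes the constant positive, for later division by it.
  refine ⟨1 / (4 * δ) * (B * (M * (2 * δ)) ^ (1 / 10 : ℝ) * I) + 1, by positivity,
    fun κ κ' h0 h1 h2 => ?_⟩
  have hκ : κ ∈ Set.Icc 0 (kappaMax δ u₀) := ⟨h0, h1.trans h2⟩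
  have hκ' : κ' ∈ Set.Icc 0 (kappaMax δ u₀) := ⟨h0.trans h1, h2⟩
  have h3 := two_delta_mem hδ hκ
  have h4 := two_delta_mem hδ hκ'
  have he := ell_le_ell hδ (u₀ := u₀) h0 h1 h2
  have he0 := ell_nonneg h3.1 h3.2
  have hi := integrable_gap hδ hu he0
  have hi' := integrable_gap hδ hu (he0.trans he)
  have hd : 0 ≤ κ' - κ := by linarith
  have hell : ell (2 * δ * κ') - ell (2 * δ * κ) ≤ M * (2 * δ) * (κ' - κ) := by
    have := hl (2 * δ * κ) (2 * δ * κ') h3.1 (by gcongr) (by gcongr)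
    linarith
  rw [weyl, weyl, RWyl_zeta hδ hu hκ, RWyl_zeta hδ hu hκ', ← mul_sub, ← integral_sub hi hi']
  have h5 : ∫ x, (gap (2 * δ * u₀ x - ell (2 * δ * κ)) - gap (2 * δ * u₀ x - ell (2 * δ * κ'))) ≤
      ∫ x, B * (ell (2 * δ * κ') - ell (2 * δ * κ)) ^ (1 / 10 : ℝ) * u₀ x ^ (2 / 5 : ℝ) :=
    integral_mono (hi.sub hi') (hu.integrable_rpow.const_mul _) fun x =>
      (hb x).2 _ _ he0 he
  rw [integral_const_mul, ← hI] at h5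
  have h6 : (ell (2 * δ * κ') - ell (2 * δ * κ)) ^ (1 / 10 : ℝ) ≤
      (M * (2 * δ)) ^ (1 / 10 : ℝ) * (κ' - κ) ^ (1 / 10 : ℝ) := by
    rw [← Real.mul_rpow (by positivity) hd]
    exact Real.rpow_le_rpow (by linarith) hell (by norm_num)
  have h7 : B * (ell (2 * δ * κ') - ell (2 * δ * κ)) ^ (1 / 10 : ℝ) * I ≤
      B * ((M * (2 * δ)) ^ (1 / 10 : ℝ) * (κ' - κ) ^ (1 / 10 : ℝ)) * I := by gcongr
  have h8 : 0 ≤ (κ' - κ) ^ (1 / 10 : ℝ) := Real.rpow_nonneg hd _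
  calc _ ≤ 1 / (4 * δ) *
        (B * ((M * (2 * δ)) ^ (1 / 10 : ℝ) * (κ' - κ) ^ (1 / 10 : ℝ)) * I) := by
        gcongr; exact h5.trans h7
    _ ≤ _ := by linarith

include hδ hu in
lemma continuousOn_weyl : ContinuousOn (weyl δ u₀) (Set.Icc 0 (kappaMax δ u₀)) := by
  obtain ⟨C, hC, h⟩ := exists_weyl_holder hδ hu
  have hanti := (strictAntiOn_weyl hδ hu).antitoneOn
  intro κ hκ
  rw [ContinuousWithinAt, tendsto_iff_norm_sub_tendsto_zero]
  have hlim : Tendsto (fun κ' => C * |κ' - κ| ^ (1 / 10 : ℝ))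
      (𝓝[Set.Icc 0 (kappaMax δ u₀)] κ) (𝓝 0) := by
    have : Continuous fun κ' => C * |κ' - κ| ^ (1 / 10 : ℝ) :=
      continuous_const.mul ((by fun_prop : Continuous fun κ' => |κ' - κ|).rpow_const
        fun _ => Or.inr (by norm_num))
    have := this.tendsto κ
    simp only [sub_self, abs_zero] at this
    rw [Real.zero_rpow (by norm_num), mul_zero] at this
    exact this.mono_left nhdsWithin_le_nhds
  refine squeeze_zero' (Eventually.of_forall fun _ => norm_nonneg _) ?_ hlim
  filter_upwards [self_mem_nhdsWithin] with κ' hκ'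
  rw [Real.norm_eq_abs]
  rcases le_total κ κ' with h1 | h1
  · rw [abs_sub_comm, abs_of_nonneg (sub_nonneg.2 (hanti hκ hκ' h1)),
      abs_of_nonneg (sub_nonneg.2 h1)]
    exact h κ κ' hκ.1 h1 hκ'.2
  · rw [abs_of_nonneg (sub_nonneg.2 (hanti hκ' hκ h1)), abs_sub_comm,
      abs_of_nonneg (sub_nonneg.2 h1)]
    exact h κ' κ hκ'.1 h1 hκ.2

include hδ hu in
lemma weyl_zero_pos : 0 < weyl δ u₀ 0 := by
  have h := kappaMax_pos hδ hu
  have := strictAntiOn_weyl hδ hu ⟨le_rfl, h.le⟩ ⟨h.le, le_rfl⟩ h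
  rwa [weyl_kappaMax hδ hu] at this

/-- `R` is a decreasing homeomorphism of the line that extends the Weyl function, and `Φ` is its
inverse. -/
structure WeylHomeo (δ : ℝ) (u₀ : ℝ → ℝ) (R Φ : ℝ → ℝ) : Prop where
  continuous : Continuous R
  continuous_inv : Continuous Φ
  strictAnti : StrictAnti R
  strictAnti_inv : StrictAnti Φ
  left_inv : ∀ κ, Φ (R κ) = κ
  right_inv : ∀ s, R (Φ s) = s
  eq_weyl : ∀ κ ∈ Set.Icc 0 (kappaMax δ u₀), R κ = weyl δ u₀ κ

include hδ hu in
lemma exists_weylHomeo : ∃ R Φ : ℝ → ℝ, WeylHomeo δ u₀ R Φ := by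
  set m := kappaMax δ u₀ with hm
  have hm0 : 0 < m := kappaMax_pos hδ hu
  set cl : ℝ → ℝ := fun κ => max 0 (min κ m) with hcl
  have hclc : Continuous cl := by fun_prop
  have hclm : ∀ κ, cl κ ∈ Set.Icc 0 m := fun κ =>
    ⟨le_max_left _ _, max_le hm0.le (min_le_right _ _)⟩
  have hcl_id : ∀ κ ∈ Set.Icc 0 m, cl κ = κ := fun κ hκ => by
    simp only [hcl]; rw [min_eq_left hκ.2, max_eq_right hκ.1]
  have hcl_mono : Monotone cl := fun a b hab => max_le_max_left 0 (min_le_min_right m hab)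
  have hanti := strictAntiOn_weyl hδ hu
  -- Outside the interval the function continues with slope -1, so R is a homeomorphism of the whole
  -- line and measurability needs no care at the endpoints.
  set R : ℝ → ℝ := fun κ => weyl δ u₀ (cl κ) + (cl κ - κ) with hR
  have hRc : Continuous R :=
    ((continuousOn_weyl hδ hu).comp_continuous hclc hclm).add (hclc.sub continuous_id)
  have hcl_lip : ∀ a b, a ≤ b → cl b - cl a ≤ b - a := by
    intro a b hab
    simp only [hcl]
    rcases max_cases 0 (min a m) with h1 | h1 <;> rcases max_cases 0 (min b m) with h2 | h2 <;>
    rcases min_cases a m with h3 | h3 <;> rcases min_cases b m with h4 | h4 <;> linarith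
  have hRa : StrictAnti R := by
    intro a b hab
    have h1 := hcl_lip a b hab.le
    rcases (hcl_mono hab.le).eq_or_lt with h | h
    · simp only [hR, h]; linarith
    · have := hanti (hclm a) (hclm b) h
      simp only [hR]; linarith
  have hRs : Function.Surjective R := by
    refine hRc.surjective' ?_ ?_
    · refine tendsto_atTop.2 fun c => ?_
      filter_upwards [eventually_le_atBot (-c), eventually_le_atBot 0] with κ h1 h2
      have h3 : cl κ = 0 := by
        simp only [hcl]; rw [min_eq_left (h2.trans hm0.le), max_eq_left h2]
      have := weyl_zero_pos hδ hu
      simp only [hR, h3]; linarith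
    · refine tendsto_atBot.2 fun c => ?_
      filter_upwards [eventually_ge_atTop (m - c), eventually_ge_atTop m] with κ h1 h2
      have h3 : cl κ = m := by
        simp only [hcl]; rw [min_eq_right h2, max_eq_right hm0.le]
      have := weyl_kappaMax hδ hu
      simp only [hR, h3]; rw [hm, this, ← hm]; linarith
  have hNs : Function.Surjective (fun κ => -R κ) := neg_surjective.comp hRs
  have hNm : StrictMono (fun κ => -R κ) := hRa.neg
  set o := hNm.orderIsoOfSurjective _ hNs with ho
  have hoa : ∀ κ, o κ = -R κ := fun κ => rfl
  refine ⟨R, fun s => o.symm (-s), hRc, o.symm.continuous.comp continuous_neg, hRa,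
    fun a b hab => o.symm.strictMono (neg_lt_neg hab), fun κ => ?_, fun s => ?_, fun κ hκ => ?_⟩
  · simp only [← hoa, o.symm_apply_apply]
  · have := hoa (o.symm (-s))
    rw [o.apply_symm_apply] at this
    linarith
  · simp only [hR, hcl_id κ hκ]; ring

end WeylFunction

/-! ### Absolute continuity of the Weyl function and the image of Lebesgue measure -/

section WeylMeasure

variable {δ : ℝ} (hδ : 0 < δ) {u₀ : ℝ → ℝ} (hu : Admissible u₀)

/-- The level function in the variable `κ`, extended from `[0, κ_max]` by constants. -/
def clampLevel (δ : ℝ) (u₀ : ℝ → ℝ) (κ : ℝ) : ℝ :=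
  ell (2 * δ * max 0 (min κ (kappaMax δ u₀)))

include hδ hu in
lemma clamp_mem (κ : ℝ) : max 0 (min κ (kappaMax δ u₀)) ∈ Set.Icc 0 (kappaMax δ u₀) :=
  ⟨le_max_left _ _, max_le (kappaMax_pos hδ hu).le (min_le_right _ _)⟩

lemma clampLevel_eq {κ : ℝ} (hκ : κ ∈ Set.Icc 0 (kappaMax δ u₀)) :
    clampLevel δ u₀ κ = ell (2 * δ * κ) := by
  rw [clampLevel, min_eq_left hκ.2, max_eq_right hκ.1]

include hδ hu in
lemma continuous_clampLevel : Continuous (clampLevel δ u₀) :=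
  continuousOn_ell.comp_continuous (by fun_prop) fun κ => two_delta_mem hδ (clamp_mem hδ hu κ)

include hδ hu in
lemma clampLevel_mono : Monotone (clampLevel δ u₀) := fun _ b hab =>
  ell_le_ell hδ (le_max_left _ _) (max_le_max_left 0 (min_le_min_right _ hab))
    (clamp_mem hδ hu b).2

include hδ hu in
lemma clampLevel_nonneg (κ : ℝ) : 0 ≤ clampLevel δ u₀ κ := by
  have := two_delta_mem hδ (clamp_mem hδ hu κ)
  exact ell_nonneg this.1 this.2

include hδ in
lemma differentiableAt_clampLevel {κ : ℝ} (hκ : κ ∈ Set.Ioo 0 (kappaMax δ u₀)) :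
    DifferentiableAt ℝ (clampLevel δ u₀) κ := by
  have h1 := two_delta_mem hδ (Set.Ioo_subset_Icc_self hκ)
  have h2 : DifferentiableAt ℝ (fun κ => ell (2 * δ * κ)) κ := by
    refine DifferentiableAt.comp κ (hasDerivAt_ell ?_ h1.2).differentiableAt (by fun_prop)
    have := hκ.1
    positivity
  refine h2.congr_of_eventuallyEq ?_
  filter_upwards [Ioo_mem_nhds hκ.1 hκ.2] with z hz
  exact clampLevel_eq (Set.Ioo_subset_Icc_self hz)

include hδ hu in
/-- The contribution of a single value `p = 2 δ u₀(x)` to the Weyl function satisfies the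
fundamental theorem of calculus. -/
lemma integral_deriv_gap (p : ℝ) {b : ℝ} (hb : b ∈ Set.Icc 0 (kappaMax δ u₀)) :
    IntervalIntegrable (deriv fun η => -gap (p - clampLevel δ u₀ η)) volume 0 b ∧
    ∫ η in (0 : ℝ)..b, deriv (fun η => -gap (p - clampLevel δ u₀ η)) η =
      gap p - gap (p - clampLevel δ u₀ b) := by
  have hc := continuous_clampLevel hδ hu
  have hmono : Monotone fun η => -gap (p - clampLevel δ u₀ η) := fun a b hab =>
    neg_le_neg (gap_mono (sub_le_sub_left (clampLevel_mono hδ hu hab) p))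
  have hint := (hmono.monotoneOn (Set.uIcc 0 b)).intervalIntegrable_deriv
  refine ⟨hint, ?_⟩
  -- For fixed p, differentiability can fail inside the interval only at the κ where `ell` reaches
  -- p, the branch point of `gap`. A countable exceptional set is allowed, as the derivative of a
  -- monotone function is integrable.
  have hcount : {κ | κ ∈ Set.Icc 0 (kappaMax δ u₀) ∧ ell (2 * δ * κ) = p}.Countable := by
    refine Set.Subsingleton.countable fun κ hκ κ' hκ' => ?_
    have := strictMonoOn_ell.injOn (two_delta_mem hδ hκ.1) (two_delta_mem hδ hκ'.1)
      (hκ.2.trans hκ'.2.symm)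
    exact mul_left_cancel₀ (by positivity) this
  have hcont : Continuous fun η => -gap (p - clampLevel δ u₀ η) :=
    (continuous_gap.comp (continuous_const.sub hc)).neg
  rw [integral_eq_of_hasDerivAt_off_countable_of_le _ _ hb.1 hcount hcont.continuousOn ?_ hint]
  · rw [clampLevel_eq ⟨le_rfl, (kappaMax_pos hδ hu).le⟩, mul_zero, ell_zero, sub_zero]
    ring
  · rintro κ ⟨hκ, hκp⟩
    have hκ' : κ ∈ Set.Ioo 0 (kappaMax δ u₀) := ⟨hκ.1, hκ.2.trans_le hb.2⟩
    have hne : clampLevel δ u₀ κ ≠ p := fun h =>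
      hκp ⟨Set.Ioo_subset_Icc_self hκ', by rw [← clampLevel_eq (Set.Ioo_subset_Icc_self hκ'), h]⟩
    refine DifferentiableAt.hasDerivAt ?_
    rcases hne.lt_or_gt with h | h
    · have h1 : DifferentiableAt ℝ (fun η => p - clampLevel δ u₀ η) κ :=
        (differentiableAt_const p).sub (differentiableAt_clampLevel hδ hκ')
      have h2 : DifferentiableAt ℝ gap (p - clampLevel δ u₀ κ) :=
        differentiableAt_gap (sub_pos.2 h)
      exact (DifferentiableAt.comp (g := gap) κ h2 h1).neg
    · have : (fun η => -gap (p - clampLevel δ u₀ η)) =ᶠ[𝓝 κ] fun _ => 0 := by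
        filter_upwards [hc.continuousAt.eventually (lt_mem_nhds h)] with z hz
        rw [gap_of_nonpos (by linarith), neg_zero]
      exact (differentiableAt_const 0).congr_of_eventuallyEq this

/-- The density `-dR/dκ`, written as an integral over `x`. -/
def weylDensity (δ : ℝ) (u₀ : ℝ → ℝ) (η : ℝ) : ℝ :=
  1 / (4 * δ) * ∫ x, deriv (fun η => -gap (2 * δ * u₀ x - clampLevel δ u₀ η)) η

include hδ hu in
lemma weyl_eq_clamp {κ : ℝ} (hκ : κ ∈ Set.Icc 0 (kappaMax δ u₀)) :
    weyl δ u₀ κ = 1 / (4 * δ) * ∫ x, gap (2 * δ * u₀ x - clampLevel δ u₀ κ) := by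
  rw [weyl, RWyl_zeta hδ hu hκ, clampLevel_eq hκ]

include hδ hu in
-- For each x the contribution is monotone in κ, so its derivative is nonnegative and its integral
-- over κ is an increment of `gap`, integrable in x. Fubini then exchanges the two integrations.
lemma integral_weylDensity {b : ℝ} (hb : b ∈ Set.Icc 0 (kappaMax δ u₀)) :
    IntervalIntegrable (weylDensity δ u₀) volume 0 b ∧
      ∫ η in (0 : ℝ)..b, weylDensity δ u₀ η = weyl δ u₀ 0 - weyl δ u₀ b := by
  have huc := hu.continuous
  have hcc := continuous_clampLevel hδ hu
  set S : ℝ → ℝ → ℝ := fun x η => -gap (2 * δ * u₀ x - clampLevel δ u₀ η) with hS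
  have hScont : Continuous (Function.uncurry S) := by
    refine (continuous_gap.comp ?_).neg
    exact (continuous_const.mul (huc.comp continuous_fst)).sub (hcc.comp continuous_snd)
  have hmeas : Measurable fun p : ℝ × ℝ => deriv (S p.1) p.2 := measurable_deriv_with_param hScont
  have hmono : ∀ x, Monotone (S x) := fun x a b hab =>
    neg_le_neg (gap_mono (sub_le_sub_left (clampLevel_mono hδ hu hab) _))
  have hpos : ∀ x η, 0 ≤ deriv (S x) η := fun x η => (hmono x).deriv_nonneg
  have hftc := fun x => integral_deriv_gap hδ hu (2 * δ * u₀ x) hb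
  have hg0 : Integrable fun x => gap (2 * δ * u₀ x) := by
    simpa using integrable_gap hδ hu le_rfl
  have hgb := integrable_gap hδ hu (clampLevel_nonneg hδ hu b)
  have hprod : Integrable (fun p : ℝ × ℝ => deriv (S p.1) p.2)
      (volume.prod (volume.restrict (Set.Ioc 0 b))) := by
    rw [integrable_prod_iff hmeas.aestronglyMeasurable]
    refine ⟨Eventually.of_forall fun x => (hftc x).1.1, ?_⟩
    refine (hg0.sub hgb).congr (Eventually.of_forall fun x => ?_)
    have := (hftc x).2
    rw [intervalIntegral.integral_of_le hb.1] at this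
    simp only [Real.norm_eq_abs, abs_of_nonneg (hpos x _)]
    exact this.symm
  have hint : IntervalIntegrable (weylDensity δ u₀) volume 0 b := by
    rw [intervalIntegrable_iff_integrableOn_Ioc_of_le hb.1]
    exact (hprod.integral_prod_right).const_mul _
  refine ⟨hint, ?_⟩
  rw [intervalIntegral.integral_of_le hb.1]
  unfold weylDensity
  rw [integral_const_mul, ← integral_integral_swap hprod,
    weyl_eq_clamp hδ hu ⟨le_rfl, (kappaMax_pos hδ hu).le⟩, weyl_eq_clamp hδ hu hb, ← mul_sub,
    clampLevel_eq ⟨le_rfl, (kappaMax_pos hδ hu).le⟩, mul_zero, ell_zero]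
  simp only [sub_zero]
  rw [← integral_sub hg0 hgb]
  congr 1
  refine integral_congr_ae (Eventually.of_forall fun x => ?_)
  have := (hftc x).2
  rwa [intervalIntegral.integral_of_le hb.1] at this

variable {R Φ : ℝ → ℝ}

lemma rhoWyl_eq_deriv (h : WeylHomeo δ u₀ R Φ) {κ : ℝ} (hκ : κ ∈ Set.Ioo 0 (kappaMax δ u₀)) :
    rhoWyl δ u₀ κ = -deriv R κ := by
  unfold rhoWyl
  congr 1
  refine EventuallyEq.deriv_eq ?_
  filter_upwards [Ioo_mem_nhds hκ.1 hκ.2] with z hz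
  exact (h.eq_weyl z (Set.Ioo_subset_Icc_self hz)).symm

lemma rhoWyl_nonneg (h : WeylHomeo δ u₀ R Φ) {κ : ℝ} (hκ : κ ∈ Set.Ioo 0 (kappaMax δ u₀)) :
    0 ≤ rhoWyl δ u₀ κ := by
  rw [rhoWyl_eq_deriv h hκ]
  exact neg_nonneg.2 h.strictAnti.antitone.deriv_nonpos

lemma measurable_rhoWyl (δ : ℝ) (u₀ : ℝ → ℝ) : Measurable (rhoWyl δ u₀) :=
  (measurable_deriv _).neg

include hδ hu in
-- Lebesgue differentiation of the integral representation. Agreement almost everywhere suffices,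
-- since the density is only ever integrated.
lemma ae_rhoWyl_eq : ∀ᵐ κ, κ ∈ Set.Ioo 0 (kappaMax δ u₀) →
    rhoWyl δ u₀ κ = weylDensity δ u₀ κ := by
  have hm := (kappaMax_pos hδ hu).le
  have h1 := (integral_weylDensity hδ hu ⟨hm, le_rfl⟩).1.ae_hasDerivAt_integral
  filter_upwards [h1] with κ hκ hmem
  have h2 := hκ (by rw [Set.uIcc_of_le hm]; exact Set.Ioo_subset_Icc_self hmem) 0
    Set.left_mem_uIcc
  have h3 : (fun s => RWyl δ u₀ (zeta δ s)) =ᶠ[𝓝 κ]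
      fun x => weyl δ u₀ 0 - ∫ t in (0 : ℝ)..x, weylDensity δ u₀ t := by
    filter_upwards [Ioo_mem_nhds hmem.1 hmem.2] with z hz
    rw [(integral_weylDensity hδ hu (Set.Ioo_subset_Icc_self hz)).2, sub_sub_cancel]
    rfl
  unfold rhoWyl
  rw [h3.deriv_eq, (h2.const_sub _).deriv, neg_neg]

include hδ hu in
lemma integral_rhoWyl {b : ℝ} (hb : b ∈ Set.Icc 0 (kappaMax δ u₀)) :
    IntegrableOn (rhoWyl δ u₀) (Set.Ioc 0 b) ∧
      ∫ η in Set.Ioc 0 b, rhoWyl δ u₀ η = weyl δ u₀ 0 - weyl δ u₀ b := by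
  have h1 : rhoWyl δ u₀ =ᵐ[volume.restrict (Set.Ioc 0 b)] weylDensity δ u₀ := by
    rw [← restrict_Ioo_eq_restrict_Ioc]
    rw [EventuallyEq, ae_restrict_iff' measurableSet_Ioo]
    filter_upwards [ae_rhoWyl_eq hδ hu] with κ hκ hmem
    exact hκ ⟨hmem.1, hmem.2.trans_le hb.2⟩
  obtain ⟨h2, h3⟩ := integral_weylDensity hδ hu hb
  rw [intervalIntegral.integral_of_le hb.1] at h3
  exact ⟨(integrable_congr h1).2 h2.1, by rw [integral_congr_ae h1, h3]⟩

include hδ hu in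
/-- The Weyl density is the density of the image of the Lebesgue measure under `Φ`. -/
lemma map_eq_withDensity (h : WeylHomeo δ u₀ R Φ) :
    Measure.map Φ (lebIoc (weyl δ u₀ 0)) =
      (lebIoc (kappaMax δ u₀)).withDensity fun κ => ENNReal.ofReal (rhoWyl δ u₀ κ) := by
  have hm := kappaMax_pos hδ hu
  set m := kappaMax δ u₀ with hmdef
  have h0 : (0 : ℝ) ∈ Set.Icc 0 m := ⟨le_rfl, hm.le⟩
  have hm' : m ∈ Set.Icc 0 m := ⟨hm.le, le_rfl⟩
  have hR0 : R 0 = weyl δ u₀ 0 := h.eq_weyl 0 h0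
  have hRm : R m = 0 := by rw [h.eq_weyl m hm', weyl_kappaMax hδ hu]
  have hL := weyl_zero_pos hδ hu
  set L := weyl δ u₀ 0 with hLdef
  have hval : ∀ b ∈ Set.Icc 0 m, ∫⁻ κ in Set.Ioc 0 b, ENNReal.ofReal (rhoWyl δ u₀ κ) =
      ENNReal.ofReal (L - R b) := by
    intro b hb
    obtain ⟨h1, h2⟩ := integral_rhoWyl hδ hu hb
    rw [h.eq_weyl b hb, ← h2, ofReal_integral_eq_lintegral_ofReal h1]
    rw [← restrict_Ioo_eq_restrict_Ioc]
    refine (ae_restrict_iff' measurableSet_Ioo).2 (Eventually.of_forall fun κ hκ => ?_)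
    exact rhoWyl_nonneg h ⟨hκ.1, hκ.2.trans_le hb.2⟩
  -- The two measures are compared on half-lines. As Φ is decreasing, the preimage of the half-line
  -- below a is the one above R a, which meets (0, L] in length L - R a when 0 ≤ a ≤ κ_max.
  refine Measure.ext_of_Iic _ _ fun a => ?_
  rw [Measure.map_apply h.continuous_inv.measurable measurableSet_Iic,
    withDensity_apply _ measurableSet_Iic, Measure.restrict_restrict measurableSet_Iic,
    Measure.restrict_apply (h.continuous_inv.measurable measurableSet_Iic)]
  have hpre : Φ ⁻¹' Set.Iic a = Set.Ici (R a) := by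
    ext s
    rw [Set.mem_preimage, Set.mem_Iic, Set.mem_Ici, ← h.strictAnti.le_iff_ge, h.right_inv]
  rw [hpre]
  rcases lt_or_ge a 0 with ha | ha
  · have hRa : L < R a := hR0 ▸ h.strictAnti ha
    have e1 : Set.Ici (R a) ∩ Set.Ioc 0 L = ∅ := by
      ext s; simp only [Set.mem_inter_iff, Set.mem_Ici, Set.mem_Ioc, Set.mem_empty_iff_false]
      constructor
      · rintro ⟨h1, -, h2⟩; linarith
      · exact False.elim
    have e2 : Set.Iic a ∩ Set.Ioc 0 m = ∅ := by
      ext s; simp only [Set.mem_inter_iff, Set.mem_Iic, Set.mem_Ioc, Set.mem_empty_iff_false]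
      constructor
      · rintro ⟨h1, h2, -⟩; linarith
      · exact False.elim
    rw [e1, e2]; simp
  · rcases le_or_gt a m with ham | ham
    · have e2 : Set.Iic a ∩ Set.Ioc 0 m = Set.Ioc 0 a := by
        ext s; simp only [Set.mem_inter_iff, Set.mem_Iic, Set.mem_Ioc]
        exact ⟨fun h => ⟨h.2.1, h.1⟩, fun h => ⟨h.2, h.1, h.2.trans ham⟩⟩
      have hRa0 : 0 ≤ R a := hRm ▸ h.strictAnti.antitone ham
      rw [e2, hval a ⟨ha, ham⟩, ← Real.volume_Icc]
      refine measure_congr ?_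
      have e3 : Set.Ioc (R a) L ⊆ Set.Ici (R a) ∩ Set.Ioc 0 L := fun s hs =>
        ⟨hs.1.le, hRa0.trans_lt hs.1, hs.2⟩
      have e4 : Set.Ici (R a) ∩ Set.Ioc 0 L ⊆ Set.Icc (R a) L := fun s hs => ⟨hs.1, hs.2.2⟩
      exact (e4.eventuallyLE).antisymm (Ioc_ae_eq_Icc.symm.le.trans e3.eventuallyLE)
    · have e2 : Set.Iic a ∩ Set.Ioc 0 m = Set.Ioc 0 m := by
        ext s; simp only [Set.mem_inter_iff, Set.mem_Iic, Set.mem_Ioc]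
        exact ⟨fun h => h.2, fun h => ⟨h.2.trans ham.le, h⟩⟩
      have hRa0 : R a < 0 := hRm ▸ h.strictAnti ham
      have e1 : Set.Ici (R a) ∩ Set.Ioc 0 L = Set.Ioc 0 L := by
        ext s; simp only [Set.mem_inter_iff, Set.mem_Ici, Set.mem_Ioc]
        exact ⟨fun h => h.2, fun h => ⟨by linarith [h.1], h⟩⟩
      rw [e2, e1, hval m hm', Real.volume_Ioc, hRm]

end WeylMeasure

/-! ### Continuity of the external potential and bounds on the Green kernel -/

section Potential

variable {δ : ℝ} (hδ : 0 < δ) {u₀ : ℝ → ℝ} (hu : Admissible u₀)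

include hδ in
lemma continuousOn_zeta : ContinuousOn (zeta δ) (Set.Icc 0 (kappaMax δ u₀)) := by
  have h1 : ContinuousOn (fun κ => ((1 / (2 * δ) : ℝ) : ℂ) *
      (((Real.cos (2 * δ * κ) / Real.sinc (2 * δ * κ) : ℝ) : ℂ) +
        ((2 * δ * κ : ℝ) : ℂ) * Complex.I)) (Set.Icc 0 (kappaMax δ u₀)) := by
    refine continuousOn_const.mul (ContinuousOn.add ?_ (by fun_prop))
    refine Complex.continuous_ofReal.comp_continuousOn (ContinuousOn.div (by fun_prop)
      (Real.continuous_sinc.comp (by fun_prop)).continuousOn fun κ hκ => ?_)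
    have := two_delta_mem hδ hκ
    exact (sinc_pos this.1 this.2).ne'
  refine h1.congr fun κ _ => ?_
  rw [zeta_eq_div hδ]
  congr 1
  apply Complex.ext <;> simp [quad, -Complex.ofReal_cos, -Complex.ofReal_div, -Complex.ofReal_mul]

/-- The integrand of `θ₊` along the quadratrix. -/
def tailIntegrand (δ : ℝ) (u₀ : ℝ → ℝ) (κ x : ℝ) : ℝ :=
  κ - yInv (ell (2 * δ * κ) - 2 * δ * u₀ x) / (2 * δ)

include hδ in
lemma tail_eq {κ : ℝ} (hκ : κ ∈ Set.Icc 0 (kappaMax δ u₀)) (x : ℝ) :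
    (zeta δ κ + 1 / (2 * δ) * lambertWNeg1 (lambertArg δ (zeta δ κ) (u₀ x))).im =
      tailIntegrand δ u₀ κ x := by
  have h3 := two_delta_mem hδ hκ
  rw [lambertArg_zeta hδ hκ.1 h3.2, Complex.add_im, zeta_im, tailIntegrand, yInv,
    show (1 / (2 * δ) : ℂ) = ((1 / (2 * δ) : ℝ) : ℂ) by push_cast; rfl, Complex.im_ofReal_mul]
  ring

include hδ hu in
-- As κ = `yInv (ell (2δκ))` / 2δ, the integrand is an increment of `yInv` over a length 2δu₀(x).
-- Its square-root modulus gives a dominating function independent of κ.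
lemma tailIntegrand_mem {κ : ℝ} (hκ : κ ∈ Set.Icc 0 (kappaMax δ u₀)) (x : ℝ) :
    0 ≤ tailIntegrand δ u₀ κ x ∧
      tailIntegrand δ u₀ κ x ≤ Real.pi * √(2 * δ) / (2 * δ) * √(u₀ x) := by
  have h3 := two_delta_mem hδ hκ
  have hux := hu.pos x
  have hp : 0 < 2 * δ * u₀ x := by positivity
  have e : tailIntegrand δ u₀ κ x =
      (yInv (ell (2 * δ * κ)) - yInv (ell (2 * δ * κ) - 2 * δ * u₀ x)) / (2 * δ) := by
    rw [yInv_ell h3.1 h3.2, tailIntegrand]; field_simp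
  have hle : ell (2 * δ * κ) - 2 * δ * u₀ x ≤ ell (2 * δ * κ) := by linarith
  rw [e]
  constructor
  · exact div_nonneg (sub_nonneg.2 (yInv_mono hle)) (by positivity)
  · have := yInv_sub_le hle
    rw [sub_sub_cancel, Real.sqrt_mul (by positivity)] at this
    rw [div_mul_eq_mul_div]
    refine div_le_div_of_nonneg_right ?_ (by positivity)
    rwa [mul_assoc Real.pi]

include hu in
lemma continuous_tailIntegrand (κ : ℝ) : Continuous (tailIntegrand δ u₀ κ) := by
  have := hu.continuous
  exact continuous_const.sub ((continuous_yInv.comp (by fun_prop)).div_const _)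

include hδ hu in
lemma integrable_tailIntegrand {κ : ℝ} (hκ : κ ∈ Set.Icc 0 (kappaMax δ u₀)) :
    Integrable (tailIntegrand δ u₀ κ) := by
  refine (hu.integrable_sqrt.const_mul (Real.pi * √(2 * δ) / (2 * δ))).mono'
    (continuous_tailIntegrand hu κ).aestronglyMeasurable (Eventually.of_forall fun x => ?_)
  have := tailIntegrand_mem hδ hu hκ x
  rw [Real.norm_eq_abs, abs_of_nonneg this.1]
  exact this.2

include hδ hu in
-- Between the lobe top and the turning point the integrand equals κ, so the moving endpoint can be
-- traded for a fixed one. This form is continuous up to κ = 0, although the turning point escapes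
-- to infinity.
lemma thetaPlus_zeta {xm : ℝ} (hxm : IsLobeTop u₀ xm) {κ : ℝ}
    (hκ : κ ∈ Set.Icc 0 (kappaMax δ u₀)) :
    thetaPlus δ u₀ (zeta δ κ) = κ * xm + ∫ x in Set.Ioi xm, tailIntegrand δ u₀ κ x := by
  have h3 := two_delta_mem hδ hκ
  have hint := integrable_tailIntegrand hδ hu hκ
  unfold thetaPlus
  simp only [tail_eq hδ hκ, zeta_im]
  -- At κ = 0 the level 0 is never attained and `xPlus` is a default value. It is harmless: its
  -- coefficient im ζ is 0 and the integrand vanishes identically.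
  rcases hκ.1.eq_or_lt with rfl | h
  · have h0 : ∀ x, tailIntegrand δ u₀ 0 x = 0 := fun x => by
      have := hu.pos x
      rw [tailIntegrand, mul_zero, ell_zero, yInv_of_nonpos, zero_div, sub_zero]
      have : 0 < 2 * δ * u₀ x := by positivity
      linarith
    simp [h0]
  · obtain ⟨h1, h2⟩ := level_mem hδ hu h hκ.2
    obtain ⟨a, b, -, hb, -, -, hiff, hbs, -⟩ := hu.exists_turning hxm h1 h2
    rw [xPlus, level_zeta hδ hκ.1 h3.2, hbs, ← Set.Ioc_union_Ioi_eq_Ioi hb,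
      setIntegral_union (Set.Ioc_disjoint_Ioi le_rfl) measurableSet_Ioi hint.integrableOn
        hint.integrableOn]
    have h4 : ∫ x in Set.Ioc xm b, tailIntegrand δ u₀ κ x = ∫ x in Set.Ioc xm b, κ := by
      refine setIntegral_congr_fun measurableSet_Ioc fun x hx => ?_
      have h5 : ell (2 * δ * κ) / (2 * δ) ≤ u₀ x :=
        (hiff x).2 ⟨by linarith [((hiff xm).1 (hxm.uMax_eq ▸ h2)).1, hx.1], hx.2⟩
      rw [div_le_iff₀ (by positivity)] at h5
      simp only [tailIntegrand]
      rw [yInv_of_nonpos (by linarith), zero_div, sub_zero]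
    rw [h4]
    simp only [integral_const, MeasurableSet.univ, measureReal_restrict_apply, Set.univ_inter,
      Real.volume_real_Ioc_of_le hb, smul_eq_mul]
    ring

include hδ hu in
lemma continuousOn_thetaPlus :
    ContinuousOn (fun κ => thetaPlus δ u₀ (zeta δ κ)) (Set.Icc 0 (kappaMax δ u₀)) := by
  obtain ⟨xm, hxm⟩ := hu.exists_lobeTop
  refine ContinuousOn.congr ?_ fun κ hκ => thetaPlus_zeta hδ hu hxm hκ
  refine (by fun_prop : ContinuousOn (fun κ : ℝ => κ * xm) _).add ?_
  refine continuousOn_of_dominated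
    (bound := fun x => Real.pi * √(2 * δ) / (2 * δ) * √(u₀ x)) ?_ ?_ ?_ ?_
  · exact fun κ _ => (continuous_tailIntegrand hu κ).aestronglyMeasurable
  · refine fun κ hκ => Eventually.of_forall fun x => ?_
    have := tailIntegrand_mem hδ hu hκ x
    rw [Real.norm_eq_abs, abs_of_nonneg this.1]
    exact this.2
  · exact (hu.integrable_sqrt.const_mul _).integrableOn
  · refine Eventually.of_forall fun x => ?_
    refine continuousOn_id.sub (ContinuousOn.div_const ?_ _)
    refine continuous_yInv.comp_continuousOn (ContinuousOn.sub ?_ continuousOn_const)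
    exact continuousOn_ell.comp (by fun_prop) fun κ hκ => two_delta_mem hδ hκ

/-- The part of the potential that is linear in `t`. -/
def quadraticPart (δ κ : ℝ) : ℝ := ((zeta δ κ - 1 / (2 * δ)) ^ 2).im

lemma V_zeta (κ x t : ℝ) : V δ u₀ (zeta δ κ) x t =
    x * κ + t * quadraticPart δ κ - thetaPlus δ u₀ (zeta δ κ) := by
  rw [V, zeta_im, quadraticPart]

include hδ in
lemma continuousOn_quadraticPart :
    ContinuousOn (quadraticPart δ) (Set.Icc 0 (kappaMax δ u₀)) :=
  Complex.continuous_im.comp_continuousOn (((continuousOn_zeta hδ).sub continuousOn_const).pow 2)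

/-! ### The Green kernel -/

/-- The logarithmic kernel along the quadratrix. -/
def greenKernel (δ κ η : ℝ) : ℝ :=
  Real.log ‖(zeta δ κ - starRingEnd ℂ (zeta δ η)) / (zeta δ κ - zeta δ η)‖

lemma greenReg_of_ne {κ η : ℝ} (h : κ ≠ η) :
    greenReg (zeta δ κ) (zeta δ η) = greenKernel δ κ η := by
  rw [greenReg, if_neg fun h' => h (zeta_injective δ h'), greenKernel]

lemma greenReg_self {κ : ℝ} (hκ : 0 ≤ κ) :
    greenReg (zeta δ κ) (zeta δ κ) = Real.log (2 * κ) := by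
  rw [greenReg, if_pos rfl, Complex.sub_conj, zeta_im]
  congr 1
  rw [norm_mul, Complex.norm_I, mul_one, Complex.norm_real, Real.norm_eq_abs,
    abs_of_nonneg (by positivity)]

lemma abs_sub_le_norm_zeta_sub (δ κ η : ℝ) : |κ - η| ≤ ‖zeta δ κ - zeta δ η‖ := by
  have := Complex.abs_im_le_norm (zeta δ κ - zeta δ η)
  rwa [Complex.sub_im, zeta_im, zeta_im] at this

/-- A point of the upper half-plane is closer to another such point than to its reflection. Hence
the logarithmic kernel is nonnegative and an upper bound controls its absolute value. -/
lemma norm_zeta_sub_le {κ η : ℝ} (hκ : 0 ≤ κ) (hη : 0 ≤ η) :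
    ‖zeta δ κ - zeta δ η‖ ≤ ‖zeta δ κ - starRingEnd ℂ (zeta δ η)‖ := by
  rw [← sq_le_sq₀ (norm_nonneg _) (norm_nonneg _), Complex.sq_norm, Complex.sq_norm,
    Complex.normSq_apply, Complex.normSq_apply]
  simp only [Complex.sub_re, Complex.sub_im, Complex.conj_re, Complex.conj_im, zeta_im]
  nlinarith [mul_nonneg hκ hη]

include hδ in
lemma exists_greenKernel_bound : ∃ M, 0 < M ∧ ∀ κ ∈ Set.Icc 0 (kappaMax δ u₀),
    ∀ η ∈ Set.Icc 0 (kappaMax δ u₀), κ ≠ η → |greenKernel δ κ η| ≤ Real.log (M / |κ - η|) := by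
  obtain ⟨B, hB⟩ := isCompact_Icc.exists_bound_of_continuousOn (continuousOn_zeta hδ (u₀ := u₀))
  refine ⟨2 * |B| + 1, by positivity, fun κ hκ η hη hne => ?_⟩
  have h1 := abs_sub_le_norm_zeta_sub δ κ η
  have h2 := norm_zeta_sub_le (δ := δ) hκ.1 hη.1
  have h3 : 0 < |κ - η| := abs_pos.2 (sub_ne_zero.2 hne)
  have h4 : ‖zeta δ κ - starRingEnd ℂ (zeta δ η)‖ ≤ 2 * |B| + 1 := by
    refine (norm_sub_le _ _).trans ?_
    rw [RCLike.norm_conj]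
    linarith [hB κ hκ, hB η hη, le_abs_self B]
  have h5 : 0 < ‖zeta δ κ - zeta δ η‖ := h3.trans_le h1
  rw [greenKernel, norm_div, abs_of_nonneg (Real.log_nonneg ((one_le_div h5).2 h2))]
  refine Real.log_le_log (div_pos (h5.trans_le h2) h5) ?_
  gcongr

include hδ in
lemma continuousOn_greenKernel : ContinuousOn (fun p : ℝ × ℝ => greenKernel δ p.1 p.2)
    {p | p.1 ∈ Set.Icc 0 (kappaMax δ u₀) ∧ p.2 ∈ Set.Icc 0 (kappaMax δ u₀) ∧ p.1 ≠ p.2} := by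
  have hz := continuousOn_zeta hδ (u₀ := u₀)
  set T : Set (ℝ × ℝ) :=
    {p | p.1 ∈ Set.Icc 0 (kappaMax δ u₀) ∧ p.2 ∈ Set.Icc 0 (kappaMax δ u₀) ∧ p.1 ≠ p.2}
  have h1 : ContinuousOn (fun p : ℝ × ℝ => zeta δ p.1) T :=
    hz.comp continuousOn_fst fun p hp => hp.1
  have h2 : ContinuousOn (fun p : ℝ × ℝ => zeta δ p.2) T :=
    hz.comp continuousOn_snd fun p hp => hp.2.1
  have hpos : ∀ p ∈ T, 0 < ‖zeta δ p.1 - zeta δ p.2‖ := fun p hp =>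
    (abs_pos.2 (sub_ne_zero.2 hp.2.2)).trans_le (abs_sub_le_norm_zeta_sub δ _ _)
  have h3 : ContinuousOn (fun p : ℝ × ℝ =>
      (zeta δ p.1 - starRingEnd ℂ (zeta δ p.2)) / (zeta δ p.1 - zeta δ p.2)) T :=
    (h1.sub (Complex.continuous_conj.comp_continuousOn h2)).div (h1.sub h2)
      fun p hp => norm_pos_iff.1 (hpos p hp)
  refine h3.norm.log fun p hp => ?_
  rw [norm_div]
  exact (div_pos ((hpos p hp).trans_le (norm_zeta_sub_le hp.1.1 hp.2.1.1)) (hpos p hp)).ne'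

variable {R Φ : ℝ → ℝ}

include hδ hu in
lemma WeylHomeo.mem_iff (h : WeylHomeo δ u₀ R Φ) (s : ℝ) :
    Φ s ∈ Set.Icc 0 (kappaMax δ u₀) ↔ s ∈ Set.Icc 0 (weyl δ u₀ 0) := by
  have hm := (kappaMax_pos hδ hu).le
  have h0 : Φ (weyl δ u₀ 0) = 0 := by rw [← h.eq_weyl 0 ⟨le_rfl, hm⟩, h.left_inv]
  have h1 : Φ 0 = kappaMax δ u₀ := by
    rw [← weyl_kappaMax hδ hu, ← h.eq_weyl _ ⟨hm, le_rfl⟩, h.left_inv]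
  have h2 : 0 ≤ Φ s ↔ s ≤ weyl δ u₀ 0 := by
    have := h.strictAnti_inv.le_iff_ge (a := weyl δ u₀ 0) (b := s)
    rwa [h0] at this
  have h3 : Φ s ≤ kappaMax δ u₀ ↔ 0 ≤ s := by rw [← h1, h.strictAnti_inv.le_iff_ge]
  rw [Set.mem_Icc, Set.mem_Icc, h2, h3]
  exact and_comm

include hδ hu in
-- The Hölder estimate of exponent 1/10 for R, read backwards through the inverse.
lemma WeylHomeo.exists_lower_bound (h : WeylHomeo δ u₀ R Φ) :
    ∃ c, 0 < c ∧ ∀ s ∈ Set.Icc 0 (weyl δ u₀ 0), ∀ t ∈ Set.Icc 0 (weyl δ u₀ 0),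
      c * |s - t| ^ (10 : ℕ) ≤ |Φ s - Φ t| := by
  obtain ⟨C, hC, hh⟩ := exists_weyl_holder hδ hu
  have key : ∀ s ∈ Set.Icc 0 (weyl δ u₀ 0), ∀ t ∈ Set.Icc 0 (weyl δ u₀ 0), s ≤ t →
      (t - s) ^ 10 ≤ C ^ 10 * (Φ s - Φ t) := by
    intro s hs t ht hst
    have hs' := (h.mem_iff hδ hu s).2 hs
    have ht' := (h.mem_iff hδ hu t).2 ht
    have hle : Φ t ≤ Φ s := h.strictAnti_inv.antitone hst
    have h1 := hh (Φ t) (Φ s) ht'.1 hle hs'.2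
    rw [← h.eq_weyl _ ht', ← h.eq_weyl _ hs', h.right_inv, h.right_inv] at h1
    calc (t - s) ^ 10 ≤ (C * (Φ s - Φ t) ^ (1 / 10 : ℝ)) ^ 10 :=
          pow_le_pow_left₀ (by linarith) h1 10
      _ = C ^ 10 * (Φ s - Φ t) := by
          rw [mul_pow, ← Real.rpow_natCast, ← Real.rpow_natCast ((Φ s - Φ t) ^ (1 / 10 : ℝ)),
            ← Real.rpow_mul (by linarith)]
          norm_num
  refine ⟨(C ^ 10)⁻¹, by positivity, fun s hs t ht => ?_⟩
  rw [inv_mul_le_iff₀ (by positivity)]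
  rcases le_total s t with hst | hst
  · rw [abs_sub_comm, abs_of_nonneg (by linarith),
      abs_of_nonneg (by linarith [h.strictAnti_inv.antitone hst])]
    exact key s hs t ht hst
  · rw [abs_of_nonneg (by linarith), abs_sub_comm,
      abs_of_nonneg (by linarith [h.strictAnti_inv.antitone hst])]
    exact key t ht s hs hst

/-- The power 10 leaves the logarithm as a factor, and log y ≤ 2√y does the rest. Any positive
Hölder exponent for R would therefore give an integrable singularity. -/
lemma log_div_pow_le {M c z : ℝ} (hM : 0 < M) (hc : 0 < c) (hz : 0 < z) :
    Real.log (M / (c * z ^ (10 : ℕ))) ≤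
      20 * ((M / c) ^ (1 / 10 : ℝ)) ^ (1 / 2 : ℝ) * z ^ (-(1 / 2) : ℝ) := by
  set b := (M / c) ^ (1 / 10 : ℝ) with hb
  have hb0 : 0 < b := by positivity
  have h1 : M / (c * z ^ 10) = (b / z) ^ 10 := by
    rw [div_pow, hb, ← Real.rpow_natCast ((M / c) ^ (1 / 10 : ℝ)), ← Real.rpow_mul (by positivity)]
    norm_num
    field_simp
  rw [h1, Real.log_pow]
  have h2 := Real.log_le_rpow_div (x := b / z) (ε := 1 / 2) (by positivity) (by norm_num)
  rw [Real.div_rpow hb0.le hz.le] at h2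
  rw [Real.rpow_neg hz.le]
  push_cast
  calc 10 * Real.log (b / z) ≤ 10 * (b ^ (1 / 2 : ℝ) / z ^ (1 / 2 : ℝ) / (1 / 2)) := by gcongr
    _ = _ := by ring

include hδ hu in
lemma WeylHomeo.exists_singularKernel (h : WeylHomeo δ u₀ R Φ) :
    ∃ C, SingularKernel (weyl δ u₀ 0) C fun s t => greenKernel δ (Φ s) (Φ t) := by
  obtain ⟨M, hM, hb⟩ := exists_greenKernel_bound hδ (u₀ := u₀)
  obtain ⟨c, hc, hl⟩ := h.exists_lower_bound hδ hu
  refine ⟨20 * ((M / c) ^ (1 / 10 : ℝ)) ^ (1 / 2 : ℝ), by positivity, ?_, ?_⟩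
  · intro s hs t ht hne
    have hz : 0 < |s - t| := abs_pos.2 (sub_ne_zero.2 hne)
    have h1 := hl s hs t ht
    refine (hb _ ((h.mem_iff hδ hu s).2 hs) _ ((h.mem_iff hδ hu t).2 ht)
      (h.strictAnti_inv.injective.ne hne)).trans (le_trans ?_ (log_div_pow_le hM hc hz))
    have h2 : 0 < c * |s - t| ^ 10 := by positivity
    refine Real.log_le_log (div_pos hM (h2.trans_le h1)) ?_
    gcongr
  · refine (continuousOn_greenKernel hδ (u₀ := u₀)).comp (f := fun p : ℝ × ℝ => (Φ p.1, Φ p.2))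
      ?_ ?_
    · have := h.continuous_inv
      fun_prop
    · intro p hp
      exact ⟨(h.mem_iff hδ hu _).2 hp.1, (h.mem_iff hδ hu _).2 hp.2.1,
        h.strictAnti_inv.injective.ne hp.2.2⟩

include hδ hu in
/-- The self-interaction at the nodes has a weak singularity only. -/
lemma WeylHomeo.exists_diagonal_bound (h : WeylHomeo δ u₀ R Φ) :
    ∃ C, 0 ≤ C ∧ ∀ s ∈ Set.Ico 0 (weyl δ u₀ 0),
      |Real.log (2 * Φ s)| ≤ C * (weyl δ u₀ 0 - s) ^ (-(1 / 2) : ℝ) + C := by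
  obtain ⟨c, hc, hl⟩ := h.exists_lower_bound hδ hu
  have hm := kappaMax_pos hδ hu
  have hL := weyl_zero_pos hδ hu
  have h0 : Φ (weyl δ u₀ 0) = 0 := by rw [← h.eq_weyl 0 ⟨le_rfl, hm.le⟩, h.left_inv]
  set C₁ := 20 * (((1 / 2) / c) ^ (1 / 10 : ℝ)) ^ (1 / 2 : ℝ) with hC₁
  refine ⟨C₁ + |Real.log (2 * kappaMax δ u₀)|, by positivity, fun s hs => ?_⟩
  have hs' := (h.mem_iff hδ hu s).2 (Set.Ico_subset_Icc_self hs)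
  have hz : 0 < weyl δ u₀ 0 - s := sub_pos.2 hs.2
  have h1 := hl s (Set.Ico_subset_Icc_self hs) _ ⟨hL.le, le_rfl⟩
  rw [h0, sub_zero, abs_of_nonneg hs'.1, abs_sub_comm, abs_of_pos hz] at h1
  have hpos : 0 < Φ s := lt_of_lt_of_le (by positivity) h1
  have h2 : Real.log (2 * Φ s) ≤ Real.log (2 * kappaMax δ u₀) :=
    Real.log_le_log (by positivity) (by linarith [hs'.2])
  -- The lower bound on Φ is applied against the endpoint L, where Φ vanishes; the constant 1/2
  -- comes from -log (2Φ) = log ((1/2) / Φ).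
  have h3 : -Real.log (2 * Φ s) ≤ C₁ * (weyl δ u₀ 0 - s) ^ (-(1 / 2) : ℝ) := by
    refine le_trans ?_ (log_div_pow_le (M := 1 / 2) (by norm_num) hc hz)
    rw [← Real.log_inv]
    refine Real.log_le_log (by positivity) ?_
    rw [mul_inv, ← one_div, div_eq_mul_inv (1 / 2 : ℝ) (c * _)]
    gcongr
  have h4 := le_abs_self (Real.log (2 * kappaMax δ u₀))
  have h5 : 0 ≤ |Real.log (2 * kappaMax δ u₀)| * (weyl δ u₀ 0 - s) ^ (-(1 / 2) : ℝ) := by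
    positivity
  have h6 : 0 ≤ C₁ * (weyl δ u₀ 0 - s) ^ (-(1 / 2) : ℝ) := by positivity
  have h7 : 0 ≤ C₁ := by positivity
  rw [abs_le]
  constructor <;> linarith [abs_nonneg (Real.log (2 * kappaMax δ u₀))]

end Potential

/-! ### Change of variables between κ and s -/

section Transfer

/-- Fubini would give integrability of almost every section, but the Green potential has to converge
at every κ. -/
lemma SingularKernel.integrableOn_section {L C : ℝ} {G : ℝ → ℝ → ℝ} (hG : SingularKernel L C G)
    {s : ℝ} (hs : s ∈ Set.Icc 0 L) : IntegrableOn (G s) (Set.Ioc 0 L) := by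
  have hm : AEStronglyMeasurable (G s) (volume.restrict (Set.Ioc 0 L)) := by
    have h1 : ContinuousOn (G s) (Set.Ioc 0 L \ {s}) :=
      hG.continuousOn.comp (f := fun t => (s, t)) (by fun_prop) fun t ht =>
        ⟨hs, Set.Ioc_subset_Icc_self ht.1, fun h => ht.2 h.symm⟩
    have h2 := h1.aestronglyMeasurable (measurableSet_Ioc.diff (measurableSet_singleton s))
      (μ := volume)
    rwa [Measure.restrict_congr_set (sdiff_null_ae_eq_self (measure_singleton s))] at h2
  have hb : IntegrableOn (fun t => |s - t| ^ (-(1 / 2) : ℝ)) (Set.Ioc 0 L) := by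
    have h1 := ((integrableOn_abs_rpow L).integrable_indicator measurableSet_Ioc).comp_sub_right s
    refine (h1.integrableOn (s := Set.Ioc 0 L)).congr ?_
    rw [EventuallyEq, ae_restrict_iff' measurableSet_Ioc]
    -- The indicator is that of a half-open interval, so the single t with t - s = -L is discarded.
    have h2 : ∀ᵐ t : ℝ, t - s ≠ -L := by
      have : {t : ℝ | t - s = -L} = {s - L} := by
        ext t; simp only [Set.mem_ofPred_eq, Set.mem_singleton_iff]
        constructor <;> intro h <;> linarith
      rw [ae_iff]
      simp only [ne_eq, not_not]
      rw [this, Real.volume_singleton]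
    filter_upwards [h2] with t ht1 ht
    have h3 : t - s ∈ Set.Ioc (-L) L :=
      ⟨lt_of_le_of_ne (by linarith [ht.1, hs.2]) (Ne.symm ht1), by linarith [ht.2, hs.1]⟩
    rw [Set.indicator_of_mem h3, abs_sub_comm]
  refine (hb.integrable.const_mul C).mono' hm ?_
  rw [ae_restrict_iff' measurableSet_Ioc]
  have h2 : ∀ᵐ t : ℝ, t ≠ s := by
    rw [ae_iff]; simp
  filter_upwards [h2] with t ht1 ht
  exact hG.bound s hs t (Set.Ioc_subset_Icc_self ht) ht1.symm

variable {δ : ℝ} (hδ : 0 < δ) {u₀ : ℝ → ℝ} (hu : Admissible u₀) {R Φ : ℝ → ℝ}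

lemma WeylHomeo.measurableEmbedding (h : WeylHomeo δ u₀ R Φ) : MeasurableEmbedding Φ :=
  let e : ℝ ≃ᵐ ℝ := ⟨⟨Φ, R, h.right_inv, h.left_inv⟩, h.continuous_inv.measurable,
    h.continuous.measurable⟩
  e.measurableEmbedding

lemma ae_mul_density (h : WeylHomeo δ u₀ R Φ) {f ρ : ℝ → ℝ}
    (hρ : ∀ κ ∈ Set.Ioo 0 (kappaMax δ u₀), ρ κ = f (R κ) * rhoWyl δ u₀ κ) (H : ℝ → ℝ) :
    (fun κ => (ENNReal.ofReal (rhoWyl δ u₀ κ)).toReal • (H κ * f (R κ)))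
      =ᵐ[lebIoc (kappaMax δ u₀)] fun κ => H κ * ρ κ := by
  rw [lebIoc, ← restrict_Ioo_eq_restrict_Ioc]
  refine (ae_restrict_iff' measurableSet_Ioo).2 (Eventually.of_forall fun κ hκ => ?_)
  simp only [smul_eq_mul]
  rw [ENNReal.toReal_ofReal (rhoWyl_nonneg h hκ), hρ κ hκ]
  ring

include hδ hu in
/-- Change of variables `κ = Φ(s)` for integrals. -/
lemma integral_transfer (h : WeylHomeo δ u₀ R Φ) {f ρ : ℝ → ℝ}
    (hρ : ∀ κ ∈ Set.Ioo 0 (kappaMax δ u₀), ρ κ = f (R κ) * rhoWyl δ u₀ κ) (H : ℝ → ℝ) :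
    ∫ κ in Set.Icc 0 (kappaMax δ u₀), H κ * ρ κ =
      ∫ s in Set.Ioc 0 (weyl δ u₀ 0), H (Φ s) * f s := by
  rw [integral_Icc_eq_integral_Ioc, ← integral_congr_ae (ae_mul_density h hρ H),
    ← integral_withDensity_eq_integral_toReal_smul (measurable_rhoWyl δ u₀).ennreal_ofReal
      (Eventually.of_forall fun _ => ENNReal.ofReal_lt_top), ← map_eq_withDensity hδ hu h,
    h.measurableEmbedding.integral_map]
  simp only [h.right_inv]

include hδ hu in
/-- Change of variables `κ = Φ(s)` for integrability. -/
lemma integrableOn_transfer (h : WeylHomeo δ u₀ R Φ) {f ρ : ℝ → ℝ}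
    (hρ : ∀ κ ∈ Set.Ioo 0 (kappaMax δ u₀), ρ κ = f (R κ) * rhoWyl δ u₀ κ) (H : ℝ → ℝ) :
    IntegrableOn (fun κ => H κ * ρ κ) (Set.Icc 0 (kappaMax δ u₀)) ↔
      IntegrableOn (fun s => H (Φ s) * f s) (Set.Ioc 0 (weyl δ u₀ 0)) := by
  rw [integrableOn_Icc_iff_integrableOn_Ioc, IntegrableOn,
    ← integrable_congr (ae_mul_density h hρ H),
    ← integrable_withDensity_iff_integrable_smul' (measurable_rhoWyl δ u₀).ennreal_ofReal
      (Eventually.of_forall fun _ => ENNReal.ofReal_lt_top), ← map_eq_withDensity hδ hu h,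
    h.measurableEmbedding.integrable_map_iff]
  simp only [Function.comp_def, h.right_inv]
  rfl

lemma exists_unitDensity (h : WeylHomeo δ u₀ R Φ) {ρ : ℝ → ℝ}
    (hρ : ρ ∈ admissibleDensities δ u₀) : ∃ f ∈ unitDensities,
      ∀ κ ∈ Set.Ioo 0 (kappaMax δ u₀), ρ κ = f (R κ) * rhoWyl δ u₀ κ := by
  obtain ⟨hm, h0, h1⟩ := hρ
  refine ⟨fun s => (Set.Ioo 0 (kappaMax δ u₀)).indicator (fun κ => ρ κ / rhoWyl δ u₀ κ) (Φ s),
    ⟨((hm.div (measurable_rhoWyl δ u₀)).indicator measurableSet_Ioo).comp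
      h.continuous_inv.measurable, fun s => ?_⟩, fun κ hκ => ?_⟩
  · by_cases hs : Φ s ∈ Set.Ioo 0 (kappaMax δ u₀)
    · simp only [Set.indicator_of_mem hs]
      have h2 := rhoWyl_nonneg h hs
      exact ⟨div_nonneg (h0 _ (Set.Ioo_subset_Icc_self hs)) h2, div_le_one_of_le₀ (h1 _ hs) h2⟩
    · simp only [Set.indicator_of_notMem hs]
      norm_num
  · simp only [h.left_inv, Set.indicator_of_mem hκ]
    -- Where ρ^Wyl vanishes the constraints force ρ = 0, so the convention 0/0 = 0 in the quotient
    -- does no harm.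
    rcases eq_or_ne (rhoWyl δ u₀ κ) 0 with h2 | h2
    · have h3 := h0 κ (Set.Ioo_subset_Icc_self hκ)
      have h4 := h1 κ hκ
      rw [h2] at h4 ⊢
      rw [mul_zero]
      exact le_antisymm h4 h3
    · rw [div_mul_cancel₀ _ h2]

lemma exists_admissibleDensity (h : WeylHomeo δ u₀ R Φ) {f : ℝ → ℝ} (hf : f ∈ unitDensities) :
    ∃ ρ ∈ admissibleDensities δ u₀,
      ∀ κ ∈ Set.Ioo 0 (kappaMax δ u₀), ρ κ = f (R κ) * rhoWyl δ u₀ κ := by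
  refine ⟨(Set.Ioo 0 (kappaMax δ u₀)).indicator fun κ => f (R κ) * rhoWyl δ u₀ κ,
    ⟨((hf.1.comp h.continuous.measurable).mul (measurable_rhoWyl δ u₀)).indicator
      measurableSet_Ioo, fun κ _ => Set.indicator_nonneg (fun κ hκ =>
        mul_nonneg (hf.2 _).1 (rhoWyl_nonneg h hκ)) κ, fun κ hκ => ?_⟩,
    fun κ hκ => Set.indicator_of_mem hκ _⟩
  rw [Set.indicator_of_mem hκ]
  exact mul_le_of_le_one_left (rhoWyl_nonneg h hκ) (hf.2 _).2

/-- The external potential in the variable `s`. -/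
def sPotential (δ : ℝ) (u₀ Φ : ℝ → ℝ) (x t s : ℝ) : ℝ := V δ u₀ (zeta δ (Φ s)) x t

/-- The Green kernel in the variable `s`. -/
def sKernel (δ : ℝ) (Φ : ℝ → ℝ) (s t : ℝ) : ℝ := greenKernel δ (Φ s) (Φ t)

lemma sPotential_eq (Φ : ℝ → ℝ) (x t s : ℝ) : sPotential δ u₀ Φ x t s =
    x * Φ s + t * quadraticPart δ (Φ s) - thetaPlus δ u₀ (zeta δ (Φ s)) := V_zeta _ _ _

include hδ hu in
lemma WeylHomeo.continuousOn_parts (h : WeylHomeo δ u₀ R Φ) :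
    ContinuousOn Φ (Set.Icc 0 (weyl δ u₀ 0)) ∧
    ContinuousOn (fun s => quadraticPart δ (Φ s)) (Set.Icc 0 (weyl δ u₀ 0)) ∧
    ContinuousOn (fun s => thetaPlus δ u₀ (zeta δ (Φ s))) (Set.Icc 0 (weyl δ u₀ 0)) := by
  have hc := h.continuous_inv.continuousOn (s := Set.Icc 0 (weyl δ u₀ 0))
  have hm : Set.MapsTo Φ (Set.Icc 0 (weyl δ u₀ 0)) (Set.Icc 0 (kappaMax δ u₀)) :=
    fun s hs => (h.mem_iff hδ hu s).2 hs
  exact ⟨hc, (continuousOn_quadraticPart hδ).comp hc hm, (continuousOn_thetaPlus hδ hu).comp hc hm⟩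

include hδ hu in
lemma WeylHomeo.continuousOn_sPotential (h : WeylHomeo δ u₀ R Φ) (x t : ℝ) :
    ContinuousOn (sPotential δ u₀ Φ x t) (Set.Icc 0 (weyl δ u₀ 0)) := by
  obtain ⟨h1, h2, h3⟩ := h.continuousOn_parts hδ hu
  refine ContinuousOn.congr ?_ fun s _ => sPotential_eq Φ x t s
  fun_prop

include hδ hu in
lemma integrableOn_potentialIntegrand (h : WeylHomeo δ u₀ R Φ) {f ρ : ℝ → ℝ}
    (hf : f ∈ unitDensities)
    (hρ : ∀ κ ∈ Set.Ioo 0 (kappaMax δ u₀), ρ κ = f (R κ) * rhoWyl δ u₀ κ) {κ : ℝ}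
    (hκ : κ ∈ Set.Icc 0 (kappaMax δ u₀)) :
    IntegrableOn (potentialIntegrand δ ρ (zeta δ κ)) (Set.Icc 0 (kappaMax δ u₀)) := by
  obtain ⟨C, hG⟩ := h.exists_singularKernel hδ hu
  have hs : R κ ∈ Set.Icc 0 (weyl δ u₀ 0) := by rwa [← h.mem_iff hδ hu, h.left_inv]
  have h1 := hG.integrableOn_section hs
  rw [h.left_inv] at h1
  refine (integrableOn_transfer hδ hu h hρ (greenKernel δ κ)).2 ?_
  exact h1.integrable.mul_bdd (c := 1) hf.1.aestronglyMeasurable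
    (Eventually.of_forall (unitDensities.norm_le hf))

include hδ hu in
-- The change of variables is made in the inner and the outer integral; Fubini then assembles the
-- iterated integral into the double integral of `sEnergy`.
lemma energy_transfer (h : WeylHomeo δ u₀ R Φ) {f ρ : ℝ → ℝ} (hf : f ∈ unitDensities)
    (hρ : ∀ κ ∈ Set.Ioo 0 (kappaMax δ u₀), ρ κ = f (R κ) * rhoWyl δ u₀ κ) (x t : ℝ) :
    IntegrableOn (energyIntegrand δ u₀ ρ x t) (Set.Icc 0 (kappaMax δ u₀)) ∧
      energy δ u₀ ρ x t =
        sEnergy (weyl δ u₀ 0) (sPotential δ u₀ Φ x t) (sKernel δ Φ) f := by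
  obtain ⟨C, hG⟩ := h.exists_singularKernel hδ hu
  have hL := weyl_zero_pos hδ hu
  have hpot : ∀ s, potential δ u₀ ρ (zeta δ (Φ s)) =
      1 / Real.pi * ∫ r in Set.Ioc 0 (weyl δ u₀ 0), sKernel δ Φ s r * f r := fun s => by
    rw [potential]
    congr 1
    exact integral_transfer hδ hu h hρ (greenKernel δ (Φ s))
  have hI := integrable_mul_unitDensities (hG.integrable hL) hf
  have h2 : Integrable (fun s => (∫ r in Set.Ioc 0 (weyl δ u₀ 0), sKernel δ Φ s r * f r) * f s)
      (lebIoc (weyl δ u₀ 0)) := by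
    refine hI.integral_prod_left.congr (Eventually.of_forall fun s => ?_)
    simp only [sKernel]
    rw [← integral_mul_const]
    congr 1; ext r; ring
  have h1 : Integrable (fun s => sPotential δ u₀ Φ x t s * f s) (lebIoc (weyl δ u₀ 0)) :=
    ((h.continuousOn_sPotential hδ hu x t).integrableOn_Icc.mono_set
      Set.Ioc_subset_Icc_self).integrable.mul_bdd (c := 1) hf.1.aestronglyMeasurable
      (Eventually.of_forall (unitDensities.norm_le hf))
  set H : ℝ → ℝ := fun κ => V δ u₀ (zeta δ κ) x t + 1 / 2 * potential δ u₀ ρ (zeta δ κ) with hH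
  have h3 : (fun s => H (Φ s) * f s) = fun s => sPotential δ u₀ Φ x t s * f s +
      1 / (2 * Real.pi) * ((∫ r in Set.Ioc 0 (weyl δ u₀ 0), sKernel δ Φ s r * f r) * f s) := by
    ext s
    simp only [hH, hpot, sPotential]
    field_simp
  constructor
  · refine (integrableOn_transfer hδ hu h hρ H).2 ?_
    rw [h3]
    exact h1.add (h2.const_mul _)
  · refine (integral_transfer hδ hu h hρ H).trans ?_
    rw [h3, integral_add h1 (h2.const_mul _), integral_const_mul, sEnergy]
    congr 2
    refine Eq.trans ?_ (integral_prod _ hI).symm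
    congr 1; ext s
    rw [← integral_mul_const]
    congr 1; ext r
    simp only [sKernel]; ring

include hδ hu in
lemma exists_minimizer (h : WeylHomeo δ u₀ R Φ) (x t : ℝ) :
    ∃ f ∈ unitDensities, (∀ g ∈ unitDensities,
      sEnergy (weyl δ u₀ 0) (sPotential δ u₀ Φ x t) (sKernel δ Φ) f ≤
        sEnergy (weyl δ u₀ 0) (sPotential δ u₀ Φ x t) (sKernel δ Φ) g) ∧
    sEnergy (weyl δ u₀ 0) (sPotential δ u₀ Φ x t) (sKernel δ Φ) f = continuumMin δ u₀ x t ∧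
    ∃ ρ ∈ admissibleDensities δ u₀, energy δ u₀ ρ x t = continuumMin δ u₀ x t ∧
      ∀ σ ∈ admissibleDensities δ u₀, energy δ u₀ ρ x t ≤ energy δ u₀ σ x t := by
  obtain ⟨C, hG⟩ := h.exists_singularKernel hδ hu
  obtain ⟨f, hf, hmin⟩ := SingularKernel.exists_minimizer hG (weyl_zero_pos hδ hu)
    (h.continuousOn_sPotential hδ hu x t)
  obtain ⟨ρ, hρ, hfρ⟩ := exists_admissibleDensity h hf
  have h1 := (energy_transfer hδ hu h hf hfρ x t).2
  have h2 : ∀ σ ∈ admissibleDensities δ u₀, energy δ u₀ ρ x t ≤ energy δ u₀ σ x t := by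
    intro σ hσ
    obtain ⟨g, hg, hgσ⟩ := exists_unitDensity h hσ
    rw [h1, (energy_transfer hδ hu h hg hgσ x t).2]
    exact hmin g hg
  have hleast : IsLeast ((fun ρ => energy δ u₀ ρ x t) '' admissibleDensities δ u₀)
      (energy δ u₀ ρ x t) :=
    ⟨⟨ρ, hρ, rfl⟩, by rintro _ ⟨σ, hσ, rfl⟩; exact h2 σ hσ⟩
  have h3 : energy δ u₀ ρ x t = continuumMin δ u₀ x t := hleast.csInf_eq.symm
  exact ⟨f, hf, hmin, h1 ▸ h3, ρ, hρ, h3, h2⟩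

end Transfer

/-! ### Discrete energies as node energies, and comparison of the minima -/

section Discrete

variable {δ : ℝ} (hδ : 0 < δ) {u₀ : ℝ → ℝ} (hu : Admissible u₀) {R Φ : ℝ → ℝ}

lemma eps_mul_pi (δ : ℝ) (u₀ : ℝ → ℝ) (N : ℕ) : eps δ u₀ N * Real.pi = weyl δ u₀ 0 / N := by
  rw [eps, weyl, one_div, mul_inv]
  field_simp

include hδ hu in
-- By injectivity of R the set under the supremum is a singleton, and π(n - 1/2)ε_N is the midpoint
-- of the n-th cell.
lemma kappa_eq (h : WeylHomeo δ u₀ R Φ) {N n : ℕ} (hn : n ∈ Finset.Icc 1 N) :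
    kappa δ u₀ N n = Φ (node (weyl δ u₀ 0 / N) n) := by
  have hnode := Set.Ioo_subset_Icc_self (node_mem (weyl_zero_pos hδ hu) hn)
  have h1 : Real.pi * ((n : ℝ) - 1 / 2) * eps δ u₀ N = node (weyl δ u₀ 0 / N) n := by
    rw [node, ← eps_mul_pi]; ring
  unfold kappa
  rw [h1]
  refine (congrArg sSup (Set.ext fun κ => ?_)).trans
    (csSup_singleton (Φ (node (weyl δ u₀ 0 / N) n)))
  rw [Set.mem_ofPred_eq, Set.mem_singleton_iff]
  constructor
  · rintro ⟨hκ, hR⟩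
    have : R κ = node (weyl δ u₀ 0 / N) n := (h.eq_weyl κ hκ).trans hR
    rw [← this, h.left_inv]
  · rintro rfl
    have hm := (h.mem_iff hδ hu _).2 hnode
    exact ⟨hm, by rw [← weyl, ← h.eq_weyl _ hm, h.right_inv]⟩

include hδ hu in
lemma integral_muS {N : ℕ} (S : Finset ℕ) (H : ℝ → ℝ) :
    ∫ κ, H κ ∂(muS δ u₀ N S) = weyl δ u₀ 0 / N * ∑ n ∈ S, H (kappa δ u₀ N n) := by
  have hL := weyl_zero_pos hδ hu
  rw [muS, eps_mul_pi, integral_smul_measure, ENNReal.toReal_ofReal (by positivity),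
    integral_finsetSum_measure fun n _ => integrable_dirac (by simp)]
  simp only [integral_dirac, smul_eq_mul]

include hδ hu in
lemma discreteEnergy_eq (h : WeylHomeo δ u₀ R Φ) {N : ℕ} {S : Finset ℕ}
    (hS : S ⊆ Finset.Icc 1 N) (x t : ℝ) :
    discreteEnergy δ u₀ N S x t =
      nodeEnergy (weyl δ u₀ 0 / N) N (sPotential δ u₀ Φ x t) (sKernel δ Φ)
        (fun n => if n ∈ S then weyl δ u₀ 0 / N else 0) +
      1 / (2 * Real.pi) * ∑ n ∈ S, (weyl δ u₀ 0 / N) ^ 2 *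
        Real.log (2 * Φ (node (weyl δ u₀ 0 / N) n)) := by
  set z := weyl δ u₀ 0 / N with hz
  -- The regulated kernel is the true one off the diagonal, and log |ζ - ζ*| = log 2κ on it. The
  -- diagonal is split off because the node energy omits it.
  have hgreen : ∀ n ∈ S, ∀ m ∈ S, greenReg (zeta δ (kappa δ u₀ N n)) (zeta δ (kappa δ u₀ N m)) =
      (if n = m then 0 else sKernel δ Φ (node z n) (node z m)) +
        (if n = m then Real.log (2 * Φ (node z n)) else 0) := by
    intro n hn m hm
    have hn' := node_mem (weyl_zero_pos hδ hu) (hS hn)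
    have hm' := node_mem (weyl_zero_pos hδ hu) (hS hm)
    rw [kappa_eq hδ hu h (hS hn), kappa_eq hδ hu h (hS hm)]
    by_cases hnm : n = m
    · subst hnm
      rw [greenReg_self ((h.mem_iff hδ hu _).2 (Set.Ioo_subset_Icc_self hn')).1]
      simp [hz]
    · rw [if_neg hnm, if_neg hnm, add_zero, greenReg_of_ne, sKernel]
      refine h.strictAnti_inv.injective.ne fun he => hnm ?_
      have h1 : 0 < z := by
        by_contra h2
        have h3 : (1 : ℝ) ≤ n := by exact_mod_cast (Finset.mem_Icc.1 (hS hn)).1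
        have h4 : 0 < ((n : ℝ) - 1 / 2) * z := hn'.1
        nlinarith
      have h2 := node_sub_node z n m
      rw [he, sub_self] at h2
      have h3 := (mul_eq_zero.1 h2.symm).resolve_right h1.ne'
      exact_mod_cast sub_eq_zero.1 h3
  have hsum : ∀ F : ℕ → ℝ, ∑ n ∈ Finset.Icc 1 N, F n * (if n ∈ S then z else 0) =
      ∑ n ∈ S, F n * z := by
    intro F
    rw [← Finset.sum_subset hS (f := fun n => F n * (if n ∈ S then z else 0))]
    · exact Finset.sum_congr rfl fun n hn => by rw [if_pos hn]
    · intro n _ hn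
      rw [if_neg hn, mul_zero]
  have hdouble : ∀ k : ℕ → ℕ → ℝ, ∑ n ∈ Finset.Icc 1 N, ∑ m ∈ Finset.Icc 1 N,
      k n m * ((if n ∈ S then z else 0) * (if m ∈ S then z else 0)) =
      ∑ n ∈ S, (∑ m ∈ S, k n m * z) * z := by
    intro k
    rw [← hsum]
    refine Finset.sum_congr rfl fun n _ => ?_
    rw [← hsum, Finset.sum_mul]
    exact Finset.sum_congr rfl fun m _ => by ring
  unfold discreteEnergy nodeEnergy
  simp only [integral_muS hδ hu, ← hz]
  rw [hsum, hdouble, add_assoc, ← mul_add]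
  congr 1
  · rw [Finset.mul_sum]
    refine Finset.sum_congr rfl fun n hn => ?_
    rw [kappa_eq hδ hu h (hS hn), sPotential, mul_comm]
  · congr 1
    rw [Finset.mul_sum, ← Finset.sum_add_distrib]
    refine Finset.sum_congr rfl fun n hn => ?_
    rw [Finset.sum_congr rfl (hgreen n hn), Finset.sum_add_distrib, Finset.sum_ite_eq, if_pos hn,
      ← Finset.sum_mul]
    ring

include hδ hu in
/-- The total self-interaction of the nodes is negligible. -/
lemma exists_diagonal_error (h : WeylHomeo δ u₀ R Φ) :
    ∃ err : ℕ → ℝ, Tendsto err atTop (𝓝 0) ∧ ∀ N : ℕ, 1 ≤ N → ∀ S ⊆ Finset.Icc 1 N,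
      |1 / (2 * Real.pi) * ∑ n ∈ S, (weyl δ u₀ 0 / N) ^ 2 *
        Real.log (2 * Φ (node (weyl δ u₀ 0 / N) n))| ≤ err N := by
  obtain ⟨C, hC, hb⟩ := h.exists_diagonal_bound hδ hu
  have hL := weyl_zero_pos hδ hu
  set L := weyl δ u₀ 0 with hLdef
  refine ⟨fun N => 1 / (2 * Real.pi) * (L * (2 * C * (L / N / 2) ^ (1 / 2 : ℝ) + C * (L / N))),
    ?_, fun N hN S hS => ?_⟩
  · have hcont : Continuous fun z : ℝ =>
        1 / (2 * Real.pi) * (L * (2 * C * (z / 2) ^ (1 / 2 : ℝ) + C * z)) := by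
      have : Continuous fun z : ℝ => (z / 2) ^ (1 / 2 : ℝ) :=
        (continuous_id.div_const 2).rpow_const fun _ => Or.inr (by norm_num)
      fun_prop
    have := (hcont.tendsto 0).comp (tendsto_div_nat L)
    rw [zero_div, Real.zero_rpow (by norm_num)] at this
    simpa [Function.comp_def] using this
  · have hN' : (0 : ℝ) < N := by exact_mod_cast hN
    set z := L / N with hz
    have hz0 : 0 < z := div_pos hL hN'
    have hNz : (N : ℝ) * z = L := mul_div_cancel₀ _ hN'.ne'
    have hterm : ∀ n ∈ Finset.Icc 1 N, |z ^ 2 * Real.log (2 * Φ (node z n))| ≤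
        z * (2 * C * (z / 2) ^ (1 / 2 : ℝ) + C * z) := by
      intro n hn
      have h1 := node_mem hL hn
      have h2 := hb _ ⟨h1.1.le, h1.2⟩
      -- The midpoints stay h/2 away from L, where log (2Φ) blows up. Each diagonal term is thus O(h
      -- · h^(1/2)), and there are at most N = L/h of them.
      have hle : z / 2 ≤ L - node z n := by
        have : (n : ℝ) ≤ N := by exact_mod_cast (Finset.mem_Icc.1 hn).2
        rw [← hNz, node]
        nlinarith
      have h3 : (L - node z n) ^ (-(1 / 2) : ℝ) ≤ (z / 2) ^ (-(1 / 2) : ℝ) :=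
        Real.rpow_le_rpow_of_nonpos (by positivity) hle (by norm_num)
      have h4 : z * (z / 2) ^ (-(1 / 2) : ℝ) = 2 * (z / 2) ^ (1 / 2 : ℝ) := by
        have : (z / 2) ^ (1 / 2 : ℝ) = (z / 2) * (z / 2) ^ (-(1 / 2) : ℝ) := by
          nth_rewrite 2 [← Real.rpow_one (z / 2)]
          rw [← Real.rpow_add (by positivity)]
          norm_num
        rw [this]; ring
      rw [abs_mul, abs_of_pos (by positivity)]
      calc z ^ 2 * |Real.log (2 * Φ (node z n))|
          ≤ z ^ 2 * (C * (z / 2) ^ (-(1 / 2) : ℝ) + C) := by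
            gcongr
            exact h2.trans (by gcongr)
        _ = z * (C * (z * (z / 2) ^ (-(1 / 2) : ℝ)) + C * z) := by ring
        _ = _ := by rw [h4]; ring
    rw [abs_mul, abs_of_pos (by positivity)]
    refine mul_le_mul_of_nonneg_left ?_ (by positivity)
    calc _ ≤ ∑ n ∈ S, |z ^ 2 * Real.log (2 * Φ (node z n))| := Finset.abs_sum_le_sum_abs _ _
      _ ≤ ∑ n ∈ Finset.Icc 1 N, |z ^ 2 * Real.log (2 * Φ (node z n))| :=
          Finset.sum_le_sum_of_subset_of_nonneg hS fun _ _ _ => abs_nonneg _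
      _ ≤ ∑ n ∈ Finset.Icc 1 N, z * (2 * C * (z / 2) ^ (1 / 2 : ℝ) + C * z) :=
          Finset.sum_le_sum hterm
      _ = L * (2 * C * (z / 2) ^ (1 / 2 : ℝ) + C * z) := by
          rw [Finset.sum_const, Nat.card_Icc, Nat.add_sub_cancel, nsmul_eq_mul, ← mul_assoc, hNz]

include hδ hu in
/-- Locally uniform comparison of continuum and discretized energies. -/
lemma exists_uniform_energy_error (h : WeylHomeo δ u₀ R Φ) {B : ℝ} (hB : 0 ≤ B) :
    ∃ err : ℕ → ℝ, Tendsto err atTop (𝓝 0) ∧ ∀ N : ℕ, 1 ≤ N → ∀ f ∈ unitDensities,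
      ∀ x t : ℝ, |x| ≤ B → |t| ≤ B →
      |sEnergy (weyl δ u₀ 0) (sPotential δ u₀ Φ x t) (sKernel δ Φ) f -
        nodeEnergy (weyl δ u₀ 0 / N) N (sPotential δ u₀ Φ x t) (sKernel δ Φ)
          (cellMass (weyl δ u₀ 0 / N) f)| ≤ err N := by
  obtain ⟨C, hG⟩ := h.exists_singularKernel hδ hu
  have hL := weyl_zero_pos hδ hu
  obtain ⟨hc1, hc2, hc3⟩ := h.continuousOn_parts hδ hu
  -- V is affine in (x, t) with three fixed continuous coefficients. Bounding the error of each one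
  -- gives a total error uniform over |x|, |t| ≤ B.
  obtain ⟨e1, he1, h1⟩ := exists_potential_error hL hc1
  obtain ⟨e2, he2, h2⟩ := exists_potential_error hL hc2
  obtain ⟨e3, he3, h3⟩ := exists_potential_error hL hc3
  obtain ⟨e4, he4, h4⟩ := SingularKernel.exists_error hG hL
  refine ⟨fun N => B * e1 N + B * e2 N + e3 N + 1 / (2 * Real.pi) * e4 N, ?_, ?_⟩
  · simpa using (((he1.const_mul B).add (he2.const_mul B)).add he3).add
      (he4.const_mul (1 / (2 * Real.pi)))
  intro N hN f hf x t hx ht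
  have hint : ∀ W : ℝ → ℝ, ContinuousOn W (Set.Icc 0 (weyl δ u₀ 0)) →
      Integrable (fun s => W s * f s) (lebIoc (weyl δ u₀ 0)) := fun W hW =>
    (hW.integrableOn_Icc.mono_set Set.Ioc_subset_Icc_self).integrable.mul_bdd (c := 1)
      hf.1.aestronglyMeasurable (Eventually.of_forall (unitDensities.norm_le hf))
  have e : ∫ s in Set.Ioc 0 (weyl δ u₀ 0), sPotential δ u₀ Φ x t s * f s =
      x * (∫ s in Set.Ioc 0 (weyl δ u₀ 0), Φ s * f s) +
      t * (∫ s in Set.Ioc 0 (weyl δ u₀ 0), quadraticPart δ (Φ s) * f s) -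
      ∫ s in Set.Ioc 0 (weyl δ u₀ 0), thetaPlus δ u₀ (zeta δ (Φ s)) * f s := by
    have hadd : Integrable (fun s => x * (Φ s * f s) + t * (quadraticPart δ (Φ s) * f s))
        (lebIoc (weyl δ u₀ 0)) := ((hint _ hc1).const_mul x).add ((hint _ hc2).const_mul t)
    rw [← integral_const_mul, ← integral_const_mul,
      ← integral_add ((hint _ hc1).const_mul x) ((hint _ hc2).const_mul t),
      ← integral_sub hadd (hint _ hc3)]
    congr 1; ext s
    rw [sPotential_eq]; ring
  have e' : ∀ a : ℕ → ℝ, ∑ n ∈ Finset.Icc 1 N,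
      sPotential δ u₀ Φ x t (node (weyl δ u₀ 0 / N) n) * a n =
      x * (∑ n ∈ Finset.Icc 1 N, Φ (node (weyl δ u₀ 0 / N) n) * a n) +
      t * (∑ n ∈ Finset.Icc 1 N, quadraticPart δ (Φ (node (weyl δ u₀ 0 / N) n)) * a n) -
      ∑ n ∈ Finset.Icc 1 N, thetaPlus δ u₀ (zeta δ (Φ (node (weyl δ u₀ 0 / N) n))) * a n := by
    intro a
    rw [Finset.mul_sum, Finset.mul_sum, ← Finset.sum_add_distrib, ← Finset.sum_sub_distrib]
    refine Finset.sum_congr rfl fun n _ => ?_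
    rw [sPotential_eq]; ring
  have g1 := h1 N hN f hf
  have g2 := h2 N hN f hf
  have g3 := h3 N hN f hf
  have g4 := h4 N hN f hf
  unfold sEnergy nodeEnergy
  rw [e, e']
  have k1 := mul_le_mul hx g1 (abs_nonneg _) hB
  have k2 := mul_le_mul ht g2 (abs_nonneg _) hB
  have k4 := mul_le_mul_of_nonneg_left g4 (by positivity : 0 ≤ 1 / (2 * Real.pi))
  rw [← abs_mul] at k1 k2
  rw [← abs_of_pos (by positivity : 0 < 1 / (2 * Real.pi)), ← abs_mul,
    abs_of_pos (by positivity : 0 < 1 / (2 * Real.pi))] at k4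
  rw [abs_le] at k1 k2 g3 k4 ⊢
  simp only [mul_sub, sKernel] at k1 k2 k4 ⊢
  constructor <;> linarith

lemma step_mem_unitDensities (z : ℝ) (S : Finset ℕ) :
    (fun s => if cellIdx z s ∈ S then (1 : ℝ) else 0) ∈ unitDensities := by
  constructor
  · exact (measurable_from_nat (f := fun n => if n ∈ S then (1 : ℝ) else 0)).comp
      (measurable_cellIdx z)
  · intro s
    beta_reduce
    split_ifs <;> norm_num

lemma cellMass_step {z : ℝ} (hz : 0 < z) (S : Finset ℕ) {n : ℕ} (hn : 1 ≤ n) :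
    cellMass z (fun s => if cellIdx z s ∈ S then (1 : ℝ) else 0) n = if n ∈ S then z else 0 := by
  have h1 : cellMass z (fun s => if cellIdx z s ∈ S then (1 : ℝ) else 0) n =
      ∫ _ in Set.Ioc (((n : ℝ) - 1) * z) (n * z), if n ∈ S then (1 : ℝ) else 0 := by
    refine setIntegral_congr_fun measurableSet_Ioc fun s hs => ?_
    rw [(cellIdx_eq_iff hz n hn).2 hs]
  rw [h1]
  simp only [integral_const, MeasurableSet.univ, measureReal_restrict_apply, Set.univ_inter,
    Real.volume_real_Ioc, smul_eq_mul]
  rw [max_eq_left (by nlinarith)]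
  split_ifs <;> ring

lemma nodeEnergy_congr {z : ℝ} {N : ℕ} {W : ℝ → ℝ} {G : ℝ → ℝ → ℝ} {a b : ℕ → ℝ}
    (hab : ∀ n ∈ Finset.Icc 1 N, a n = b n) : nodeEnergy z N W G a = nodeEnergy z N W G b := by
  unfold nodeEnergy
  congr 1
  · exact Finset.sum_congr rfl fun n hn => by rw [hab n hn]
  · congr 1
    exact Finset.sum_congr rfl fun n hn => Finset.sum_congr rfl fun m hm => by
      rw [hab n hn, hab m hm]

include hδ hu in
lemma exists_min_error (h : WeylHomeo δ u₀ R Φ) {B : ℝ} (hB : 0 ≤ B) :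
    ∃ err : ℕ → ℝ, Tendsto err atTop (𝓝 0) ∧ ∀ N : ℕ, 1 ≤ N → ∀ x t : ℝ, |x| ≤ B → |t| ≤ B →
      |discreteMin δ u₀ N x t - continuumMin δ u₀ x t| ≤ err N := by
  obtain ⟨e, he, hE⟩ := exists_uniform_energy_error hδ hu h hB
  obtain ⟨d, hd, hD⟩ := exists_diagonal_error hδ hu h
  have hL := weyl_zero_pos hδ hu
  refine ⟨fun N => e N + d N, by simpa using he.add hd, fun N hN x t hx ht => ?_⟩
  have hN' : (0 : ℝ) < N := by exact_mod_cast hN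
  have hz : 0 < weyl δ u₀ 0 / N := div_pos hL hN'
  obtain ⟨f, hf, hmin, hfm, -⟩ := exists_minimizer hδ hu h x t
  rw [abs_sub_le_iff]
  constructor
  -- Upper bound: the cell masses of the continuum minimizer are rounded to a vertex of the cube,
  -- that is to a set S.
  · obtain ⟨S, hS, hle⟩ := exists_vertex_le (Finset.Icc 1 N)
      (fun n => sPotential δ u₀ Φ x t (node (weyl δ u₀ 0 / N) n))
      (fun n m => if n = m then 0 else
        sKernel δ Φ (node (weyl δ u₀ 0 / N) n) (node (weyl δ u₀ 0 / N) m)) (by simp)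
      (1 / (2 * Real.pi)) (weyl δ u₀ 0 / N) (cellMass (weyl δ u₀ 0 / N) f)
      (cellMass_mem hz hf)
    change nodeEnergy (weyl δ u₀ 0 / N) N (sPotential δ u₀ Φ x t) (sKernel δ Φ)
        (fun n => if n ∈ S then weyl δ u₀ 0 / N else 0) ≤
      nodeEnergy (weyl δ u₀ 0 / N) N (sPotential δ u₀ Φ x t) (sKernel δ Φ)
        (cellMass (weyl δ u₀ 0 / N) f) at hle
    have h1 : discreteMin δ u₀ N x t ≤ discreteEnergy δ u₀ N S x t :=
      Finset.inf'_le _ (Finset.mem_powerset.2 hS)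
    rw [discreteEnergy_eq hδ hu h hS] at h1
    have h2 := (abs_le.1 (hD N hN S hS)).2
    have h3 := (abs_le.1 (hE N hN f hf x t hx ht)).1
    linarith
  · obtain ⟨S, hS, hSeq⟩ := Finset.exists_mem_eq_inf' ⟨∅, Finset.empty_mem_powerset _⟩
      (fun S => discreteEnergy δ u₀ N S x t) (s := (Finset.Icc 1 N).powerset)
    rw [Finset.mem_powerset] at hS
    have h1 : discreteMin δ u₀ N x t = discreteEnergy δ u₀ N S x t := hSeq
    rw [discreteEnergy_eq hδ hu h hS] at h1
    -- Lower bound: an optimal S is read as the step density equal to 1 on its cells, a competitor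
    -- in the continuum problem whose cell masses are exactly those of S.
    have hg := step_mem_unitDensities (weyl δ u₀ 0 / N) S
    have h2 := (abs_le.1 (hD N hN S hS)).1
    have h3 := (abs_le.1 (hE N hN _ hg x t hx ht)).2
    rw [nodeEnergy_congr (b := fun n => if n ∈ S then weyl δ u₀ 0 / N else 0)
      fun n hn => cellMass_step hz S (Finset.mem_Icc.1 hn).1] at h3
    have h4 := hmin _ hg
    linarith

end Discrete

end ILW

end

theorem mainTheorem3 (δ : ℝ) (hδ : 0 < δ) (u₀ : ℝ → ℝ) (hu : ILW.Admissible u₀) :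
    -- the integrals defining the energy converge on the admissible set
    (∀ ρ ∈ ILW.admissibleDensities δ u₀,
      (∀ κ ∈ Set.Icc 0 (ILW.kappaMax δ u₀),
        IntegrableOn (ILW.potentialIntegrand δ ρ (ILW.zeta δ κ))
          (Set.Icc 0 (ILW.kappaMax δ u₀))) ∧
      ∀ x t : ℝ, IntegrableOn (ILW.energyIntegrand δ u₀ ρ x t)
        (Set.Icc 0 (ILW.kappaMax δ u₀))) ∧
    -- the minimum is attained
    (∀ x t : ℝ, ∃ ρ ∈ ILW.admissibleDensities δ u₀,
      ILW.energy δ u₀ ρ x t = ILW.continuumMin δ u₀ x t ∧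
      ∀ σ ∈ ILW.admissibleDensities δ u₀,
        ILW.energy δ u₀ ρ x t ≤ ILW.energy δ u₀ σ x t) ∧
    -- the discrete minima converge to it, uniformly on compact sets
    ∀ K : Set (ℝ × ℝ), IsCompact K →
      TendstoUniformlyOn (fun (N : ℕ) (p : ℝ × ℝ) => ILW.discreteMin δ u₀ N p.1 p.2)
        (fun p => ILW.continuumMin δ u₀ p.1 p.2) atTop K := by
  obtain ⟨R, Φ, h⟩ := ILW.exists_weylHomeo hδ hu
  refine ⟨fun ρ hρ => ?_, fun x t => ?_, fun K hK => ?_⟩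
  · obtain ⟨f, hf, hfρ⟩ := ILW.exists_unitDensity h hρ
    exact ⟨fun κ hκ => ILW.integrableOn_potentialIntegrand hδ hu h hf hfρ hκ,
      fun x t => (ILW.energy_transfer hδ hu h hf hfρ x t).1⟩
  · obtain ⟨-, -, -, -, hρ⟩ := ILW.exists_minimizer hδ hu h x t
    exact hρ
  · obtain ⟨B, hB⟩ := hK.isBounded.exists_norm_le
    obtain ⟨err, herr, hE⟩ := ILW.exists_min_error hδ hu h (abs_nonneg B)
    rw [Metric.tendstoUniformlyOn_iff]
    intro ε hε
    filter_upwards [herr.eventually_lt_const hε, eventually_ge_atTop 1] with N h1 h2 p hp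
    have hp' := (hB p hp).trans (le_abs_self B)
    rw [dist_comm, Real.dist_eq]
    exact (hE N h2 p.1 p.2 ((norm_fst_le p).trans hp') ((norm_snd_le p).trans hp')).trans_lt h1
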